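/- **Setting.** Fix a calculus of timed networks of smart devices with: infinite sets of node names $n$ and of actuators $a$; channels $c$ with a range $\mathrm{rng}(c)\in\mathbb N\cup\{-1,\infty\}$ (infinitely many channels for each range that occurs); locations $h,k$ with a distance $d(h,k)\in\mathbb N$ ($d(h,h)=0$, $d(h,k)=d(k,h)$); a mobility bound $\delta\in\mathbb N$; sensors $s$, each with a domain of values, some of them location-dependent and the others node-dependent; and at least two values $v$, which include the locations. *Processes:* $P::=\mathsf{nil}\mid\rho.P\mid P|Q\mid\lfloor\pi.P\rfloor Q\mid[b]P;Q\mid X\mid\mathrm{fix}\,X.P$, with intra-node prefixes $\rho\in\{\sigma,\,@(x),\,s?(x),\,a!v\}$ (sleep one time unit, read the location, read a sensor, write an actuator) and communication prefixes $\pi\in\{\bar c\langle v\rangle,\,c(x)\}$ with timeout $Q$; $b$ is a decidable guard on values; recursion is time-guarded, i.e. in $\mathrm{fix}\,X.P$ the variable $X$ occurs in $P$ only inside $Q$ of some $\sigma.Q$ or $\lfloor\pi.P'\rfloor Q$. *Networks:* $M::=\mathbf 0\mid n[I\bowtie P]^\mu_h\mid M|N\mid(\nu c)M$, where $\mu\in\{\mathsf{s},\mathsf{m}\}$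 (stationary or mobile) and $I$ is a finite partial map from sensors and actuators to values. Terms are taken up to $\alpha$-conversion, which for channels preserves the range. All networks considered are closed and *well-formed*: distinct nodes have distinct names, disjoint sets of actuators and disjoint sets of node-dependent sensors; every sensor or actuator occurring in a prefix of the process of a node is in the domain of its interface; and nodes having a location-dependent sensor are stationary. *Structural congruence* $\equiv$ is the least congruence such that $|$ is a commutative monoid (with unit $\mathsf{nil}$, resp. $\mathbf 0$), $[b]P;Q$ equals $P$ or $Q$ according to the value of $b$, $\mathrm{fix}\,X.P\equiv P\{\mathrm{fix}\,X.P/X\}$, $(\nu c)\mathbf 0\equiv\mathbf 0$, $(\nu c)(\nu d)M\equiv(\nu d)(\nu c)M$, and $(\nu c)(M|N)\equiv M|(\nu c)N$ if $c$ is not free in $M$. *Reductions.* $\rightharpoonup_\tau$ and $\rightharpoonup_a$ are the instantaneous reductions. A reduction $\rightharpoonup_\tau$ is a position read, a sensor read, an actuator write that does not change the value, a communication inside a node on a channel of range $-1$, or a communication on $c$ between two nodes at $h$ and $k$ with $d(h,k)\le\mathrm{rng}(c)$; $\rightharpoonup_a$ is a write that changes the value of $a$. Both are closed under parallel composition of processes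 in nodes, parallel composition of networks, restriction and $\equiv$. The timed reduction $\rightharpoonup_\sigma$ is closed under restriction and $\equiv$; it takes $\mathbf 0$ to $\mathbf 0$; it takes a node with process $\prod_i\lfloor\pi_i.P_i\rfloor Q_i\mid\prod_j\sigma.R_j$ that has no $\rightharpoonup_\tau$ to the node with process $\prod_iQ_i\mid\prod_jR_j$ (a mobile node may at the same time move from $h$ to any $k$ with $d(h,k)\le\delta$); and it takes $M|N$ to $M'|N'$ if $M\rightharpoonup_\sigma M'$, $N\rightharpoonup_\sigma N'$ and $M|N\not\rightharpoonup_\tau$. Put $\rightharpoonup\;=\;\rightharpoonup_\tau\cup\rightharpoonup_\sigma$. The *barb* $M\downarrow_{a@h!v}$ means $M\equiv(\nu\tilde g)(n[I\bowtie P]^\mu_h\mid M')$ with $I(a)=v$; and $M\Downarrow_{a@h!v}$ means $M\rightharpoonup^*M'\downarrow_{a@h!v}$ for some $M'$. The *sensor update* $M[s@h\mapsto v]$ sets $s$ to $v$ in all nodes of $M$ located at $h$ whose interface is defined on $s$. *Reduction barbed congruence* $\cong$ is the largest symmetric relation $\mathcal R$ on networks such that $M\mathrel{\mathcal R}N$ implies: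 (i) if $M\rightharpoonup M'$ then $N\rightharpoonup^*N'$ with $M'\mathrel{\mathcal R}N'$ for some $N'$, and, for every actuator $a$, if $M\rightharpoonup_aM'$ then $N\rightharpoonup^*\rightharpoonup_a\rightharpoonup^*N'$ with $M'\mathrel{\mathcal R}N'$ for some $N'$; (ii) if $M\downarrow_{a@h!v}$ then $N\Downarrow_{a@h!v}$; (iii) $M|O\mathrel{\mathcal R}N|O$ for all $O$ such that both are well-formed, $(\nu c)M\mathrel{\mathcal R}(\nu c)N$ for all $c$, and $M[s@h\mapsto v]\mathrel{\mathcal R}N[s@h\mapsto v]$ for all $s,h$ and all $v$ in the domain of $s$. *Labelled semantics.* Let $\xrightarrow{\tau}$, $\xrightarrow{a}$, $\xrightarrow{\sigma}$, $\xrightarrow{\bar cv@h}$, $\xrightarrow{cv@h}$ be the usual structural-operational labelled transitions of networks: internal step, change of actuator $a$, passage of one time unit (only when no $\tau$ is possible), and sending or receiving $v$ along a channel $c$ with $\mathrm{rng}(c)\ge0$ by a node at $h$. The *extensional* transitions are $\xrightarrow{\tau}$, $\xrightarrow{a}$, $\xrightarrow{\sigma}$ together with: $M\xrightarrow{\bar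 cv\triangleright k}M'$ if $M\xrightarrow{\bar cv@h}M'$ for some $h$ with $d(h,k)\le\mathrm{rng}(c)$; $M\xrightarrow{cv\triangleright k}M'$ if $M\xrightarrow{cv@h}M'$ for some $h$ with $d(k,h)\le\mathrm{rng}(c)$; $M\xrightarrow{s@h?v}M[s@h\mapsto v]$ for every $v$ in the domain of $s$; and $M\xrightarrow{a@h!v}M$ if $M\downarrow_{a@h!v}$. Let $\Rightarrow$ be the reflexive and transitive closure of $\xrightarrow{\tau}$, and let $\stackrel{\hat\alpha}{\Rightarrow}$ be $\Rightarrow$ if $\alpha=\tau$ and $\Rightarrow\xrightarrow{\alpha}\Rightarrow$ otherwise. *Bisimilarity* $\approx$ is the union of all symmetric relations $\mathcal R$ on networks such that $M\mathrel{\mathcal R}N$ and $M\xrightarrow{\alpha}M'$, for an extensional $\alpha$, imply $N\stackrel{\hat\alpha}{\Rightarrow}N'$ and $M'\mathrel{\mathcal R}N'$ for some $N'$. **Theorem (Completeness).** For all networks $M$ and $N$, if $M\cong N$ then $M\approx N$. -/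

import Mathlib

universe u

namespace CaIT

/-- The parameters of the calculus: names, values, channel ranges, distances, mobility bound. -/
structure Sig where
  /-- node (device) names -/
  Node : Type u
  /-- channel names -/
  Chan : Type u
  /-- physical locations -/
  Loc : Type u
  /-- sensor names -/
  Sens : Type u
  /-- actuator names -/
  Act : Type u
  /-- values -/
  Val : Type u
  /-- transmission range of a channel: `⊥` stands for `-1` (intra-node), `⊤` for `∞` (Internet) -/
  rng : Chan → WithBot ℕ∞
  /-- distance between two locations -/
  dist : Loc → Loc → ℕ
  dist_self : ∀ h, dist h h = 0
  dist_comm : ∀ h k, dist h k = dist k h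
  /-- maximal distance covered by a mobile node in one time unit -/
  δ : ℕ
  /-- coordinates of locations are values -/
  locVal : Loc ↪ Val
  /-- the location-dependent sensors; all the others are node-dependent -/
  locDep : Sens → Prop
  /-- the domain of a sensor -/
  dom : Sens → Set Val
  infinite_node : Infinite Node
  infinite_act : Infinite Act
  /-- there is always a fresh channel of the same range, as needed for alpha-conversion -/
  infinite_chan : ∀ c, {d | rng d = rng c}.Infinite
  nontrivial_val : Nontrivial Val

/-- `dist h k ≤ rng c` -/
def Sig.InRange (S : Sig.{u}) (c : S.Chan) (h k : S.Loc) : Prop :=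
  (((S.dist h k : ℕ) : ℕ∞) : WithBot ℕ∞) ≤ S.rng c

/-! ### Syntax of processes

Processes are taken up to alpha-conversion: value variables and process variables are de Bruijn
indices, in two separate index spaces. -/

/-- Values and value variables. -/
inductive Expr (S : Sig.{u}) : Type u
  | val (v : S.Val)
  | var (i : ℕ)

/-- Boolean guards: a decidable predicate applied to finitely many values or variables. -/
structure Guard (S : Sig.{u}) : Type u where
  pred : List S.Val → Bool
  args : List (Expr S)

/-- Intra-node prefixes: `σ`, `@(x)`, `s?(x)`, `a!e`. -/
inductive Rho (S : Sig.{u}) : Type u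
  | sleep
  | pos
  | sense (s : S.Sens)
  | write (e : Expr S) (a : S.Act)

/-- Communication prefixes: output of `e` along `c`, input along `c`. -/
inductive Pi (S : Sig.{u}) : Type u
  | out (c : S.Chan) (e : Expr S)
  | inp (c : S.Chan)

/-- Number of value variables bound by a prefix. -/
def Rho.arity {S : Sig.{u}} : Rho S → ℕ
  | .sleep => 0
  | .pos => 1
  | .sense _ => 1
  | .write _ _ => 0

/-- Number of value variables bound by a prefix. -/
def Pi.arity {S : Sig.{u}} : Pi S → ℕ
  | .out _ _ => 0
  | .inp _ => 1

/-- Processes. In `pre ρ P` and `timeout π P Q` the prefix binds value variable `0` of `P` if its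
arity is `1` (never a variable of `Q`); `fix P` binds process variable `0` of `P`. -/
inductive Proc (S : Sig.{u}) : Type u
  | nil
  | pre (ρ : Rho S) (P : Proc S)
  | par (P Q : Proc S)
  | timeout (π : Pi S) (P Q : Proc S)
  | cond (b : Guard S) (P Q : Proc S)
  | pvar (X : ℕ)
  | fix (P : Proc S)

section Substitution

variable {S : Sig.{u}}

/-- Add `n` to all variables `≥ c`. -/
def Expr.shift (c n : ℕ) : Expr S → Expr S
  | .val v => .val v
  | .var i => .var (if i < c then i else i + n)

/-- Substitute the value `v` for variable `k`, lowering the variables above `k`. -/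
def Expr.subst (k : ℕ) (v : S.Val) : Expr S → Expr S
  | .val w => .val w
  | .var i => if i < k then .var i else if i = k then .val v else .var (i - 1)

def Expr.Closed (n : ℕ) : Expr S → Prop
  | .val _ => True
  | .var i => i < n

def Guard.mapExpr (f : Expr S → Expr S) (b : Guard S) : Guard S := ⟨b.pred, b.args.map f⟩

def Guard.Closed (n : ℕ) (b : Guard S) : Prop := ∀ e ∈ b.args, e.Closed n

/-- The guard contains no variables and evaluates to `t`. -/
def Guard.EvalsTo (b : Guard S) (t : Bool) : Prop :=
  ∃ vs : List S.Val, b.args = vs.map Expr.val ∧ b.pred vs = t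

def Rho.mapExpr (f : Expr S → Expr S) : Rho S → Rho S
  | .sleep => .sleep
  | .pos => .pos
  | .sense s => .sense s
  | .write e a => .write (f e) a

def Pi.mapExpr (f : Expr S → Expr S) : Pi S → Pi S
  | .out c e => .out c (f e)
  | .inp c => .inp c

/-- Add `n` to all free value variables `≥ c`. -/
def Proc.shiftV (c n : ℕ) : Proc S → Proc S
  | .nil => .nil
  | .pre ρ P => .pre (ρ.mapExpr (Expr.shift c n)) (P.shiftV (c + ρ.arity) n)
  | .par P Q => .par (P.shiftV c n) (Q.shiftV c n)
  | .timeout π P Q =>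
      .timeout (π.mapExpr (Expr.shift c n)) (P.shiftV (c + π.arity) n) (Q.shiftV c n)
  | .cond b P Q => .cond (b.mapExpr (Expr.shift c n)) (P.shiftV c n) (Q.shiftV c n)
  | .pvar X => .pvar X
  | .fix P => .fix (P.shiftV c n)

/-- Add `1` to all free process variables `≥ c`. -/
def Proc.shiftP (c : ℕ) : Proc S → Proc S
  | .nil => .nil
  | .pre ρ P => .pre ρ (P.shiftP c)
  | .par P Q => .par (P.shiftP c) (Q.shiftP c)
  | .timeout π P Q => .timeout π (P.shiftP c) (Q.shiftP c)
  | .cond b P Q => .cond b (P.shiftP c) (Q.shiftP c)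
  | .pvar X => .pvar (if X < c then X else X + 1)
  | .fix P => .fix (P.shiftP (c + 1))

/-- `P{v/x}`: substitute the value `v` for value variable `k`. -/
def Proc.subst (k : ℕ) (v : S.Val) : Proc S → Proc S
  | .nil => .nil
  | .pre ρ P => .pre (ρ.mapExpr (Expr.subst k v)) (P.subst (k + ρ.arity) v)
  | .par P Q => .par (P.subst k v) (Q.subst k v)
  | .timeout π P Q =>
      .timeout (π.mapExpr (Expr.subst k v)) (P.subst (k + π.arity) v) (Q.subst k v)
  | .cond b P Q => .cond (b.mapExpr (Expr.subst k v)) (P.subst k v) (Q.subst k v)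
  | .pvar X => .pvar X
  | .fix P => .fix (P.subst k v)

/-- `P{R/X}`: substitute the process `R` for process variable `k`, avoiding capture. -/
def Proc.psubst : ℕ → Proc S → Proc S → Proc S
  | _, _, .nil => .nil
  | k, R, .pre ρ P => .pre ρ (Proc.psubst k (R.shiftV 0 ρ.arity) P)
  | k, R, .par P Q => .par (Proc.psubst k R P) (Proc.psubst k R Q)
  | k, R, .timeout π P Q =>
      .timeout π (Proc.psubst k (R.shiftV 0 π.arity) P) (Proc.psubst k R Q)
  | k, R, .cond b P Q => .cond b (Proc.psubst k R P) (Proc.psubst k R Q)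
  | k, R, .pvar X => if X < k then .pvar X else if X = k then R else .pvar (X - 1)
  | k, R, .fix P => .fix (Proc.psubst (k + 1) (R.shiftP 0) P)

/-- The unfolding `P{fix X.P / X}` of `fix X.P`. -/
def Proc.unfold (P : Proc S) : Proc S := Proc.psubst 0 (.fix P) P

/-- All free value variables are `< n` and all free process variables are `< m`. -/
def Proc.Closed : ℕ → ℕ → Proc S → Prop
  | _, _, .nil => True
  | n, m, .pre ρ P =>
      (match ρ with
        | .write e _ => e.Closed n
        | _ => True) ∧ Proc.Closed (n + ρ.arity) m P
  | n, m, .par P Q => Proc.Closed n m P ∧ Proc.Closed n m Q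
  | n, m, .timeout π P Q =>
      (match π with
        | .out _ e => e.Closed n
        | .inp _ => True) ∧ Proc.Closed (n + π.arity) m P ∧ Proc.Closed n m Q
  | n, m, .cond b P Q => b.Closed n ∧ Proc.Closed n m P ∧ Proc.Closed n m Q
  | _, m, .pvar X => X < m
  | n, m, .fix P => Proc.Closed n (m + 1) P

/-- Every free occurrence of process variable `X` is time-guarded, that is, lies inside the
continuation `Q` of some `σ.Q` or of some `⌊π.P⌋Q`. -/
def Proc.TimeGuarded : ℕ → Proc S → Prop
  | _, .nil => True
  | X, .pre ρ P =>
      match ρ with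
      | .sleep => True
      | _ => Proc.TimeGuarded X P
  | X, .par P Q => Proc.TimeGuarded X P ∧ Proc.TimeGuarded X Q
  | X, .timeout _ P _ => Proc.TimeGuarded X P
  | X, .cond _ P Q => Proc.TimeGuarded X P ∧ Proc.TimeGuarded X Q
  | X, .pvar Y => Y ≠ X
  | X, .fix P => Proc.TimeGuarded (X + 1) P

/-- All recursions occurring in the process are time-guarded. -/
def Proc.RecGuarded : Proc S → Prop
  | .nil => True
  | .pre _ P => P.RecGuarded
  | .par P Q => P.RecGuarded ∧ Q.RecGuarded
  | .timeout _ P Q => P.RecGuarded ∧ Q.RecGuarded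
  | .cond _ P Q => P.RecGuarded ∧ Q.RecGuarded
  | .pvar _ => True
  | .fix P => P.TimeGuarded 0 ∧ P.RecGuarded

/-- The channels occurring in a process (no process construct binds channels). -/
def Proc.chans : Proc S → Set S.Chan
  | .nil => ∅
  | .pre _ P => P.chans
  | .par P Q => P.chans ∪ Q.chans
  | .timeout π P Q =>
      (match π with
        | .out c _ => {c}
        | .inp c => {c}) ∪ (P.chans ∪ Q.chans)
  | .cond _ P Q => P.chans ∪ Q.chans
  | .pvar _ => ∅
  | .fix P => P.chans

def Pi.mapChan (f : S.Chan → S.Chan) : Pi S → Pi S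
  | .out c e => .out (f c) e
  | .inp c => .inp (f c)

def Proc.mapChan (f : S.Chan → S.Chan) : Proc S → Proc S
  | .nil => .nil
  | .pre ρ P => .pre ρ (P.mapChan f)
  | .par P Q => .par (P.mapChan f) (Q.mapChan f)
  | .timeout π P Q => .timeout (π.mapChan f) (P.mapChan f) (Q.mapChan f)
  | .cond b P Q => .cond b (P.mapChan f) (Q.mapChan f)
  | .pvar X => .pvar X
  | .fix P => .fix (P.mapChan f)

/-- Finite parallel composition of processes. -/
def Proc.prod (L : List (Proc S)) : Proc S := L.foldr .par .nil

end Substitution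

/-! ### Syntax of networks -/

/-- Physical interfaces: partial maps from sensors and actuators to values. -/
structure Interface (S : Sig.{u}) : Type u where
  sens : S.Sens → Option S.Val
  act : S.Act → Option S.Val

/-- Tags of stationary and mobile nodes. -/
inductive Mobility : Type
  | stat
  | mob

/-- Networks; `node n I P μ h` is a device `n` with interface `I`, process `P`, mobility tag `μ`,
located at `h`, and `res c M` is the restriction of channel `c` to `M`. -/
inductive Net (S : Sig.{u}) : Type u
  | zero
  | node (n : S.Node) (I : Interface S) (P : Proc S) (μ : Mobility) (h : S.Loc)
  | par (M N : Net S)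
  | res (c : S.Chan) (M : Net S)

section Networks

variable {S : Sig.{u}}

open Classical in
/-- `I[s ↦ v]` -/
noncomputable def Interface.setSens (I : Interface S) (s : S.Sens) (v : S.Val) : Interface S :=
  { I with sens := Function.update I.sens s (some v) }

open Classical in
/-- `I[a ↦ v]` -/
noncomputable def Interface.setAct (I : Interface S) (a : S.Act) (v : S.Val) : Interface S :=
  { I with act := Function.update I.act a (some v) }

/-- Every prefix `s?(x)` and `a!v` occurring in the process refers to a sensor or an actuator on
which the interface is defined. -/
def Proc.UsesOnly (I : Interface S) : Proc S → Prop
  | .nil => True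
  | .pre ρ P =>
      (match ρ with
        | .sense s => (I.sens s).isSome
        | .write _ a => (I.act a).isSome
        | _ => True) ∧ P.UsesOnly I
  | .par P Q => P.UsesOnly I ∧ Q.UsesOnly I
  | .timeout _ P Q => P.UsesOnly I ∧ Q.UsesOnly I
  | .cond _ P Q => P.UsesOnly I ∧ Q.UsesOnly I
  | .pvar _ => True
  | .fix P => P.UsesOnly I

/-- Free channels of a network. -/
def Net.freeChans : Net S → Set S.Chan
  | .zero => ∅
  | .node _ _ P _ _ => P.chans
  | .par M N => M.freeChans ∪ N.freeChans
  | .res c M => M.freeChans \ {c}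

/-- Rename all channels, free and bound. -/
def Net.mapChan (f : S.Chan → S.Chan) : Net S → Net S
  | .zero => .zero
  | .node n I P μ h => .node n I (P.mapChan f) μ h
  | .par M N => .par (M.mapChan f) (N.mapChan f)
  | .res c M => .res (f c) (M.mapChan f)

open Classical in
/-- Exchange the channels `c` and `d` everywhere. -/
noncomputable def Net.swapChan (c d : S.Chan) (M : Net S) : Net S := M.mapChan (Equiv.swap c d)

/-- Finite parallel composition of networks. -/
def Net.prod (L : List (Net S)) : Net S := L.foldr .par .zero

/-- `(ν c₁)…(ν cₖ) M` -/
def Net.resList (cs : List S.Chan) (M : Net S) : Net S := cs.foldr .res M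

open Classical in
/-- The sensor update `M[s@h ↦ v]`. -/
noncomputable def Net.update (s : S.Sens) (h : S.Loc) (v : S.Val) : Net S → Net S
  | .zero => .zero
  | .node n I P μ k =>
      if k = h ∧ (I.sens s).isSome then .node n (I.setSens s v) P μ k else .node n I P μ k
  | .par M N => .par (M.update s h v) (N.update s h v)
  | .res c M => .res c (M.update s h v)

end Networks

/-- The data of a single node. -/
structure NodeData (S : Sig.{u}) : Type u where
  name : S.Node
  iface : Interface S
  proc : Proc S
  mob : Mobility
  loc : S.Loc

section WellFormed

variable {S : Sig.{u}}

/-- The list of all nodes of a network. -/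
def Net.nodes : Net S → List (NodeData S)
  | .zero => []
  | .node n I P μ h => [⟨n, I, P, μ, h⟩]
  | .par M N => M.nodes ++ N.nodes
  | .res _ M => M.nodes

/-- A single well-formed node: a finite interface; a closed process in which recursion is
time-guarded and which only uses sensors and actuators of the interface; location-dependent
sensors only if the node is stationary. -/
structure NodeData.WF (x : NodeData S) : Prop where
  finite_sens : {s | (x.iface.sens s).isSome}.Finite
  finite_act : {a | (x.iface.act a).isSome}.Finite
  closed : x.proc.Closed 0 0
  guarded : x.proc.RecGuarded
  usesOnly : x.proc.UsesOnly x.iface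
  stationary : ∀ s, S.locDep s → (x.iface.sens s).isSome → x.mob = .stat

/-- Different nodes have different names, different actuators and different node-dependent
sensors. -/
structure NodeData.Compatible (x y : NodeData S) : Prop where
  name_ne : x.name ≠ y.name
  act_disj : ∀ a, ¬ ((x.iface.act a).isSome ∧ (y.iface.act a).isSome)
  sens_disj : ∀ s, ¬ S.locDep s → ¬ ((x.iface.sens s).isSome ∧ (y.iface.sens s).isSome)

/-- Well-formed (closed) networks. -/
def Net.WF (M : Net S) : Prop :=
  (∀ x ∈ M.nodes, x.WF) ∧ M.nodes.Pairwise NodeData.Compatible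

end WellFormed

/-! ### Structural congruence -/

section Congruence

variable {S : Sig.{u}}

/-- Structural congruence of processes. -/
inductive ProcEq : Proc S → Proc S → Prop
  | refl (P) : ProcEq P P
  | symm {P Q} : ProcEq P Q → ProcEq Q P
  | trans {P Q R} : ProcEq P Q → ProcEq Q R → ProcEq P R
  | pre (ρ) {P P'} : ProcEq P P' → ProcEq (.pre ρ P) (.pre ρ P')
  | par {P P' Q Q'} : ProcEq P P' → ProcEq Q Q' → ProcEq (.par P Q) (.par P' Q')
  | timeout (π) {P P' Q Q'} :
      ProcEq P P' → ProcEq Q Q' → ProcEq (.timeout π P Q) (.timeout π P' Q')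
  | cond (b) {P P' Q Q'} : ProcEq P P' → ProcEq Q Q' → ProcEq (.cond b P Q) (.cond b P' Q')
  | fix {P P'} : ProcEq P P' → ProcEq (.fix P) (.fix P')
  | par_nil (P) : ProcEq (.par P .nil) P
  | par_comm (P Q) : ProcEq (.par P Q) (.par Q P)
  | par_assoc (P Q R) : ProcEq (.par (.par P Q) R) (.par P (.par Q R))
  | cond_true {b} (P Q) : b.EvalsTo true → ProcEq (.cond b P Q) P
  | cond_false {b} (P Q) : b.EvalsTo false → ProcEq (.cond b P Q) Q
  | unfold (P) : ProcEq (.fix P) P.unfold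

/-- Structural congruence of networks. The constructor `alpha` is alpha-conversion of bound
channels; as the range of a channel is part of its meaning, it preserves ranges. -/
inductive NetEq : Net S → Net S → Prop
  | refl (M) : NetEq M M
  | symm {M N} : NetEq M N → NetEq N M
  | trans {M N O} : NetEq M N → NetEq N O → NetEq M O
  | par {M M' N N'} : NetEq M M' → NetEq N N' → NetEq (.par M N) (.par M' N')
  | res (c) {M M'} : NetEq M M' → NetEq (.res c M) (.res c M')
  | alpha (c d M) : S.rng d = S.rng c → d ∉ M.freeChans →
      NetEq (.res c M) (.res d (M.swapChan c d))
  | node {P Q} (n I μ h) : ProcEq P Q → NetEq (.node n I P μ h) (.node n I Q μ h)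
  | par_zero (M) : NetEq (.par M .zero) M
  | par_comm (M N) : NetEq (.par M N) (.par N M)
  | par_assoc (M N O) : NetEq (.par (.par M N) O) (.par M (.par N O))
  | res_zero (c) : NetEq (.res c .zero) .zero
  | res_comm (c d M) : NetEq (.res c (.res d M)) (.res d (.res c M))
  | res_par (c M N) : c ∉ M.freeChans → NetEq (.res c (.par M N)) (.par M (.res c N))

end Congruence

/-! ### Reduction semantics -/

/-- Labels of instantaneous reductions: `τ`, or the change of an actuator `a`. -/
inductive RLabel (S : Sig.{u}) : Type u
  | tau
  | act (a : S.Act)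

section Reduction

variable {S : Sig.{u}}

/-- The instantaneous reductions `M ⇀_ω N`, `ω ∈ {τ, a}`. -/
inductive Red : RLabel S → Net S → Net S → Prop
  | pos (n I P μ h) :
      Red .tau (.node n I (.pre .pos P) μ h) (.node n I (P.subst 0 (S.locVal h)) μ h)
  | sensread (n) {I : Interface S} {s v} (P μ h) : I.sens s = some v →
      Red .tau (.node n I (.pre (.sense s) P) μ h) (.node n I (P.subst 0 v) μ h)
  | actunchg (n) {I : Interface S} {a v} (P μ h) : I.act a = some v →
      Red .tau (.node n I (.pre (.write (.val v) a) P) μ h) (.node n I P μ h)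
  | actchg (n) {I : Interface S} {a v} (P μ h) : I.act a ≠ some v →
      Red (.act a) (.node n I (.pre (.write (.val v) a) P) μ h) (.node n (I.setAct a v) P μ h)
  | loccom (n I μ h) {c} (v P R Q T) : S.rng c = ⊥ →
      Red .tau
        (.node n I (.par (.timeout (.out c (.val v)) P R) (.timeout (.inp c) Q T)) μ h)
        (.node n I (.par P (Q.subst 0 v)) μ h)
  | glbcom (n m I J μ₁ μ₂) {c h k} (v P R Q T) : S.InRange c h k →
      Red .tau
        (.par (.node n I (.timeout (.out c (.val v)) P R) μ₁ h)
          (.node m J (.timeout (.inp c) Q T) μ₂ k))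
        (.par (.node n I P μ₁ h) (.node m J (Q.subst 0 v) μ₂ k))
  | parp {ω} (r : ℕ) (n : ℕ → S.Node) (I I' : ℕ → Interface S) (P P' Q : ℕ → Proc S)
      (μ μ' : ℕ → Mobility) (h h' : ℕ → S.Loc) :
      Red ω
        (Net.prod ((List.range r).map fun i => .node (n i) (I i) (P i) (μ i) (h i)))
        (Net.prod ((List.range r).map fun i => .node (n i) (I' i) (P' i) (μ' i) (h' i))) →
      Red ω
        (Net.prod ((List.range r).map fun i =>
          .node (n i) (I i) (.par (P i) (Q i)) (μ i) (h i)))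
        (Net.prod ((List.range r).map fun i =>
          .node (n i) (I' i) (.par (P' i) (Q i)) (μ' i) (h' i)))
  | parn {ω M M'} (N) : Red ω M M' → Red ω (.par M N) (.par M' N)
  | res {ω M M'} (c) : Red ω M M' → Red ω (.res c M) (.res c M')
  | struct {ω M N N' M'} : NetEq M N → Red ω N N' → NetEq N' M' → Red ω M M'

/-- The process `∏ᵢ ⌊πᵢ.Pᵢ⌋Qᵢ | ∏ⱼ σ.Rⱼ`, given the triples `(πᵢ, Pᵢ, Qᵢ)` and the `Rⱼ`. -/
def Proc.waiting (ts : List (Pi S × Proc S × Proc S)) (rs : List (Proc S)) : Proc S :=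
  .par (Proc.prod (ts.map fun t => .timeout t.1 t.2.1 t.2.2))
    (Proc.prod (rs.map fun R => .pre .sleep R))

/-- The process `∏ᵢ Qᵢ | ∏ⱼ Rⱼ`. -/
def Proc.resumed (ts : List (Pi S × Proc S × Proc S)) (rs : List (Proc S)) : Proc S :=
  .par (Proc.prod (ts.map fun t => t.2.2)) (Proc.prod rs)

/-- The timed reduction `M ⇀_σ N`. -/
inductive RedTime : Net S → Net S → Prop
  | timestat (n I ts rs h) : (¬ ∃ M', Red .tau (.node n I (Proc.waiting ts rs) .stat h) M') →
      RedTime (.node n I (Proc.waiting ts rs) .stat h) (.node n I (Proc.resumed ts rs) .stat h)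
  | timemob (n I ts rs) {h k} : (¬ ∃ M', Red .tau (.node n I (Proc.waiting ts rs) .mob h) M') →
      S.dist h k ≤ S.δ →
      RedTime (.node n I (Proc.waiting ts rs) .mob h) (.node n I (Proc.resumed ts rs) .mob k)
  | timepar {M M' N N'} : RedTime M M' → RedTime N N' → (¬ ∃ O, Red .tau (.par M N) O) →
      RedTime (.par M N) (.par M' N')
  | timezero : RedTime .zero .zero
  | res {M M'} (c) : RedTime M M' → RedTime (.res c M) (.res c M')
  | struct {M N N' M'} : NetEq M N → RedTime N N' → NetEq N' M' → RedTime M M'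

/-- The barb `M ↓ a@h!v`: some node of `M` at `h` displays `v` on the actuator `a`. -/
def Net.Barb (M : Net S) (a : S.Act) (h : S.Loc) (v : S.Val) : Prop :=
  ∃ (gs : List S.Chan) (n : S.Node) (I : Interface S) (P : Proc S) (μ : Mobility) (M' : Net S),
    NetEq M (Net.resList gs (.par (.node n I P μ h) M')) ∧ I.act a = some v

end Reduction

/-! ### Labelled transition semantics -/

/-- Labels of process transitions other than `σ`. -/
inductive PLabel (S : Sig.{u}) : Type u
  | tau
  | out (c : S.Chan) (v : S.Val)
  | inp (c : S.Chan) (v : S.Val)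
  | pos (h : S.Loc)
  | sens (s : S.Sens) (v : S.Val)
  | act (a : S.Act) (v : S.Val)

/-- Labels of network transitions other than `σ`. -/
inductive NLabel (S : Sig.{u}) : Type u
  | tau
  | act (a : S.Act)
  | snd (c : S.Chan) (v : S.Val) (h : S.Loc)
  | rcv (c : S.Chan) (v : S.Val) (h : S.Loc)

/-- Labels of extensional transitions. -/
inductive ELabel (S : Sig.{u}) : Type u
  | tau
  | sigma
  | act (a : S.Act)
  | sndObs (c : S.Chan) (v : S.Val) (k : S.Loc)
  | rcvObs (c : S.Chan) (v : S.Val) (k : S.Loc)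
  | sensEnv (s : S.Sens) (h : S.Loc) (v : S.Val)
  | actEnv (a : S.Act) (h : S.Loc) (v : S.Val)

section LTS

variable {S : Sig.{u}}

/-- Process transitions `P --λ--> Q` with `λ ≠ σ`. -/
inductive ProcStep : Proc S → PLabel S → Proc S → Prop
  | sndP (c v P Q) : ProcStep (.timeout (.out c (.val v)) P Q) (.out c v) P
  | rcvP (c v P Q) : ProcStep (.timeout (.inp c) P Q) (.inp c v) (P.subst 0 v)
  | sensor (s v P) : ProcStep (.pre (.sense s) P) (.sens s v) (P.subst 0 v)
  | actuator (a v P) : ProcStep (.pre (.write (.val v) a) P) (.act a v) P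
  | posP (h P) : ProcStep (.pre .pos P) (.pos h) (P.subst 0 (S.locVal h))
  | comL {P P' Q Q' c v} : ProcStep P (.out c v) P' → ProcStep Q (.inp c v) Q' →
      S.rng c = ⊥ → ProcStep (.par P Q) .tau (.par P' Q')
  | comR {P P' Q Q' c v} : ProcStep P (.inp c v) P' → ProcStep Q (.out c v) Q' →
      S.rng c = ⊥ → ProcStep (.par P Q) .tau (.par P' Q')
  | parL {P P' l} (Q) : ProcStep P l P' → ProcStep (.par P Q) l (.par P' Q)
  | parR {Q Q' l} (P) : ProcStep Q l Q' → ProcStep (.par P Q) l (.par P Q')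
  | fix {P Q l} : ProcStep P.unfold l Q → ProcStep (.fix P) l Q
  | condT {b P P' l} (Q) : b.EvalsTo true → ProcStep P l P' → ProcStep (.cond b P Q) l P'
  | condF {b Q Q' l} (P) : b.EvalsTo false → ProcStep Q l Q' → ProcStep (.cond b P Q) l Q'

/-- Process transitions `P --σ--> Q`. -/
inductive ProcTime : Proc S → Proc S → Prop
  | timeNil : ProcTime .nil .nil
  | delay (P) : ProcTime (.pre .sleep P) P
  | timeout (π P Q) : ProcTime (.timeout π P Q) Q
  | par {P P' Q Q'} : ProcTime P P' → ProcTime Q Q' → (¬ ∃ R, ProcStep (.par P Q) .tau R) →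
      ProcTime (.par P Q) (.par P' Q')
  | fix {P Q} : ProcTime P.unfold Q → ProcTime (.fix P) Q
  | condT {b P P'} (Q) : b.EvalsTo true → ProcTime P P' → ProcTime (.cond b P Q) P'
  | condF {b Q Q'} (P) : b.EvalsTo false → ProcTime Q Q' → ProcTime (.cond b P Q) Q'

/-- Intensional network transitions `M --ν--> N` with `ν ≠ σ`. -/
inductive NetStep : Net S → NLabel S → Net S → Prop
  | pos {P P' h} (n I μ) : ProcStep P (.pos h) P' →
      NetStep (.node n I P μ h) .tau (.node n I P' μ h)
  | sensRead {P P' s v} (n) {I : Interface S} (μ h) : I.sens s = some v →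
      ProcStep P (.sens s v) P' → NetStep (.node n I P μ h) .tau (.node n I P' μ h)
  | actUnChg {P P' a v} (n) {I : Interface S} (μ h) : I.act a = some v →
      ProcStep P (.act a v) P' → NetStep (.node n I P μ h) .tau (.node n I P' μ h)
  | locCom {P P'} (n I μ h) : ProcStep P .tau P' →
      NetStep (.node n I P μ h) .tau (.node n I P' μ h)
  | actChg {P P' a v} (n) {I : Interface S} (μ h) : I.act a ≠ some v →
      ProcStep P (.act a v) P' →
      NetStep (.node n I P μ h) (.act a) (.node n (I.setAct a v) P' μ h)
  | snd {P P' c v} (n I μ h) : ProcStep P (.out c v) P' → 0 ≤ S.rng c →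
      NetStep (.node n I P μ h) (.snd c v h) (.node n I P' μ h)
  | rcv {P P' c v} (n I μ h) : ProcStep P (.inp c v) P' → 0 ≤ S.rng c →
      NetStep (.node n I P μ h) (.rcv c v h) (.node n I P' μ h)
  | glbComL {M M' N N' c v h k} : NetStep M (.snd c v k) M' → NetStep N (.rcv c v h) N' →
      S.InRange c h k → NetStep (.par M N) .tau (.par M' N')
  | glbComR {M M' N N' c v h k} : NetStep M (.rcv c v h) M' → NetStep N (.snd c v k) N' →
      S.InRange c h k → NetStep (.par M N) .tau (.par M' N')
  | parL {M M' l} (N) : NetStep M l M' → NetStep (.par M N) l (.par M' N)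
  | parR {N N' l} (M) : NetStep N l N' → NetStep (.par M N) l (.par M N')
  | res {M M' l} (c) : NetStep M l M' → (∀ v h, l ≠ .snd c v h ∧ l ≠ .rcv c v h) →
      NetStep (.res c M) l (.res c M')

/-- Intensional network transitions `M --σ--> N`. -/
inductive NetTime : Net S → Net S → Prop
  | timeStat {P P'} (n I h) : ProcTime P P' → (¬ ∃ M', NetStep (.node n I P .stat h) .tau M') →
      NetTime (.node n I P .stat h) (.node n I P' .stat h)
  | timeMob {P P' h k} (n I) : ProcTime P P' → (¬ ∃ M', NetStep (.node n I P .mob h) .tau M') →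
      S.dist h k ≤ S.δ → NetTime (.node n I P .mob h) (.node n I P' .mob k)
  | timePar {M M' N N'} : NetTime M M' → NetTime N N' → (¬ ∃ O, NetStep (.par M N) .tau O) →
      NetTime (.par M N) (.par M' N')
  | timeZero : NetTime .zero .zero
  | res {M M'} (c) : NetTime M M' → NetTime (.res c M) (.res c M')

/-- Extensional transitions. -/
inductive ExtStep : Net S → ELabel S → Net S → Prop
  | tau {M M'} : NetStep M .tau M' → ExtStep M .tau M'
  | sigma {M M'} : NetTime M M' → ExtStep M .sigma M'
  | act {M M' a} : NetStep M (.act a) M' → ExtStep M (.act a) M'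
  | sndObs {M M' c v h k} : NetStep M (.snd c v h) M' → S.InRange c h k →
      ExtStep M (.sndObs c v k) M'
  | rcvObs {M M' c v h k} : NetStep M (.rcv c v h) M' → S.InRange c k h →
      ExtStep M (.rcvObs c v k) M'
  | sensEnv (M) {s v} (h) : v ∈ S.dom s → ExtStep M (.sensEnv s h v) (M.update s h v)
  | actEnv {M a h v} : M.Barb a h v → ExtStep M (.actEnv a h v) M

end LTS

/-! ### The two behavioural equivalences, over well-formed networks -/

/-- Well-formed networks. -/
abbrev Network (S : Sig.{u}) : Type u := {M : Net S // M.WF}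

section Equivalences

variable {S : Sig.{u}}

theorem Interface.isSome_setSens {I : Interface S} {s : S.Sens} (v : S.Val)
    (hs : (I.sens s).isSome) (t : S.Sens) :
    ((I.setSens s v).sens t).isSome = (I.sens t).isSome := by
  unfold Interface.setSens
  by_cases h : t = s
  · subst h; simp [hs]
  · simp [Function.update, h]

theorem Proc.UsesOnly.mono {I J : Interface S} (hs : ∀ s, (J.sens s).isSome = (I.sens s).isSome)
    (ha : ∀ a, (J.act a).isSome = (I.act a).isSome) (P : Proc S) (h : P.UsesOnly I) :
    P.UsesOnly J := by
  induction P with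
  | nil => trivial
  | pre ρ P ih => exact ⟨by cases ρ <;> simp_all [Proc.UsesOnly], ih h.2⟩
  | par P Q ih₁ ih₂ => exact ⟨ih₁ h.1, ih₂ h.2⟩
  | timeout π P Q ih₁ ih₂ => exact ⟨ih₁ h.1, ih₂ h.2⟩
  | cond b P Q ih₁ ih₂ => exact ⟨ih₁ h.1, ih₂ h.2⟩
  | pvar X => trivial
  | fix P ih => exact ih h

/-- The two nodes differ at most in the values of their interfaces. -/
structure NodeData.SameShape (x y : NodeData S) : Prop where
  name : y.name = x.name
  proc : y.proc = x.proc
  mob : y.mob = x.mob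
  sens : ∀ s, (y.iface.sens s).isSome = (x.iface.sens s).isSome
  act : ∀ a, (y.iface.act a).isSome = (x.iface.act a).isSome

theorem Net.update_nodes (s : S.Sens) (h : S.Loc) (v : S.Val) (M : Net S) :
    List.Forall₂ NodeData.SameShape M.nodes (M.update s h v).nodes := by
  induction M with
  | zero => exact .nil
  | node n I P μ k =>
    unfold Net.update
    split
    · rename_i hk
      exact .cons ⟨rfl, rfl, rfl, Interface.isSome_setSens v hk.2, fun _ => rfl⟩ .nil
    · exact .cons ⟨rfl, rfl, rfl, fun _ => rfl, fun _ => rfl⟩ .nil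
  | par M N ih₁ ih₂ => exact List.rel_append ih₁ ih₂
  | res c M ih => exact ih

theorem NodeData.WF.of_sameShape {x y : NodeData S} (h : x.SameShape y) (hx : x.WF) : y.WF where
  finite_sens := by simpa only [h.sens] using hx.finite_sens
  finite_act := by simpa only [h.act] using hx.finite_act
  closed := h.proc ▸ hx.closed
  guarded := h.proc ▸ hx.guarded
  usesOnly := h.proc ▸ Proc.UsesOnly.mono h.sens h.act _ hx.usesOnly
  stationary s h₁ h₂ := h.mob ▸ hx.stationary s h₁ (h.sens s ▸ h₂)

theorem NodeData.Compatible.of_sameShape {x x' y y' : NodeData S} (hx : x.SameShape x')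
    (hy : y.SameShape y') (h : x.Compatible y) : x'.Compatible y' where
  name_ne := by rw [hx.name, hy.name]; exact h.name_ne
  act_disj a := by rw [hx.act, hy.act]; exact h.act_disj a
  sens_disj s hs := by rw [hx.sens, hy.sens]; exact h.sens_disj s hs

theorem Net.WF.update {M : Net S} (hM : M.WF) (s : S.Sens) (h : S.Loc) (v : S.Val) :
    (M.update s h v).WF := by
  have key : ∀ {L L' : List (NodeData S)}, List.Forall₂ NodeData.SameShape L L' →
      (∀ x ∈ L, x.WF) ∧ L.Pairwise NodeData.Compatible →
      (∀ x ∈ L', x.WF) ∧ L'.Pairwise NodeData.Compatible := by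
    intro L L' hL
    induction hL with
    | nil => exact id
    | @cons x x' L L' hx hL ih =>
      rintro ⟨h₁, h₂⟩
      rw [List.pairwise_cons] at h₂
      obtain ⟨i₁, i₂⟩ := ih ⟨fun y hy => h₁ y (List.mem_cons_of_mem _ hy), h₂.2⟩
      refine ⟨?_, List.pairwise_cons.2 ⟨?_, i₂⟩⟩
      · intro y hy
        rcases List.mem_cons.1 hy with rfl | hy
        · exact (h₁ x List.mem_cons_self).of_sameShape hx
        · exact i₁ y hy
      · intro y' hy'
        obtain ⟨i, hi, rfl⟩ := List.mem_iff_getElem.1 hy'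
        have hi' : i < L.length := hL.length_eq ▸ hi
        exact (h₂.1 _ (List.getElem_mem hi')).of_sameShape hx (hL.get hi' hi)
  exact key (Net.update_nodes s h v M) hM

/-- `(ν c) M` -/
def Network.res (c : S.Chan) (M : Network S) : Network S := ⟨.res c M.1, M.2⟩

/-- `M[s@h ↦ v]` -/
noncomputable def Network.update (s : S.Sens) (h : S.Loc) (v : S.Val) (M : Network S) :
    Network S := ⟨M.1.update s h v, M.2.update s h v⟩

/-- The reduction `M ⇀ N`, the union of `⇀_τ` and `⇀_σ`. -/
def Network.Reduces (M N : Network S) : Prop := Red .tau M.1 N.1 ∨ RedTime M.1 N.1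

/-- `M ⇀* N` -/
def Network.ReducesMany : Network S → Network S → Prop :=
  Relation.ReflTransGen Network.Reduces

/-- `M ⇀_a N` -/
def Network.ReducesAct (a : S.Act) (M N : Network S) : Prop := Red (.act a) M.1 N.1

def Network.Barb (M : Network S) (a : S.Act) (h : S.Loc) (v : S.Val) : Prop := M.1.Barb a h v

/-- The weak barb `M ⇓ a@h!v`. -/
def Network.WeakBarb (M : Network S) (a : S.Act) (h : S.Loc) (v : S.Val) : Prop :=
  ∃ M' : Network S, M.ReducesMany M' ∧ M'.Barb a h v

def BarbPreserving (R : Network S → Network S → Prop) : Prop :=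
  ∀ M N, R M N → ∀ a h v, M.Barb a h v → N.WeakBarb a h v

def ReductionClosed (R : Network S → Network S → Prop) : Prop :=
  ∀ M N, R M N →
    (∀ M', M.Reduces M' → ∃ N', N.ReducesMany N' ∧ R M' N') ∧
    (∀ a M', M.ReducesAct a M' →
      ∃ N₁ N₂ N', N.ReducesMany N₁ ∧ N₁.ReducesAct a N₂ ∧ N₂.ReducesMany N' ∧ R M' N')

def Contextual (R : Network S → Network S → Prop) : Prop :=
  ∀ M N, R M N →
    (∀ (O : Net S) (hM : (Net.par M.1 O).WF) (hN : (Net.par N.1 O).WF),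
      R ⟨.par M.1 O, hM⟩ ⟨.par N.1 O, hN⟩) ∧
    (∀ c, R (M.res c) (N.res c)) ∧
    (∀ s h v, v ∈ S.dom s → R (M.update s h v) (N.update s h v))

/-- Reduction barbed congruence `M ≅ N`: the largest symmetric relation which is reduction closed,
barb preserving and contextual (the union of all such relations). -/
def RBCongruent (M N : Network S) : Prop :=
  ∃ R : Network S → Network S → Prop,
    (∀ M N, R M N → R N M) ∧ ReductionClosed R ∧ BarbPreserving R ∧ Contextual R ∧ R M N

/-- Extensional transitions between well-formed networks. -/
def Network.Trans (M : Network S) (α : ELabel S) (N : Network S) : Prop := ExtStep M.1 α N.1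

/-- The reflexive and transitive closure of `τ`-transitions. -/
def Network.TauMany : Network S → Network S → Prop :=
  Relation.ReflTransGen fun M N => M.Trans .tau N

/-- The weak transition labelled `α̂`: `⇒` if `α = τ`, and `⇒ --α--> ⇒` otherwise. -/
def Network.WeakTrans (M : Network S) (α : ELabel S) (N : Network S) : Prop :=
  (α = .tau ∧ M.TauMany N) ∨
    (α ≠ .tau ∧ ∃ M₁ M₂, M.TauMany M₁ ∧ M₁.Trans α M₂ ∧ M₂.TauMany N)

def IsBisimulation (R : Network S → Network S → Prop) : Prop :=
  (∀ M N, R M N → R N M) ∧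
    ∀ M N, R M N → ∀ α M', M.Trans α M' → ∃ N', N.WeakTrans α N' ∧ R M' N'

/-- Bisimilarity `M ≈ N`. -/
def Bisimilar (M N : Network S) : Prop :=
  ∃ R : Network S → Network S → Prop, IsBisimulation R ∧ R M N

end Equivalences

end CaIT

namespace CaIT

/-! ### Commutation laws for shifts, substitutions and channel renamings of de Bruijn terms -/

section ProcessSubstitution

variable {S : Sig.{u}}

/-! Bisimilarity asks that a single transition be matched by the same weak transition, whereas the
congruence only asks that a reduction be matched by some sequence of internal steps and passages of
time. Every extensional label therefore has to be recognised by a context, and the context must also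
control how much time passes during the match.

The main device uses the fact that `⇀` does not contain the changes of actuators. A node whose
process is a pending write that would change a fresh actuator cannot let time pass, and no reduction
`⇀` removes that write. Beside such a blocker all matching takes place within the current time unit;
hence barbs are matched at once (`NetCong.strongBarb`) and changes of actuators are matched by
`τ`-steps around one change (`NetCong.weakAct`).

A timer is a silent context `K₀` which sleeps for one time unit and then becomes a blocker `K₁` on
an actuator `a`; once `a` is changed, it becomes an inert `K₂`. Since `K₁` can change `a` now and
`K₀` cannot, `K₁ | U` and `K₀ | V` are never congruent (`Timer.not_netCong`). In congruent networks
the timers are thus in the same state: a `τ`-step or a change of an actuator beside `K₀` is matched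
without time passing (`Timer.tau`, `Timer.act`), and one time step is matched by exactly one
(`Timer.netTime_match`).

Communications are observed by probes. A node placed at the location of the label sends or receives
on the channel and then can change a fresh actuator, for a receiver only if the value is the
expected one. Matching the communication and then the change shows that the other network has
performed the same communication (`Probe.detect`).

A used timer or probe leaves an inert node behind. Instead of being removed from the congruence, it
is absorbed into the timer. This is why the bisimulation is `TimedCong`, congruence in the presence
of some timer, and not the congruence itself. It contains the congruence because a fresh timer can
always be added. If there is no location, no context can be built, but then there are no nodes
either and all networks are bisimilar.

The rest connects the two semantics: structural congruence is compatible with transitions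
(`BStep.conv`, `NetEq.netSim`, `NetEq.timeStep`), so on well-formed networks reductions are
transitions up to `≡` (`Red.netStep`, `RedTime.netTime`), and conversely (`NetStep.red`,
`NetTime.redTime`). -/

@[simp] theorem Rho.arity_mapExpr (f : Expr S → Expr S) (ρ : Rho S) :
    (ρ.mapExpr f).arity = ρ.arity := by cases ρ <;> rfl

@[simp] theorem Pi.arity_mapExpr (f : Expr S → Expr S) (π : Pi S) :
    (π.mapExpr f).arity = π.arity := by cases π <;> rfl

@[simp] theorem Pi.arity_mapChan (f : S.Chan → S.Chan) (π : Pi S) :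
    (π.mapChan f).arity = π.arity := by cases π <;> rfl

theorem Rho.mapExpr_mapExpr (f g : Expr S → Expr S) (ρ : Rho S) :
    (ρ.mapExpr f).mapExpr g = ρ.mapExpr (g ∘ f) := by cases ρ <;> rfl

theorem Pi.mapExpr_mapExpr (f g : Expr S → Expr S) (π : Pi S) :
    (π.mapExpr f).mapExpr g = π.mapExpr (g ∘ f) := by cases π <;> rfl

theorem Guard.mapExpr_mapExpr (f g : Expr S → Expr S) (b : Guard S) :
    (b.mapExpr f).mapExpr g = b.mapExpr (g ∘ f) := by simp [Guard.mapExpr]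

theorem Expr.shift_comp_shift {b c : ℕ} (m n : ℕ) (h : b ≤ c) :
    (Expr.shift (c + m) n ∘ Expr.shift b m : Expr S → Expr S) =
      Expr.shift b m ∘ Expr.shift c n := by
  funext e
  cases e with
  | val => rfl
  | var i =>
    simp only [Function.comp, Expr.shift]
    congr 1
    split_ifs <;> omega

theorem Expr.subst_comp_shift {b k : ℕ} (m : ℕ) (v : S.Val) (h : b ≤ k) :
    (Expr.subst (k + m) v ∘ Expr.shift b m : Expr S → Expr S) =
      Expr.shift b m ∘ Expr.subst k v := by
  funext e
  cases e with
  | val => rfl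
  | var i =>
    simp only [Function.comp, Expr.shift, Expr.subst]
    split_ifs <;> first | omega | rfl | (congr 1; split_ifs <;> omega)

theorem Proc.shiftV_shiftV (P : Proc S) : ∀ {b c : ℕ} (m n : ℕ), b ≤ c →
    (P.shiftV b m).shiftV (c + m) n = (P.shiftV c n).shiftV b m := by
  induction P with
  | nil | pvar => intros; rfl
  | pre ρ P ih =>
    intro b c m n h
    simp only [Proc.shiftV, Rho.mapExpr_mapExpr, Expr.shift_comp_shift m n h, Rho.arity_mapExpr]
    rw [Nat.add_right_comm, ih m n (by omega)]
  | par P Q ih₁ ih₂ => intro b c m n h; simp only [Proc.shiftV, ih₁ m n h, ih₂ m n h]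
  | timeout π P Q ih₁ ih₂ =>
    intro b c m n h
    simp only [Proc.shiftV, Pi.mapExpr_mapExpr, Expr.shift_comp_shift m n h, Pi.arity_mapExpr,
      ih₂ m n h]
    rw [Nat.add_right_comm, ih₁ m n (by omega)]
  | cond g P Q ih₁ ih₂ =>
    intro b c m n h
    simp only [Proc.shiftV, Guard.mapExpr_mapExpr, Expr.shift_comp_shift m n h, ih₁ m n h,
      ih₂ m n h]
  | fix P ih => intro b c m n h; simp only [Proc.shiftV, ih m n h]

theorem Proc.subst_shiftV (P : Proc S) : ∀ {b k : ℕ} (m : ℕ) (v : S.Val), b ≤ k →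
    (P.shiftV b m).subst (k + m) v = (P.subst k v).shiftV b m := by
  induction P with
  | nil | pvar => intros; rfl
  | pre ρ P ih =>
    intro b k m v h
    simp only [Proc.shiftV, Proc.subst, Rho.mapExpr_mapExpr, Expr.subst_comp_shift m v h,
      Rho.arity_mapExpr]
    rw [Nat.add_right_comm, ih m v (by omega)]
  | par P Q ih₁ ih₂ => intro b k m v h; simp only [Proc.shiftV, Proc.subst, ih₁ m v h, ih₂ m v h]
  | timeout π P Q ih₁ ih₂ =>
    intro b k m v h
    simp only [Proc.shiftV, Proc.subst, Pi.mapExpr_mapExpr, Expr.subst_comp_shift m v h,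
      Pi.arity_mapExpr, ih₂ m v h]
    rw [Nat.add_right_comm, ih₁ m v (by omega)]
  | cond g P Q ih₁ ih₂ =>
    intro b k m v h
    simp only [Proc.shiftV, Proc.subst, Guard.mapExpr_mapExpr, Expr.subst_comp_shift m v h,
      ih₁ m v h, ih₂ m v h]
  | fix P ih => intro b k m v h; simp only [Proc.shiftV, Proc.subst, ih m v h]

theorem Proc.shiftV_shiftP (P : Proc S) : ∀ (b c n : ℕ),
    (P.shiftP b).shiftV c n = (P.shiftV c n).shiftP b := by
  induction P <;> intros <;> simp_all [Proc.shiftV, Proc.shiftP]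

theorem Proc.subst_shiftP (P : Proc S) : ∀ (b k : ℕ) (v : S.Val),
    (P.shiftP b).subst k v = (P.subst k v).shiftP b := by
  induction P <;> intros <;> simp_all [Proc.subst, Proc.shiftP]

theorem Proc.shiftP_shiftP (P : Proc S) : ∀ {b c : ℕ}, b ≤ c →
    (P.shiftP b).shiftP (c + 1) = (P.shiftP c).shiftP b := by
  induction P with
  | nil => intros; rfl
  | pvar X =>
    intro b c h
    simp only [Proc.shiftP]
    congr 1
    split_ifs <;> omega
  | pre ρ P ih => intro b c h; simp only [Proc.shiftP, ih h]
  | par P Q ih₁ ih₂ | timeout π P Q ih₁ ih₂ | cond g P Q ih₁ ih₂ =>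
    intro b c h; simp only [Proc.shiftP, ih₁ h, ih₂ h]
  | fix P ih => intro b c h; simp only [Proc.shiftP, ih (Nat.succ_le_succ h)]

theorem Proc.psubst_shiftV (P : Proc S) : ∀ (j : ℕ) (R : Proc S) (c n : ℕ),
    (Proc.psubst j R P).shiftV c n = Proc.psubst j (R.shiftV c n) (P.shiftV c n) := by
  induction P with
  | nil => intros; rfl
  | pvar X => intro j R c n; simp only [Proc.shiftV, Proc.psubst]; split_ifs <;> rfl
  | pre ρ P ih =>
    intro j R c n
    simp only [Proc.shiftV, Proc.psubst, Rho.arity_mapExpr, ih,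
      Proc.shiftV_shiftV R ρ.arity n (Nat.zero_le c)]
  | par P Q ih₁ ih₂ | cond g P Q ih₁ ih₂ =>
    intro j R c n; simp only [Proc.shiftV, Proc.psubst, ih₁, ih₂]
  | timeout π P Q ih₁ ih₂ =>
    intro j R c n
    simp only [Proc.shiftV, Proc.psubst, Pi.arity_mapExpr, ih₁, ih₂,
      Proc.shiftV_shiftV R π.arity n (Nat.zero_le c)]
  | fix P ih => intro j R c n; simp only [Proc.shiftV, Proc.psubst, ih, Proc.shiftV_shiftP]

theorem Proc.psubst_subst (P : Proc S) : ∀ (j : ℕ) (R : Proc S) (k : ℕ) (v : S.Val),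
    (Proc.psubst j R P).subst k v = Proc.psubst j (R.subst k v) (P.subst k v) := by
  induction P with
  | nil => intros; rfl
  | pvar X => intro j R k v; simp only [Proc.subst, Proc.psubst]; split_ifs <;> rfl
  | pre ρ P ih =>
    intro j R k v
    simp only [Proc.subst, Proc.psubst, Rho.arity_mapExpr, ih,
      Proc.subst_shiftV R ρ.arity v (Nat.zero_le k)]
  | par P Q ih₁ ih₂ | cond g P Q ih₁ ih₂ =>
    intro j R k v; simp only [Proc.subst, Proc.psubst, ih₁, ih₂]
  | timeout π P Q ih₁ ih₂ =>
    intro j R k v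
    simp only [Proc.subst, Proc.psubst, Pi.arity_mapExpr, ih₁, ih₂,
      Proc.subst_shiftV R π.arity v (Nat.zero_le k)]
  | fix P ih => intro j R k v; simp only [Proc.subst, Proc.psubst, ih, Proc.subst_shiftP]

theorem Proc.psubst_shiftP (P : Proc S) : ∀ {j c : ℕ} (R : Proc S), j ≤ c →
    (Proc.psubst j R P).shiftP c = Proc.psubst j (R.shiftP c) (P.shiftP (c + 1)) := by
  induction P with
  | nil => intros; rfl
  | pvar X =>
    intro j c R h
    simp only [Proc.shiftP, Proc.psubst]
    split_ifs <;> first | omega | rfl | (simp only [Proc.shiftP]; congr 1; split_ifs <;> omega)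
  | pre ρ P ih => intro j c R h; simp only [Proc.shiftP, Proc.psubst, ih _ h, Proc.shiftV_shiftP]
  | par P Q ih₁ ih₂ | cond g P Q ih₁ ih₂ =>
    intro j c R h; simp only [Proc.shiftP, Proc.psubst, ih₁ _ h, ih₂ _ h]
  | timeout π P Q ih₁ ih₂ =>
    intro j c R h; simp only [Proc.shiftP, Proc.psubst, ih₁ _ h, ih₂ _ h, Proc.shiftV_shiftP]
  | fix P ih =>
    intro j c R h
    simp only [Proc.shiftP, Proc.psubst, ih _ (Nat.succ_le_succ h),
      Proc.shiftP_shiftP R (Nat.zero_le c)]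

/-- The variable `j` does not occur after the shift, so the substitution only lowers the indices
again. -/
theorem Proc.psubst_shiftP_self (P : Proc S) : ∀ (j : ℕ) (R : Proc S),
    Proc.psubst j R (P.shiftP j) = P := by
  induction P with
  | nil => intros; rfl
  | pvar X =>
    intro j R
    simp only [Proc.shiftP, Proc.psubst]
    split_ifs <;> first | omega | rfl
  | pre ρ P ih => intro j R; simp only [Proc.shiftP, Proc.psubst, ih]
  | par P Q ih₁ ih₂ | cond g P Q ih₁ ih₂ | timeout π P Q ih₁ ih₂ =>
    intro j R; simp only [Proc.shiftP, Proc.psubst, ih₁, ih₂]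
  | fix P ih => intro j R; simp only [Proc.shiftP, Proc.psubst, ih]

/-- Complements `Proc.psubst_shiftP`: here the cutoff is at or below the substituted variable, which
therefore moves up with the shift. -/
theorem Proc.shiftP_psubst (P : Proc S) : ∀ {c k : ℕ} (A : Proc S), c ≤ k →
    (Proc.psubst k A P).shiftP c = Proc.psubst (k + 1) (A.shiftP c) (P.shiftP c) := by
  induction P with
  | nil => intros; rfl
  | pvar X =>
    intro c k A h
    simp only [Proc.shiftP, Proc.psubst]
    split_ifs <;> first | omega | rfl | (simp only [Proc.shiftP]; congr 1; split_ifs <;> omega)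
  | pre ρ P ih => intro c k A h; simp only [Proc.shiftP, Proc.psubst, ih _ h, Proc.shiftV_shiftP]
  | par P Q ih₁ ih₂ | cond g P Q ih₁ ih₂ =>
    intro c k A h; simp only [Proc.shiftP, Proc.psubst, ih₁ _ h, ih₂ _ h]
  | timeout π P Q ih₁ ih₂ =>
    intro c k A h; simp only [Proc.shiftP, Proc.psubst, ih₁ _ h, ih₂ _ h, Proc.shiftV_shiftP]
  | fix P ih =>
    intro c k A h
    simp only [Proc.shiftP, Proc.psubst, ih _ (Nat.succ_le_succ h),
      Proc.shiftP_shiftP A (Nat.zero_le c)]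

/-- The substitution lemma for process variables. On the right `A` is inserted while `j` is still a
variable, hence its shift; the later substitution for `j` undoes it. -/
theorem Proc.psubst_psubst (P : Proc S) : ∀ {j k : ℕ} (A R : Proc S), j ≤ k →
    Proc.psubst k A (Proc.psubst j R P) =
      Proc.psubst j (Proc.psubst k A R) (Proc.psubst (k + 1) (A.shiftP j) P) := by
  induction P with
  | nil => intros; rfl
  | pvar X =>
    intro j k A R h
    simp only [Proc.psubst]
    split_ifs <;> first
      | omega
      | (simp only [Proc.psubst, Proc.psubst_shiftP_self]; done)
      | (simp only [Proc.psubst, Proc.psubst_shiftP_self]; split_ifs <;> first | omega | rfl)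
  | pre ρ P ih =>
    intro j k A R h
    simp only [Proc.psubst, ih _ _ h, Proc.psubst_shiftV, Proc.shiftV_shiftP]
  | par P Q ih₁ ih₂ | cond g P Q ih₁ ih₂ =>
    intro j k A R h; simp only [Proc.psubst, ih₁ _ _ h, ih₂ _ _ h]
  | timeout π P Q ih₁ ih₂ =>
    intro j k A R h
    simp only [Proc.psubst, ih₁ _ _ h, ih₂ _ _ h, Proc.psubst_shiftV, Proc.shiftV_shiftP]
  | fix P ih =>
    intro j k A R h
    simp only [Proc.psubst, ih _ _ (Nat.succ_le_succ h)]
    rw [Proc.shiftP_shiftP A (Nat.zero_le j), Proc.shiftP_psubst R A (Nat.zero_le k)]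

theorem Proc.mapChan_shiftV (f : S.Chan → S.Chan) (P : Proc S) : ∀ (c n : ℕ),
    (P.shiftV c n).mapChan f = (P.mapChan f).shiftV c n := by
  induction P with
  | timeout π P Q ih₁ ih₂ => intro c n; cases π <;> simp_all [Proc.shiftV, Proc.mapChan, Pi.mapExpr, Pi.mapChan, Pi.arity]
  | _ => intros; simp_all [Proc.shiftV, Proc.mapChan]

theorem Proc.mapChan_subst (f : S.Chan → S.Chan) (P : Proc S) : ∀ (k : ℕ) (v : S.Val),
    (P.subst k v).mapChan f = (P.mapChan f).subst k v := by
  induction P with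
  | timeout π P Q ih₁ ih₂ => intro c n; cases π <;> simp_all [Proc.subst, Proc.mapChan, Pi.mapExpr, Pi.mapChan, Pi.arity]
  | _ => intros; simp_all [Proc.subst, Proc.mapChan]

theorem Proc.mapChan_shiftP (f : S.Chan → S.Chan) (P : Proc S) : ∀ (c : ℕ),
    (P.shiftP c).mapChan f = (P.mapChan f).shiftP c := by
  induction P <;> intros <;> simp_all [Proc.shiftP, Proc.mapChan]

theorem Proc.mapChan_psubst (f : S.Chan → S.Chan) (P : Proc S) : ∀ (k : ℕ) (R : Proc S),
    (Proc.psubst k R P).mapChan f = Proc.psubst k (R.mapChan f) (P.mapChan f) := by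
  induction P with
  | pvar X => intro k R; simp only [Proc.psubst, Proc.mapChan]; split_ifs <;> rfl
  | _ => intros; simp_all [Proc.psubst, Proc.mapChan, Proc.mapChan_shiftV, Proc.mapChan_shiftP]

/-- This and the next four laws serve the unfolding axiom of structural congruence: the axiom is
stable under an operation because unfolding commutes with that operation. -/
theorem Proc.unfold_subst (P : Proc S) (k : ℕ) (v : S.Val) :
    P.unfold.subst k v = (P.subst k v).unfold := Proc.psubst_subst P 0 _ k v

theorem Proc.unfold_shiftV (P : Proc S) (c n : ℕ) :
    P.unfold.shiftV c n = (P.shiftV c n).unfold := Proc.psubst_shiftV P 0 _ c n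

theorem Proc.unfold_shiftP (P : Proc S) (c : ℕ) :
    P.unfold.shiftP c = (P.shiftP (c + 1)).unfold := Proc.psubst_shiftP P _ (Nat.zero_le c)

theorem Proc.psubst_unfold (P : Proc S) (k : ℕ) (A : Proc S) :
    Proc.psubst k A P.unfold = (Proc.psubst (k + 1) (A.shiftP 0) P).unfold :=
  Proc.psubst_psubst P A _ (Nat.zero_le k)

theorem Proc.mapChan_unfold (f : S.Chan → S.Chan) (P : Proc S) :
    P.unfold.mapChan f = (P.mapChan f).unfold := Proc.mapChan_psubst f P 0 _

end ProcessSubstitution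

/-! ### Structural congruence of processes is compatible with their transitions -/

section ProcessConversion

variable {S : Sig.{u}}

theorem Guard.EvalsTo.mapExpr {b : Guard S} {t : Bool} (h : b.EvalsTo t)
    {f : Expr S → Expr S} (hf : ∀ v, f (.val v) = .val v) : (b.mapExpr f).EvalsTo t := by
  obtain ⟨vs, h₁, h₂⟩ := h
  exact ⟨vs, by simp [Guard.mapExpr, h₁, Function.comp_def, hf], h₂⟩

theorem Guard.EvalsTo.unique {b : Guard S} {t t' : Bool} (h : b.EvalsTo t) (h' : b.EvalsTo t') :
    t = t' := by
  obtain ⟨vs, h₁, h₂⟩ := h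
  obtain ⟨vs', h₁', h₂'⟩ := h'
  have : vs = vs' :=
    List.map_injective_iff.2 (fun v w h => by injection h) (h₁.symm.trans h₁')
  rw [← h₂, ← h₂', this]

/-- Structural congruence without transitivity: one round of rewriting at any number of
positions. Its rules are such that it is symmetric and closed under substitution. -/
inductive ProcConv : Proc S → Proc S → Prop
  | nil : ProcConv .nil .nil
  | pvar (X) : ProcConv (.pvar X) (.pvar X)
  | pre (ρ) {P P'} : ProcConv P P' → ProcConv (.pre ρ P) (.pre ρ P')
  | par {P P' Q Q'} : ProcConv P P' → ProcConv Q Q' → ProcConv (.par P Q) (.par P' Q')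
  | timeout (π) {P P' Q Q'} :
      ProcConv P P' → ProcConv Q Q' → ProcConv (.timeout π P Q) (.timeout π P' Q')
  | cond (b) {P P' Q Q'} : ProcConv P P' → ProcConv Q Q' → ProcConv (.cond b P Q) (.cond b P' Q')
  | fix {P P'} : ProcConv P P' → ProcConv (.fix P) (.fix P')
  | nilL {P Q} : ProcConv P Q → ProcConv (.par P .nil) Q
  | nilR {P Q} : ProcConv P Q → ProcConv P (.par Q .nil)
  | comm {P P' Q Q'} : ProcConv P P' → ProcConv Q Q' → ProcConv (.par P Q) (.par Q' P')
  | assocL {P P' Q Q' R R'} : ProcConv P P' → ProcConv Q Q' → ProcConv R R' →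
      ProcConv (.par (.par P Q) R) (.par P' (.par Q' R'))
  | assocR {P P' Q Q' R R'} : ProcConv P P' → ProcConv Q Q' → ProcConv R R' →
      ProcConv (.par P (.par Q R)) (.par (.par P' Q') R')
  | trueL {b P Q} (T) : b.EvalsTo true → ProcConv P Q → ProcConv (.cond b P T) Q
  | trueR {b P Q} (T) : b.EvalsTo true → ProcConv P Q → ProcConv P (.cond b Q T)
  | falseL {b P Q} (T) : b.EvalsTo false → ProcConv P Q → ProcConv (.cond b T P) Q
  | falseR {b P Q} (T) : b.EvalsTo false → ProcConv P Q → ProcConv P (.cond b T Q)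
  | unfoldL {P Q} : ProcConv P.unfold Q → ProcConv (.fix P) Q
  | unfoldR {P Q} : ProcConv P Q.unfold → ProcConv P (.fix Q)

theorem ProcConv.refl (P : Proc S) : ProcConv P P := by
  induction P with
  | nil => exact .nil
  | pvar X => exact .pvar X
  | pre ρ P ih => exact .pre ρ ih
  | par P Q ih₁ ih₂ => exact .par ih₁ ih₂
  | timeout π P Q ih₁ ih₂ => exact .timeout π ih₁ ih₂
  | cond b P Q ih₁ ih₂ => exact .cond b ih₁ ih₂
  | fix P ih => exact .fix ih

theorem ProcConv.symm {P Q : Proc S} (h : ProcConv P Q) : ProcConv Q P := by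
  induction h
  case comm ih₁ ih₂ => exact .comm ih₂ ih₁
  case assocL ih₁ ih₂ ih₃ => exact .assocR ih₁ ih₂ ih₃
  case assocR ih₁ ih₂ ih₃ => exact .assocL ih₁ ih₂ ih₃
  case falseL hb _ ih => exact .falseR _ hb ih
  case falseR hb _ ih => exact .falseL _ hb ih
  all_goals constructor <;> assumption

theorem ProcConv.subst {P Q : Proc S} (h : ProcConv P Q) (v : S.Val) :
    ∀ k, ProcConv (P.subst k v) (Q.subst k v) := by
  have hv (k : ℕ) (w : S.Val) : Expr.subst k v (.val w) = .val w := rfl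
  induction h <;> intro k
  case comm ih₁ ih₂ => exact .comm (ih₁ k) (ih₂ k)
  case assocL ih₁ ih₂ ih₃ => exact .assocL (ih₁ k) (ih₂ k) (ih₃ k)
  case assocR ih₁ ih₂ ih₃ => exact .assocR (ih₁ k) (ih₂ k) (ih₃ k)
  case trueL hb _ ih => exact .trueL _ (hb.mapExpr (hv k)) (ih k)
  case trueR hb _ ih => exact .trueR _ (hb.mapExpr (hv k)) (ih k)
  case falseL hb _ ih => exact .falseL _ (hb.mapExpr (hv k)) (ih k)
  case falseR hb _ ih => exact .falseR _ (hb.mapExpr (hv k)) (ih k)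
  case unfoldL ih => exact .unfoldL (Proc.unfold_subst _ k v ▸ ih k)
  case unfoldR ih => exact .unfoldR (Proc.unfold_subst _ k v ▸ ih k)
  all_goals constructor <;> solve_by_elim

theorem ProcConv.shiftV {P Q : Proc S} (h : ProcConv P Q) (n : ℕ) :
    ∀ c, ProcConv (P.shiftV c n) (Q.shiftV c n) := by
  have hv (k : ℕ) (w : S.Val) : Expr.shift k n (.val w) = .val w := rfl
  induction h <;> intro k
  case comm ih₁ ih₂ => exact .comm (ih₁ k) (ih₂ k)
  case assocL ih₁ ih₂ ih₃ => exact .assocL (ih₁ k) (ih₂ k) (ih₃ k)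
  case assocR ih₁ ih₂ ih₃ => exact .assocR (ih₁ k) (ih₂ k) (ih₃ k)
  case trueL hb _ ih => exact .trueL _ (hb.mapExpr (hv k)) (ih k)
  case trueR hb _ ih => exact .trueR _ (hb.mapExpr (hv k)) (ih k)
  case falseL hb _ ih => exact .falseL _ (hb.mapExpr (hv k)) (ih k)
  case falseR hb _ ih => exact .falseR _ (hb.mapExpr (hv k)) (ih k)
  case unfoldL ih => exact .unfoldL (Proc.unfold_shiftV _ k n ▸ ih k)
  case unfoldR ih => exact .unfoldR (Proc.unfold_shiftV _ k n ▸ ih k)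
  all_goals constructor <;> solve_by_elim

theorem ProcConv.shiftP {P Q : Proc S} (h : ProcConv P Q) :
    ∀ c, ProcConv (P.shiftP c) (Q.shiftP c) := by
  induction h <;> intro k
  case pvar X => exact .pvar _
  case comm ih₁ ih₂ => exact .comm (ih₁ k) (ih₂ k)
  case assocL ih₁ ih₂ ih₃ => exact .assocL (ih₁ k) (ih₂ k) (ih₃ k)
  case assocR ih₁ ih₂ ih₃ => exact .assocR (ih₁ k) (ih₂ k) (ih₃ k)
  case trueL hb _ ih => exact .trueL _ hb (ih k)
  case trueR hb _ ih => exact .trueR _ hb (ih k)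
  case falseL hb _ ih => exact .falseL _ hb (ih k)
  case falseR hb _ ih => exact .falseR _ hb (ih k)
  case unfoldL ih => exact .unfoldL (Proc.unfold_shiftP _ k ▸ ih k)
  case unfoldR ih => exact .unfoldR (Proc.unfold_shiftP _ k ▸ ih k)
  all_goals constructor <;> solve_by_elim

theorem ProcConv.mapChan {P Q : Proc S} (h : ProcConv P Q) (f : S.Chan → S.Chan) :
    ProcConv (P.mapChan f) (Q.mapChan f) := by
  induction h
  case comm ih₁ ih₂ => exact .comm ih₁ ih₂
  case assocL ih₁ ih₂ ih₃ => exact .assocL ih₁ ih₂ ih₃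
  case assocR ih₁ ih₂ ih₃ => exact .assocR ih₁ ih₂ ih₃
  case trueL hb _ ih => exact .trueL _ hb ih
  case trueR hb _ ih => exact .trueR _ hb ih
  case falseL hb _ ih => exact .falseL _ hb ih
  case falseR hb _ ih => exact .falseR _ hb ih
  case unfoldL ih => exact .unfoldL (Proc.mapChan_unfold f _ ▸ ih)
  case unfoldR ih => exact .unfoldR (Proc.mapChan_unfold f _ ▸ ih)
  all_goals constructor <;> assumption

theorem ProcConv.psubst {P Q : Proc S} (h : ProcConv P Q) :
    ∀ (k : ℕ) {R T : Proc S}, ProcConv R T → ProcConv (Proc.psubst k R P) (Proc.psubst k T Q) := by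
  induction h <;> intro k R T hR
  case pvar X =>
    simp only [Proc.psubst]
    split_ifs
    exacts [.pvar _, hR, .pvar _]
  case pre ih => exact .pre _ (ih k (hR.shiftV _ _))
  case timeout ih₁ ih₂ => exact .timeout _ (ih₁ k (hR.shiftV _ _)) (ih₂ k hR)
  case fix ih => exact .fix (ih _ (hR.shiftP _))
  case comm ih₁ ih₂ => exact .comm (ih₁ k hR) (ih₂ k hR)
  case assocL ih₁ ih₂ ih₃ => exact .assocL (ih₁ k hR) (ih₂ k hR) (ih₃ k hR)
  case assocR ih₁ ih₂ ih₃ => exact .assocR (ih₁ k hR) (ih₂ k hR) (ih₃ k hR)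
  case trueL hb _ ih => exact .trueL _ hb (ih k hR)
  case trueR hb _ ih => exact .trueR _ hb (ih k hR)
  case falseL hb _ ih => exact .falseL _ hb (ih k hR)
  case falseR hb _ ih => exact .falseR _ hb (ih k hR)
  case unfoldL ih => exact .unfoldL (Proc.psubst_unfold _ k R ▸ ih k hR)
  case unfoldR ih => exact .unfoldR (Proc.psubst_unfold _ k T ▸ ih k hR)
  all_goals constructor <;> solve_by_elim

/-- The body and all inserted copies of the recursion change simultaneously; since one round may
rewrite at any number of positions, a single round still suffices. -/
theorem ProcConv.unfold {P Q : Proc S} (h : ProcConv P Q) : ProcConv P.unfold Q.unfold :=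
  h.psubst 0 (.fix h)

theorem ProcConv.procEq {P Q : Proc S} (h : ProcConv P Q) : ProcEq P Q := by
  induction h with
  | nil => exact .refl _
  | pvar X => exact .refl _
  | pre ρ _ ih => exact .pre ρ ih
  | par _ _ ih₁ ih₂ => exact .par ih₁ ih₂
  | timeout π _ _ ih₁ ih₂ => exact .timeout π ih₁ ih₂
  | cond b _ _ ih₁ ih₂ => exact .cond b ih₁ ih₂
  | fix _ ih => exact .fix ih
  | nilL _ ih => exact .trans (.par_nil _) ih
  | nilR _ ih => exact .trans ih (.symm (.par_nil _))
  | comm _ _ ih₁ ih₂ => exact .trans (.par ih₁ ih₂) (.par_comm _ _)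
  | assocL _ _ _ ih₁ ih₂ ih₃ => exact .trans (.par_assoc _ _ _) (.par ih₁ (.par ih₂ ih₃))
  | assocR _ _ _ ih₁ ih₂ ih₃ => exact .trans (.symm (.par_assoc _ _ _)) (.par (.par ih₁ ih₂) ih₃)
  | trueL T hb _ ih => exact .trans (.cond_true _ _ hb) ih
  | trueR T hb _ ih => exact .trans ih (.symm (.cond_true _ _ hb))
  | falseL T hb _ ih => exact .trans (.cond_false _ _ hb) ih
  | falseR T hb _ ih => exact .trans ih (.symm (.cond_false _ _ hb))
  | unfoldL _ ih => exact .trans (.unfold _) ih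
  | unfoldR _ ih => exact .trans ih (.symm (.unfold _))

-- As `ProcConv` is symmetric, no symmetric closure is needed, and chains of rounds exhaust the
-- congruence.
open Relation in
theorem ProcEq.reflTransGen {P Q : Proc S} (h : ProcEq P Q) : ReflTransGen ProcConv P Q := by
  induction h with
  | refl P => exact .refl
  | symm _ ih =>
    have : Std.Symm (ProcConv (S := S)) := ⟨fun _ _ h => h.symm⟩
    exact ReflTransGen.stdSymm.symm _ _ ih
  | trans _ _ ih₁ ih₂ => exact ih₁.trans ih₂
  | pre ρ _ ih => exact ih.lift _ fun _ _ h => .pre ρ h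
  | @par P P' Q Q' _ _ ih₁ ih₂ =>
    exact (ih₁.lift (Proc.par · Q) fun _ _ h => .par h (.refl _)).trans
      (ih₂.lift (Proc.par P' ·) fun _ _ h => .par (.refl _) h)
  | @timeout π P P' Q Q' _ _ ih₁ ih₂ =>
    exact (ih₁.lift (Proc.timeout π · Q) fun _ _ h => .timeout π h (.refl _)).trans
      (ih₂.lift (Proc.timeout π P' ·) fun _ _ h => .timeout π (.refl _) h)
  | @cond b P P' Q Q' _ _ ih₁ ih₂ =>
    exact (ih₁.lift (Proc.cond b · Q) fun _ _ h => .cond b h (.refl _)).trans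
      (ih₂.lift (Proc.cond b P' ·) fun _ _ h => .cond b (.refl _) h)
  | fix _ ih => exact ih.lift _ fun _ _ h => .fix h
  | par_nil P => exact .single (.nilL (.refl _))
  | par_comm P Q => exact .single (.comm (.refl _) (.refl _))
  | par_assoc P Q R => exact .single (.assocL (.refl _) (.refl _) (.refl _))
  | cond_true P Q hb => exact .single (.trueL _ hb (.refl _))
  | cond_false P Q hb => exact .single (.falseL _ hb (.refl _))
  | unfold P => exact .single (.unfoldL (.refl _))

theorem ProcEq.of_reflTransGen {P Q : Proc S} (h : Relation.ReflTransGen ProcConv P Q) :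
    ProcEq P Q := by
  induction h with
  | refl => exact .refl _
  | tail _ h ih => exact ih.trans h.procEq

theorem ProcEq.mapChan {P Q : Proc S} (h : ProcEq P Q) (f : S.Chan → S.Chan) :
    ProcEq (P.mapChan f) (Q.mapChan f) :=
  .of_reflTransGen (h.reflTransGen.lift _ fun _ _ h => h.mapChan f)

/-! ### Transitions of processes with a bound on the number of nested unfoldings -/

/-- Transitions `P --l--> Q` deriving which takes at most `n` nested unfoldings of recursions.
The label `none` stands for `σ`, without any condition of maximal progress. -/
inductive BStep : ℕ → Proc S → Option (PLabel S) → Proc S → Prop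
  | sndP (n c v P Q) : BStep n (.timeout (.out c (.val v)) P Q) (some (.out c v)) P
  | rcvP (n c v P Q) : BStep n (.timeout (.inp c) P Q) (some (.inp c v)) (P.subst 0 v)
  | sensor (n s v P) : BStep n (.pre (.sense s) P) (some (.sens s v)) (P.subst 0 v)
  | actuator (n a v P) : BStep n (.pre (.write (.val v) a) P) (some (.act a v)) P
  | posP (n h P) : BStep n (.pre .pos P) (some (.pos h)) (P.subst 0 (S.locVal h))
  | timeNil (n) : BStep n .nil none .nil
  | delay (n P) : BStep n (.pre .sleep P) none P
  | timeout (n π P Q) : BStep n (.timeout π P Q) none Q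
  | comL {n P P' Q Q' c v} : BStep n P (some (.out c v)) P' → BStep n Q (some (.inp c v)) Q' →
      S.rng c = ⊥ → BStep n (.par P Q) (some .tau) (.par P' Q')
  | comR {n P P' Q Q' c v} : BStep n P (some (.inp c v)) P' → BStep n Q (some (.out c v)) Q' →
      S.rng c = ⊥ → BStep n (.par P Q) (some .tau) (.par P' Q')
  | parL {n P P' l} (Q) : BStep n P (some l) P' → BStep n (.par P Q) (some l) (.par P' Q)
  | parR {n Q Q' l} (P) : BStep n Q (some l) Q' → BStep n (.par P Q) (some l) (.par P Q')
  | timePar {n P P' Q Q'} : BStep n P none P' → BStep n Q none Q' →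
      BStep n (.par P Q) none (.par P' Q')
  | fix {n P Q l} : BStep n P.unfold l Q → BStep (n + 1) (.fix P) l Q
  | condT {n b P P' l} (Q) : b.EvalsTo true → BStep n P l P' → BStep n (.cond b P Q) l P'
  | condF {n b Q Q' l} (P) : b.EvalsTo false → BStep n Q l Q' → BStep n (.cond b P Q) l Q'

theorem BStep.mono {n m : ℕ} {P Q : Proc S} {l : Option (PLabel S)} (h : BStep n P l Q)
    (hm : n ≤ m) : BStep m P l Q := by
  induction h generalizing m with
  | fix _ ih =>
    obtain ⟨m, rfl⟩ := Nat.exists_eq_add_of_le' (Nat.one_le_of_lt hm)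
    exact .fix (ih (Nat.le_of_succ_le_succ hm))
  | comL _ _ hc ih₁ ih₂ => exact .comL (ih₁ hm) (ih₂ hm) hc
  | comR _ _ hc ih₁ ih₂ => exact .comR (ih₁ hm) (ih₂ hm) hc
  | parL _ _ ih => exact .parL _ (ih hm)
  | parR _ _ ih => exact .parR _ (ih hm)
  | timePar _ _ ih₁ ih₂ => exact .timePar (ih₁ hm) (ih₂ hm)
  | condT _ hb _ ih => exact .condT _ hb (ih hm)
  | condF _ hb _ ih => exact .condF _ hb (ih hm)
  | _ => constructor

/-- Transitions `P --l--> Q`; the label `none` stands for `σ`, without maximal progress. -/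
def PStep (P : Proc S) (l : Option (PLabel S)) (Q : Proc S) : Prop := ∃ n, BStep n P l Q

namespace PStep

variable {P P' Q Q' : Proc S} {c : S.Chan} {v : S.Val} {l : Option (PLabel S)} {b : Guard S}

theorem comL : PStep P (some (.out c v)) P' → PStep Q (some (.inp c v)) Q' → S.rng c = ⊥ →
    PStep (.par P Q) (some .tau) (.par P' Q') := fun ⟨n, h₁⟩ ⟨m, h₂⟩ hc =>
  ⟨max n m, .comL (h₁.mono (le_max_left n m)) (h₂.mono (le_max_right n m)) hc⟩

theorem comR : PStep P (some (.inp c v)) P' → PStep Q (some (.out c v)) Q' → S.rng c = ⊥ →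
    PStep (.par P Q) (some .tau) (.par P' Q') := fun ⟨n, h₁⟩ ⟨m, h₂⟩ hc =>
  ⟨max n m, .comR (h₁.mono (le_max_left n m)) (h₂.mono (le_max_right n m)) hc⟩

theorem timePar : PStep P none P' → PStep Q none Q' →
    PStep (.par P Q) none (.par P' Q') := fun ⟨n, h₁⟩ ⟨m, h₂⟩ =>
  ⟨max n m, .timePar (h₁.mono (le_max_left n m)) (h₂.mono (le_max_right n m))⟩

theorem parL {l : PLabel S} (Q : Proc S) : PStep P (some l) P' →
    PStep (.par P Q) (some l) (.par P' Q) := fun ⟨n, h⟩ => ⟨n, .parL Q h⟩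

theorem parR {l : PLabel S} (P : Proc S) : PStep Q (some l) Q' →
    PStep (.par P Q) (some l) (.par P Q') := fun ⟨n, h⟩ => ⟨n, .parR P h⟩

theorem fix : PStep P.unfold l Q → PStep (.fix P) l Q := fun ⟨n, h⟩ => ⟨n + 1, .fix h⟩

theorem condT (Q : Proc S) (hb : b.EvalsTo true) : PStep P l P' → PStep (.cond b P Q) l P' :=
  fun ⟨n, h⟩ => ⟨n, .condT Q hb h⟩

theorem condF (P : Proc S) (hb : b.EvalsTo false) : PStep Q l Q' → PStep (.cond b P Q) l Q' :=
  fun ⟨n, h⟩ => ⟨n, .condF P hb h⟩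

end PStep

/-- The difficult rule is congruence under `fix`: a transition of a recursion comes from its
unfolding, and the conversion between the unfoldings is not a subderivation of the given one. The
bound on nested unfoldings drops there, hence an outer induction on `n` around the induction on the
conversion. The matching transition carries no bound, as `Q` may need further unfoldings; this is
why transitivity is kept out of `ProcConv`. -/
theorem BStep.conv (n : ℕ) {P Q : Proc S} (h : ProcConv P Q) :
    ∀ {l : Option (PLabel S)} {P'}, BStep n P l P' → ∃ Q', PStep Q l Q' ∧ ProcEq P' Q' := by
  induction n using Nat.strong_induction_on generalizing P Q with | _ n ihn
  induction h with
  | nil | pvar => intro l P' h; exact ⟨_, ⟨n, h⟩, .refl _⟩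
  | pre ρ hP =>
    intro l P' h
    cases h with
    | sensor n s v P => exact ⟨_, ⟨n, .sensor ..⟩, (hP.subst v 0).procEq⟩
    | actuator n a v P => exact ⟨_, ⟨n, .actuator ..⟩, hP.procEq⟩
    | posP n h P => exact ⟨_, ⟨n, .posP ..⟩, (hP.subst _ 0).procEq⟩
    | delay n P => exact ⟨_, ⟨n, .delay ..⟩, hP.procEq⟩
  | timeout π hP hQ =>
    intro l P' h
    cases h with
    | sndP n c v P Q => exact ⟨_, ⟨n, .sndP ..⟩, hP.procEq⟩
    | rcvP n c v P Q => exact ⟨_, ⟨n, .rcvP ..⟩, (hP.subst v 0).procEq⟩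
    | timeout n π P Q => exact ⟨_, ⟨n, .timeout ..⟩, hQ.procEq⟩
  | cond b hP hQ ih₁ ih₂ =>
    intro l P' h
    cases h with
    | condT _ hb h => obtain ⟨Q', h₁, h₂⟩ := ih₁ h; exact ⟨Q', .condT _ hb h₁, h₂⟩
    | condF _ hb h => obtain ⟨Q', h₁, h₂⟩ := ih₂ h; exact ⟨Q', .condF _ hb h₁, h₂⟩
  | par hP hQ ih₁ ih₂ =>
    intro l P' h
    cases h with
    | comL h₁ h₂ hc =>
      obtain ⟨_, h₁, e₁⟩ := ih₁ h₁; obtain ⟨_, h₂, e₂⟩ := ih₂ h₂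
      exact ⟨_, .comL h₁ h₂ hc, .par e₁ e₂⟩
    | comR h₁ h₂ hc =>
      obtain ⟨_, h₁, e₁⟩ := ih₁ h₁; obtain ⟨_, h₂, e₂⟩ := ih₂ h₂
      exact ⟨_, .comR h₁ h₂ hc, .par e₁ e₂⟩
    | timePar h₁ h₂ =>
      obtain ⟨_, h₁, e₁⟩ := ih₁ h₁; obtain ⟨_, h₂, e₂⟩ := ih₂ h₂
      exact ⟨_, .timePar h₁ h₂, .par e₁ e₂⟩
    | parL _ h => obtain ⟨_, h, e⟩ := ih₁ h; exact ⟨_, .parL _ h, .par e hQ.procEq⟩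
    | parR _ h => obtain ⟨_, h, e⟩ := ih₂ h; exact ⟨_, .parR _ h, .par hP.procEq e⟩
  | fix hP _ =>
    intro l P' h
    cases h with
    | fix h =>
      -- The only use of the outer induction.
      obtain ⟨Q', h₁, h₂⟩ := ihn _ (Nat.lt_succ_self _) hP.unfold h
      exact ⟨Q', .fix h₁, h₂⟩
  | nilL hP ih =>
    intro l P' h
    cases h with
    | comL _ h _ => cases h
    | comR _ h _ => cases h
    | parR _ h => cases h
    | parL _ h => obtain ⟨Q', h₁, h₂⟩ := ih h; exact ⟨Q', h₁, .trans (.par_nil _) h₂⟩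
    | timePar h h' =>
      cases h'
      obtain ⟨Q', h₁, h₂⟩ := ih h
      exact ⟨Q', h₁, .trans (.par_nil _) h₂⟩
  | nilR hP ih =>
    intro l P' h
    obtain ⟨Q', h₁, h₂⟩ := ih h
    cases l with
    | none => exact ⟨_, h₁.timePar ⟨0, .timeNil 0⟩, h₂.trans (.symm (.par_nil _))⟩
    | some l => exact ⟨_, h₁.parL _, h₂.trans (.symm (.par_nil _))⟩
  | comm hP hQ ih₁ ih₂ =>
    intro l P' h
    cases h with
    | comL h₁ h₂ hc =>
      obtain ⟨_, h₁, e₁⟩ := ih₁ h₁; obtain ⟨_, h₂, e₂⟩ := ih₂ h₂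
      exact ⟨_, .comR h₂ h₁ hc, .trans (.par_comm _ _) (.par e₂ e₁)⟩
    | comR h₁ h₂ hc =>
      obtain ⟨_, h₁, e₁⟩ := ih₁ h₁; obtain ⟨_, h₂, e₂⟩ := ih₂ h₂
      exact ⟨_, .comL h₂ h₁ hc, .trans (.par_comm _ _) (.par e₂ e₁)⟩
    | timePar h₁ h₂ =>
      obtain ⟨_, h₁, e₁⟩ := ih₁ h₁; obtain ⟨_, h₂, e₂⟩ := ih₂ h₂
      exact ⟨_, .timePar h₂ h₁, .trans (.par_comm _ _) (.par e₂ e₁)⟩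
    | parL _ h =>
      obtain ⟨_, h, e⟩ := ih₁ h
      exact ⟨_, .parR _ h, .trans (.par_comm _ _) (.par hQ.procEq e)⟩
    | parR _ h =>
      obtain ⟨_, h, e⟩ := ih₂ h
      exact ⟨_, .parL _ h, .trans (.par_comm _ _) (.par e hP.procEq)⟩
  | assocL hP hQ hR ih₁ ih₂ ih₃ =>
    have aux {A B C A' B' C' : Proc S} (h₁ : ProcEq A A') (h₂ : ProcEq B B') (h₃ : ProcEq C C') :
        ProcEq (.par (.par A B) C) (.par A' (.par B' C')) :=
      .trans (.par_assoc _ _ _) (.par h₁ (.par h₂ h₃))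
    intro l P' h
    cases h with
    | comL h h₃ hc =>
      obtain ⟨_, h₃, e₃⟩ := ih₃ h₃
      cases h with
      | parL _ h => obtain ⟨_, h, e⟩ := ih₁ h; exact ⟨_, .comL h (h₃.parR _) hc, aux e hQ.procEq e₃⟩
      | parR _ h => obtain ⟨_, h, e⟩ := ih₂ h; exact ⟨_, .parR _ (.comL h h₃ hc), aux hP.procEq e e₃⟩
    | comR h h₃ hc =>
      obtain ⟨_, h₃, e₃⟩ := ih₃ h₃
      cases h with
      | parL _ h => obtain ⟨_, h, e⟩ := ih₁ h; exact ⟨_, .comR h (h₃.parR _) hc, aux e hQ.procEq e₃⟩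
      | parR _ h => obtain ⟨_, h, e⟩ := ih₂ h; exact ⟨_, .parR _ (.comR h h₃ hc), aux hP.procEq e e₃⟩
    | timePar h h₃ =>
      cases h with
      | timePar h₁ h₂ =>
        obtain ⟨_, h₁, e₁⟩ := ih₁ h₁; obtain ⟨_, h₂, e₂⟩ := ih₂ h₂
        obtain ⟨_, h₃, e₃⟩ := ih₃ h₃
        exact ⟨_, .timePar h₁ (.timePar h₂ h₃), aux e₁ e₂ e₃⟩
    | parR _ h =>
      obtain ⟨_, h, e⟩ := ih₃ h
      exact ⟨_, .parR _ (.parR _ h), aux hP.procEq hQ.procEq e⟩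
    | parL _ h =>
      cases h with
      | comL h₁ h₂ hc =>
        obtain ⟨_, h₁, e₁⟩ := ih₁ h₁; obtain ⟨_, h₂, e₂⟩ := ih₂ h₂
        exact ⟨_, .comL h₁ (.parL _ h₂) hc, aux e₁ e₂ hR.procEq⟩
      | comR h₁ h₂ hc =>
        obtain ⟨_, h₁, e₁⟩ := ih₁ h₁; obtain ⟨_, h₂, e₂⟩ := ih₂ h₂
        exact ⟨_, .comR h₁ (.parL _ h₂) hc, aux e₁ e₂ hR.procEq⟩
      | parL _ h => obtain ⟨_, h, e⟩ := ih₁ h; exact ⟨_, .parL _ h, aux e hQ.procEq hR.procEq⟩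
      | parR _ h =>
        obtain ⟨_, h, e⟩ := ih₂ h
        exact ⟨_, .parR _ (.parL _ h), aux hP.procEq e hR.procEq⟩
  | assocR hP hQ hR ih₁ ih₂ ih₃ =>
    have aux {A B C A' B' C' : Proc S} (h₁ : ProcEq A A') (h₂ : ProcEq B B') (h₃ : ProcEq C C') :
        ProcEq (.par A (.par B C)) (.par (.par A' B') C') :=
      .trans (.symm (.par_assoc _ _ _)) (.par (.par h₁ h₂) h₃)
    intro l P' h
    cases h with
    | comL h₁ h hc =>
      obtain ⟨_, h₁, e₁⟩ := ih₁ h₁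
      cases h with
      | parL _ h => obtain ⟨_, h, e⟩ := ih₂ h; exact ⟨_, .parL _ (.comL h₁ h hc), aux e₁ e hR.procEq⟩
      | parR _ h => obtain ⟨_, h, e⟩ := ih₃ h; exact ⟨_, .comL (h₁.parL _) h hc, aux e₁ hQ.procEq e⟩
    | comR h₁ h hc =>
      obtain ⟨_, h₁, e₁⟩ := ih₁ h₁
      cases h with
      | parL _ h => obtain ⟨_, h, e⟩ := ih₂ h; exact ⟨_, .parL _ (.comR h₁ h hc), aux e₁ e hR.procEq⟩
      | parR _ h => obtain ⟨_, h, e⟩ := ih₃ h; exact ⟨_, .comR (h₁.parL _) h hc, aux e₁ hQ.procEq e⟩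
    | timePar h₁ h =>
      cases h with
      | timePar h₂ h₃ =>
        obtain ⟨_, h₁, e₁⟩ := ih₁ h₁; obtain ⟨_, h₂, e₂⟩ := ih₂ h₂
        obtain ⟨_, h₃, e₃⟩ := ih₃ h₃
        exact ⟨_, .timePar (.timePar h₁ h₂) h₃, aux e₁ e₂ e₃⟩
    | parL _ h =>
      obtain ⟨_, h, e⟩ := ih₁ h
      exact ⟨_, .parL _ (.parL _ h), aux e hQ.procEq hR.procEq⟩
    | parR _ h =>
      cases h with
      | comL h₂ h₃ hc =>
        obtain ⟨_, h₂, e₂⟩ := ih₂ h₂; obtain ⟨_, h₃, e₃⟩ := ih₃ h₃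
        exact ⟨_, .comL (.parR _ h₂) h₃ hc, aux hP.procEq e₂ e₃⟩
      | comR h₂ h₃ hc =>
        obtain ⟨_, h₂, e₂⟩ := ih₂ h₂; obtain ⟨_, h₃, e₃⟩ := ih₃ h₃
        exact ⟨_, .comR (.parR _ h₂) h₃ hc, aux hP.procEq e₂ e₃⟩
      | parL _ h =>
        obtain ⟨_, h, e⟩ := ih₂ h
        exact ⟨_, .parL _ (.parR _ h), aux hP.procEq e hR.procEq⟩
      | parR _ h => obtain ⟨_, h, e⟩ := ih₃ h; exact ⟨_, .parR _ h, aux hP.procEq hQ.procEq e⟩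
  | trueL T hb hP ih =>
    intro l P' h
    cases h with
    | condT _ _ h => exact ih h
    | condF _ hb' h => exact absurd (hb.unique hb') (by decide)
  | falseL T hb hP ih =>
    intro l P' h
    cases h with
    | condT _ hb' h => exact absurd (hb.unique hb') (by decide)
    | condF _ _ h => exact ih h
  | trueR T hb hP ih =>
    intro l P' h
    obtain ⟨Q', h₁, h₂⟩ := ih h
    exact ⟨Q', h₁.condT _ hb, h₂⟩
  | falseR T hb hP ih =>
    intro l P' h
    obtain ⟨Q', h₁, h₂⟩ := ih h
    exact ⟨Q', h₁.condF _ hb, h₂⟩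
  | unfoldL hP ih =>
    intro l P' h
    cases h with
    | fix h => exact ih (h.mono (Nat.le_succ _))
  | unfoldR hP ih =>
    intro l P' h
    obtain ⟨Q', h₁, h₂⟩ := ih h
    exact ⟨Q', h₁.fix, h₂⟩

/-- Transitivity enters only here: each round of the chain is treated with whatever bound the
transition found in the previous round has. -/
theorem PStep.procEq {P Q P' : Proc S} {l : Option (PLabel S)} (h : ProcEq P Q)
    (hP : PStep P l P') : ∃ Q', PStep Q l Q' ∧ ProcEq P' Q' := by
  have := h.reflTransGen
  induction this with
  | refl => exact ⟨P', hP, .refl _⟩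
  | tail h₁ h₂ ih =>
    obtain ⟨Q₁, ⟨n, h₃⟩, e₁⟩ := ih (.of_reflTransGen h₁)
    obtain ⟨Q₂, h₄, e₂⟩ := h₃.conv n h₂
    exact ⟨Q₂, h₄, e₁.trans e₂⟩

theorem pStep_some {P Q : Proc S} {l : PLabel S} : PStep P (some l) Q ↔ ProcStep P l Q := by
  constructor
  · rintro ⟨n, h⟩
    generalize hl : some l = l' at h
    induction h generalizing l with
    | comL _ _ hc ih₁ ih₂ => cases hl; exact .comL (ih₁ rfl) (ih₂ rfl) hc
    | comR _ _ hc ih₁ ih₂ => cases hl; exact .comR (ih₁ rfl) (ih₂ rfl) hc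
    | parL _ _ ih => cases hl; exact .parL _ (ih rfl)
    | parR _ _ ih => cases hl; exact .parR _ (ih rfl)
    | fix _ ih => exact .fix (ih hl)
    | condT _ hb _ ih => exact .condT _ hb (ih hl)
    | condF _ hb _ ih => exact .condF _ hb (ih hl)
    | _ => cases hl <;> constructor
  · intro h
    induction h with
    | comL _ _ hc ih₁ ih₂ => exact .comL ih₁ ih₂ hc
    | comR _ _ hc ih₁ ih₂ => exact .comR ih₁ ih₂ hc
    | parL _ _ ih => exact .parL _ ih
    | parR _ _ ih => exact .parR _ ih
    | fix _ ih => exact .fix ih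
    | condT _ hb _ ih => exact .condT _ hb ih
    | condF _ hb _ ih => exact .condF _ hb ih
    | _ => exact ⟨0, by constructor⟩

theorem ProcStep.procEq {P Q P' : Proc S} {l : PLabel S} (h : ProcEq P Q) (hP : ProcStep P l P') :
    ∃ Q', ProcStep Q l Q' ∧ ProcEq P' Q' := by
  simpa only [pStep_some] using (pStep_some.2 hP).procEq h

/-- Separates the positive part of a time step from maximal progress. `ProcTime` tests the latter
only at parallel compositions, but the axioms start from processes without `τ`, and recursions and
conditionals have the `τ`-steps of the process they stand for. -/
theorem procTime_iff {P Q : Proc S} :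
    ProcTime P Q ↔ PStep P none Q ∧ ¬ ∃ R, ProcStep P .tau R := by
  constructor
  · intro h
    induction h with
    | timeNil => exact ⟨⟨0, .timeNil 0⟩, fun ⟨_, h⟩ => by cases h⟩
    | delay P => exact ⟨⟨0, .delay 0 P⟩, fun ⟨_, h⟩ => by cases h⟩
    | timeout π P Q => exact ⟨⟨0, .timeout 0 π P Q⟩, fun ⟨_, h⟩ => by cases h⟩
    | par _ _ hn ih₁ ih₂ => exact ⟨ih₁.1.timePar ih₂.1, hn⟩
    | fix _ ih => exact ⟨ih.1.fix, fun ⟨R, h⟩ => by cases h with | fix h => exact ih.2 ⟨R, h⟩⟩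
    | condT _ hb _ ih =>
      refine ⟨ih.1.condT _ hb, fun ⟨R, h⟩ => ?_⟩
      cases h with
      | condT _ _ h => exact ih.2 ⟨R, h⟩
      | condF _ hb' h => exact absurd (hb.unique hb') (by decide)
    | condF _ hb _ ih =>
      refine ⟨ih.1.condF _ hb, fun ⟨R, h⟩ => ?_⟩
      cases h with
      | condT _ hb' h => exact absurd (hb.unique hb') (by decide)
      | condF _ _ h => exact ih.2 ⟨R, h⟩
  · rintro ⟨⟨n, h⟩, hn⟩
    generalize hl : none = l at h
    induction h with
    | timeNil => exact .timeNil
    | delay => exact .delay _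
    | timeout => exact .timeout _ _ _
    | timePar _ _ ih₁ ih₂ =>
      exact .par (ih₁ (fun ⟨_, h⟩ => hn ⟨_, h.parL _⟩) hl) (ih₂ (fun ⟨_, h⟩ => hn ⟨_, h.parR _⟩) hl) hn
    | fix _ ih => exact .fix (ih (fun ⟨_, h⟩ => hn ⟨_, h.fix⟩) hl)
    | condT _ hb _ ih => exact .condT _ hb (ih (fun ⟨_, h⟩ => hn ⟨_, h.condT _ hb⟩) hl)
    | condF _ hb _ ih => exact .condF _ hb (ih (fun ⟨_, h⟩ => hn ⟨_, h.condF _ hb⟩) hl)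
    | _ => cases hl

end ProcessConversion

/-! ### Transitions preserve closedness, guardedness, used interfaces and channels -/

section SubjectReduction

variable {S : Sig.{u}}

theorem Expr.Closed.shift {e : Expr S} {n : ℕ} (h : e.Closed n) (c m : ℕ) :
    (e.shift c m).Closed (n + m) := by
  cases e with
  | val => trivial
  | var i => simp only [Expr.Closed, Expr.shift] at *; split_ifs <;> omega

theorem Expr.Closed.subst {e : Expr S} {n k : ℕ} (h : e.Closed (n + 1)) (hk : k ≤ n) (v : S.Val) :
    (e.subst k v).Closed n := by
  cases e with
  | val => trivial
  | var i =>
    simp only [Expr.Closed, Expr.subst] at *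
    split_ifs <;> simp only <;> omega

theorem Guard.Closed.mapExpr {b : Guard S} {n m : ℕ} {f : Expr S → Expr S} (h : b.Closed n)
    (hf : ∀ e : Expr S, e.Closed n → (f e).Closed m) : (b.mapExpr f).Closed m := by
  intro e he
  obtain ⟨e', he', rfl⟩ := List.mem_map.1 he
  exact hf e' (h e' he')

theorem Proc.Closed.shiftV {P : Proc S} : ∀ {n m : ℕ}, P.Closed n m → ∀ c k,
    (P.shiftV c k).Closed (n + k) m := by
  induction P with
  | nil => intros; trivial
  | pvar X => intro n m h c k; exact h
  | pre ρ P ih =>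
    intro n m h c k
    refine ⟨?_, ?_⟩
    · cases ρ with
      | write e a => exact h.1.shift c k
      | _ => trivial
    · rw [Rho.arity_mapExpr, Nat.add_right_comm]; exact ih h.2 _ k
  | par P Q ih₁ ih₂ => intro n m h c k; exact ⟨ih₁ h.1 c k, ih₂ h.2 c k⟩
  | timeout π P Q ih₁ ih₂ =>
    intro n m h c k
    refine ⟨?_, ?_, ih₂ h.2.2 c k⟩
    · cases π with
      | out d e => exact h.1.shift c k
      | inp d => trivial
    · rw [Pi.arity_mapExpr, Nat.add_right_comm]; exact ih₁ h.2.1 _ k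
  | cond b P Q ih₁ ih₂ =>
    intro n m h c k
    exact ⟨h.1.mapExpr fun e he => he.shift c k, ih₁ h.2.1 c k, ih₂ h.2.2 c k⟩
  | fix P ih => intro n m h c k; exact ih (m := m + 1) h c k

theorem Proc.Closed.subst {P : Proc S} : ∀ {n m k : ℕ}, P.Closed (n + 1) m → k ≤ n → ∀ v,
    (P.subst k v).Closed n m := by
  induction P with
  | nil => intros; trivial
  | pvar X => intro n m k h _ v; exact h
  | pre ρ P ih =>
    intro n m k h hk v
    refine ⟨?_, ?_⟩
    · cases ρ with
      | write e a => exact h.1.subst hk v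
      | _ => trivial
    · rw [Rho.arity_mapExpr]; exact ih (Nat.add_right_comm n 1 _ ▸ h.2) (by omega) v
  | par P Q ih₁ ih₂ => intro n m k h hk v; exact ⟨ih₁ h.1 hk v, ih₂ h.2 hk v⟩
  | timeout π P Q ih₁ ih₂ =>
    intro n m k h hk v
    refine ⟨?_, ?_, ih₂ h.2.2 hk v⟩
    · cases π with
      | out d e => exact h.1.subst hk v
      | inp d => trivial
    · rw [Pi.arity_mapExpr]; exact ih₁ (Nat.add_right_comm n 1 _ ▸ h.2.1) (by omega) v
  | cond b P Q ih₁ ih₂ =>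
    intro n m k h hk v
    exact ⟨h.1.mapExpr fun e he => he.subst hk v, ih₁ h.2.1 hk v, ih₂ h.2.2 hk v⟩
  | fix P ih => intro n m k h hk v; exact ih (m := m + 1) h hk v

theorem Proc.Closed.shiftP {P : Proc S} : ∀ {n m : ℕ}, P.Closed n m → ∀ c,
    (P.shiftP c).Closed n (m + 1) := by
  induction P with
  | nil => intros; trivial
  | pvar X =>
    intro n m h c
    simp only [Proc.Closed, Proc.shiftP] at *
    split_ifs <;> omega
  | pre ρ P ih => intro n m h c; exact ⟨h.1, ih h.2 c⟩
  | par P Q ih₁ ih₂ => intro n m h c; exact ⟨ih₁ h.1 c, ih₂ h.2 c⟩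
  | timeout π P Q ih₁ ih₂ | cond b P Q ih₁ ih₂ =>
    intro n m h c; exact ⟨h.1, ih₁ h.2.1 c, ih₂ h.2.2 c⟩
  | fix P ih => intro n m h c; exact ih (m := m + 1) h _

theorem Proc.Closed.psubst {P : Proc S} : ∀ {n m k : ℕ} {R : Proc S}, P.Closed n (m + 1) →
    R.Closed n m → k ≤ m → (Proc.psubst k R P).Closed n m := by
  induction P with
  | nil => intros; trivial
  | pvar X =>
    intro n m k R h hR hk
    simp only [Proc.Closed, Proc.psubst] at *
    split_ifs
    · simp only [Proc.Closed]; omega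
    · exact hR
    · simp only [Proc.Closed]; omega
  | pre ρ P ih => intro n m k R h hR hk; exact ⟨h.1, ih h.2 (hR.shiftV 0 _) hk⟩
  | par P Q ih₁ ih₂ => intro n m k R h hR hk; exact ⟨ih₁ h.1 hR hk, ih₂ h.2 hR hk⟩
  | timeout π P Q ih₁ ih₂ =>
    intro n m k R h hR hk
    exact ⟨h.1, ih₁ h.2.1 (hR.shiftV 0 _) hk, ih₂ h.2.2 hR hk⟩
  | cond b P Q ih₁ ih₂ =>
    intro n m k R h hR hk; exact ⟨h.1, ih₁ h.2.1 hR hk, ih₂ h.2.2 hR hk⟩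
  | fix P ih =>
    intro n m k R h hR hk; exact ih (m := m + 1) h (hR.shiftP 0) (Nat.succ_le_succ hk)

theorem BStep.closed {n : ℕ} {P Q : Proc S} {l : Option (PLabel S)} (h : BStep n P l Q)
    (hP : P.Closed 0 0) : Q.Closed 0 0 := by
  induction h with
  | sndP => exact hP.2.1
  | rcvP => exact hP.2.1.subst le_rfl _
  | sensor => exact hP.2.subst le_rfl _
  | actuator => exact hP.2
  | posP => exact hP.2.subst le_rfl _
  | timeNil => trivial
  | delay => exact hP.2
  | timeout => exact hP.2.2
  | comL _ _ _ ih₁ ih₂ | comR _ _ _ ih₁ ih₂ => exact ⟨ih₁ hP.1, ih₂ hP.2⟩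
  | timePar _ _ ih₁ ih₂ => exact ⟨ih₁ hP.1, ih₂ hP.2⟩
  | parL _ _ ih => exact ⟨ih hP.1, hP.2⟩
  | parR _ _ ih => exact ⟨hP.1, ih hP.2⟩
  | fix _ ih => exact ih (Proc.Closed.psubst hP hP le_rfl)
  | condT _ _ _ ih => exact ih hP.2.1
  | condF _ _ _ ih => exact ih hP.2.2

theorem Proc.TimeGuarded.shiftV {P : Proc S} : ∀ {X : ℕ}, P.TimeGuarded X → ∀ c n,
    (P.shiftV c n).TimeGuarded X := by
  induction P with
  | nil => intros; trivial
  | pvar Y => intro X h c n; exact h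
  | pre ρ P ih =>
    intro X h c n
    cases ρ with
    | sleep => trivial
    | _ => exact ih h _ n
  | par P Q ih₁ ih₂ | cond b P Q ih₁ ih₂ => intro X h c n; exact ⟨ih₁ h.1 c n, ih₂ h.2 c n⟩
  | timeout π P Q ih₁ ih₂ => intro X h c n; exact ih₁ (X := X) h _ n
  | fix P ih => intro X h c n; exact ih (X := X + 1) h c n

theorem Proc.TimeGuarded.subst {P : Proc S} : ∀ {X : ℕ}, P.TimeGuarded X → ∀ k v,
    (P.subst k v).TimeGuarded X := by
  induction P with
  | nil => intros; trivial
  | pvar Y => intro X h k v; exact h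
  | pre ρ P ih =>
    intro X h k v
    cases ρ with
    | sleep => trivial
    | _ => exact ih h _ v
  | par P Q ih₁ ih₂ | cond b P Q ih₁ ih₂ => intro X h k v; exact ⟨ih₁ h.1 k v, ih₂ h.2 k v⟩
  | timeout π P Q ih₁ ih₂ => intro X h k v; exact ih₁ (X := X) h _ v
  | fix P ih => intro X h k v; exact ih (X := X + 1) h k v

/-- Holds because `X` does not occur at all after the shift. -/
theorem Proc.timeGuarded_shiftP_self (P : Proc S) : ∀ X, (P.shiftP X).TimeGuarded X := by
  induction P with
  | nil => intros; trivial
  | pvar Y =>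
    intro X
    simp only [Proc.shiftP, Proc.TimeGuarded]
    split_ifs <;> omega
  | pre ρ P ih =>
    intro X
    cases ρ with
    | sleep => trivial
    | _ => exact ih X
  | par P Q ih₁ ih₂ | cond b P Q ih₁ ih₂ => intro X; exact ⟨ih₁ X, ih₂ X⟩
  | timeout π P Q ih₁ ih₂ => intro X; exact ih₁ X
  | fix P ih => intro X; exact ih (X + 1)

theorem Proc.TimeGuarded.shiftP_of_lt {P : Proc S} : ∀ {X c : ℕ}, P.TimeGuarded X → X < c →
    (P.shiftP c).TimeGuarded X := by
  induction P with
  | nil => intros; trivial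
  | pvar Y =>
    intro X c h hc
    simp only [Proc.shiftP, Proc.TimeGuarded] at *
    split_ifs <;> omega
  | pre ρ P ih =>
    intro X c h hc
    cases ρ with
    | sleep => trivial
    | _ => exact ih h hc
  | par P Q ih₁ ih₂ | cond b P Q ih₁ ih₂ => intro X c h hc; exact ⟨ih₁ h.1 hc, ih₂ h.2 hc⟩
  | timeout π P Q ih₁ ih₂ => intro X c h hc; exact ih₁ (X := X) h hc
  | fix P ih => intro X c h hc; exact ih (X := X + 1) h (Nat.succ_lt_succ hc)

theorem Proc.TimeGuarded.shiftP_of_le {P : Proc S} : ∀ {X c : ℕ}, P.TimeGuarded X → c ≤ X →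
    (P.shiftP c).TimeGuarded (X + 1) := by
  induction P with
  | nil => intros; trivial
  | pvar Y =>
    intro X c h hc
    simp only [Proc.shiftP, Proc.TimeGuarded] at *
    split_ifs <;> omega
  | pre ρ P ih =>
    intro X c h hc
    cases ρ with
    | sleep => trivial
    | _ => exact ih h hc
  | par P Q ih₁ ih₂ | cond b P Q ih₁ ih₂ => intro X c h hc; exact ⟨ih₁ h.1 hc, ih₂ h.2 hc⟩
  | timeout π P Q ih₁ ih₂ => intro X c h hc; exact ih₁ (X := X) h hc
  | fix P ih => intro X c h hc; exact ih (X := X + 1) h (Nat.succ_le_succ hc)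

theorem Proc.TimeGuarded.psubst {P : Proc S} : ∀ {X k : ℕ} {R : Proc S}, P.TimeGuarded X →
    R.TimeGuarded X → X < k → (Proc.psubst k R P).TimeGuarded X := by
  induction P with
  | nil => intros; trivial
  | pvar Y =>
    intro X k R h hR hk
    simp only [Proc.psubst, Proc.TimeGuarded] at *
    split_ifs
    · exact h
    · exact hR
    · simp only [Proc.TimeGuarded]; omega
  | pre ρ P ih =>
    intro X k R h hR hk
    cases ρ with
    | sleep => trivial
    | _ => exact ih h (hR.shiftV _ _) hk
  | par P Q ih₁ ih₂ | cond b P Q ih₁ ih₂ =>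
    intro X k R h hR hk; exact ⟨ih₁ h.1 hR hk, ih₂ h.2 hR hk⟩
  | timeout π P Q ih₁ ih₂ => intro X k R h hR hk; exact ih₁ (X := X) h (hR.shiftV _ _) hk
  | fix P ih =>
    intro X k R h hR hk
    exact ih (X := X + 1) h (hR.shiftP_of_le (Nat.zero_le _)) (Nat.succ_lt_succ hk)

theorem Proc.RecGuarded.shiftV {P : Proc S} (h : P.RecGuarded) : ∀ c n,
    (P.shiftV c n).RecGuarded := by
  induction P with
  | nil | pvar => intros; trivial
  | pre ρ P ih => intro c n; exact ih h _ n
  | par P Q ih₁ ih₂ | cond b P Q ih₁ ih₂ => intro c n; exact ⟨ih₁ h.1 c n, ih₂ h.2 c n⟩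
  | timeout π P Q ih₁ ih₂ => intro c n; exact ⟨ih₁ h.1 _ n, ih₂ h.2 c n⟩
  | fix P ih => intro c n; exact ⟨h.1.shiftV c n, ih h.2 c n⟩

theorem Proc.RecGuarded.subst {P : Proc S} (h : P.RecGuarded) : ∀ k v,
    (P.subst k v).RecGuarded := by
  induction P with
  | nil | pvar => intros; trivial
  | pre ρ P ih => intro k v; exact ih h _ v
  | par P Q ih₁ ih₂ | cond b P Q ih₁ ih₂ => intro k v; exact ⟨ih₁ h.1 k v, ih₂ h.2 k v⟩
  | timeout π P Q ih₁ ih₂ => intro k v; exact ⟨ih₁ h.1 _ v, ih₂ h.2 k v⟩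
  | fix P ih => intro k v; exact ⟨h.1.subst k v, ih h.2 k v⟩

theorem Proc.RecGuarded.shiftP {P : Proc S} (h : P.RecGuarded) : ∀ c, (P.shiftP c).RecGuarded := by
  induction P with
  | nil | pvar => intros; trivial
  | pre ρ P ih => intro c; exact ih h c
  | par P Q ih₁ ih₂ | cond b P Q ih₁ ih₂ | timeout π P Q ih₁ ih₂ =>
    intro c; exact ⟨ih₁ h.1 c, ih₂ h.2 c⟩
  | fix P ih => intro c; exact ⟨h.1.shiftP_of_lt (Nat.succ_pos c), ih h.2 _⟩

theorem Proc.RecGuarded.psubst {P : Proc S} (h : P.RecGuarded) : ∀ (k : ℕ) {R : Proc S},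
    R.RecGuarded → (Proc.psubst k R P).RecGuarded := by
  induction P with
  | nil => intros; trivial
  | pvar Y =>
    intro k R hR
    simp only [Proc.psubst]
    split_ifs
    exacts [trivial, hR, trivial]
  | pre ρ P ih => intro k R hR; exact ih h k (hR.shiftV _ _)
  | par P Q ih₁ ih₂ | cond b P Q ih₁ ih₂ => intro k R hR; exact ⟨ih₁ h.1 k hR, ih₂ h.2 k hR⟩
  | timeout π P Q ih₁ ih₂ => intro k R hR; exact ⟨ih₁ h.1 k (hR.shiftV _ _), ih₂ h.2 k hR⟩
  | fix P ih =>
    intro k R hR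
    -- Under the binder `R` is shifted past the variable bound there, so inserting it adds no
    -- occurrence of that variable.
    exact ⟨h.1.psubst (R.timeGuarded_shiftP_self 0) (Nat.succ_pos k), ih h.2 _ (hR.shiftP 0)⟩

theorem BStep.recGuarded {n : ℕ} {P Q : Proc S} {l : Option (PLabel S)} (h : BStep n P l Q)
    (hP : P.RecGuarded) : Q.RecGuarded := by
  induction h with
  | sndP => exact hP.1
  | rcvP => exact hP.1.subst _ _
  | @sensor _ _ _ P | @posP _ _ P => exact Proc.RecGuarded.subst (P := P) hP _ _
  | actuator | delay => exact hP
  | timeNil => trivial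
  | timeout => exact hP.2
  | comL _ _ _ ih₁ ih₂ | comR _ _ _ ih₁ ih₂ => exact ⟨ih₁ hP.1, ih₂ hP.2⟩
  | timePar _ _ ih₁ ih₂ => exact ⟨ih₁ hP.1, ih₂ hP.2⟩
  | parL _ _ ih => exact ⟨ih hP.1, hP.2⟩
  | parR _ _ ih => exact ⟨hP.1, ih hP.2⟩
  | fix _ ih => exact ih (hP.2.psubst 0 hP)
  | condT _ _ _ ih => exact ih hP.1
  | condF _ _ _ ih => exact ih hP.2

theorem Proc.usesOnly_shiftV {I : Interface S} (P : Proc S) : ∀ c n,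
    (P.shiftV c n).UsesOnly I ↔ P.UsesOnly I := by
  induction P with
  | pre ρ P ih => intro c n; cases ρ <;> simp [Proc.shiftV, Proc.UsesOnly, Rho.mapExpr, ih]
  | _ => intros; simp_all [Proc.shiftV, Proc.UsesOnly]

theorem Proc.usesOnly_subst {I : Interface S} (P : Proc S) : ∀ k v,
    (P.subst k v).UsesOnly I ↔ P.UsesOnly I := by
  induction P with
  | pre ρ P ih => intro c n; cases ρ <;> simp [Proc.subst, Proc.UsesOnly, Rho.mapExpr, ih]
  | _ => intros; simp_all [Proc.subst, Proc.UsesOnly]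

theorem Proc.usesOnly_shiftP {I : Interface S} (P : Proc S) : ∀ c,
    (P.shiftP c).UsesOnly I ↔ P.UsesOnly I := by
  induction P <;> intros <;> simp_all [Proc.shiftP, Proc.UsesOnly]

theorem Proc.UsesOnly.psubst {I : Interface S} {P : Proc S} (h : P.UsesOnly I) :
    ∀ (k : ℕ) {R : Proc S}, R.UsesOnly I → (Proc.psubst k R P).UsesOnly I := by
  induction P with
  | nil => intros; trivial
  | pvar Y =>
    intro k R hR
    simp only [Proc.psubst]
    split_ifs
    exacts [trivial, hR, trivial]
  | pre ρ P ih => intro k R hR; exact ⟨h.1, ih h.2 k ((R.usesOnly_shiftV _ _).2 hR)⟩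
  | par P Q ih₁ ih₂ | cond b P Q ih₁ ih₂ => intro k R hR; exact ⟨ih₁ h.1 k hR, ih₂ h.2 k hR⟩
  | timeout π P Q ih₁ ih₂ =>
    intro k R hR; exact ⟨ih₁ h.1 k ((R.usesOnly_shiftV _ _).2 hR), ih₂ h.2 k hR⟩
  | fix P ih => intro k R hR; exact ih h _ ((R.usesOnly_shiftP 0).2 hR)

theorem Proc.UsesOnly.unfold {I : Interface S} {P : Proc S} (h : (Proc.fix P).UsesOnly I) :
    P.unfold.UsesOnly I := Proc.UsesOnly.psubst (P := P) h 0 h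

theorem BStep.usesOnly {I : Interface S} {n : ℕ} {P Q : Proc S} {l : Option (PLabel S)}
    (h : BStep n P l Q) (hP : P.UsesOnly I) : Q.UsesOnly I := by
  induction h with
  | sndP => exact hP.1
  | rcvP => exact (Proc.usesOnly_subst _ _ _).2 hP.1
  | sensor | posP => exact (Proc.usesOnly_subst _ _ _).2 hP.2
  | actuator | delay => exact hP.2
  | timeNil => trivial
  | timeout => exact hP.2
  | comL _ _ _ ih₁ ih₂ | comR _ _ _ ih₁ ih₂ => exact ⟨ih₁ hP.1, ih₂ hP.2⟩
  | timePar _ _ ih₁ ih₂ => exact ⟨ih₁ hP.1, ih₂ hP.2⟩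
  | parL _ _ ih => exact ⟨ih hP.1, hP.2⟩
  | parR _ _ ih => exact ⟨hP.1, ih hP.2⟩
  | fix _ ih => exact ih (Proc.UsesOnly.unfold hP)
  | condT _ _ _ ih => exact ih hP.1
  | condF _ _ _ ih => exact ih hP.2

/-- Ensures that a write never enlarges an interface and that a changed actuator can be traced back
to the node owning it. -/
theorem ProcStep.act_isSome {I : Interface S} {P Q : Proc S} {a : S.Act} {v : S.Val}
    (h : ProcStep P (.act a v) Q) (hP : P.UsesOnly I) : (I.act a).isSome := by
  generalize hl : PLabel.act a v = l at h
  induction h with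
  | actuator => cases hl; exact hP.1
  | parL _ _ ih => exact ih hP.1 hl
  | parR _ _ ih => exact ih hP.2 hl
  | fix _ ih => exact ih (Proc.UsesOnly.unfold hP) hl
  | condT _ _ _ ih => exact ih hP.1 hl
  | condF _ _ _ ih => exact ih hP.2 hl
  | _ => cases hl

/-! ### Channels of processes -/

/-- The channel of a label, if any. -/
def PLabel.chans : PLabel S → Set S.Chan
  | .out c _ => {c}
  | .inp c _ => {c}
  | _ => ∅

def PLabel.mapChan (f : S.Chan → S.Chan) : PLabel S → PLabel S
  | .tau => .tau
  | .out c v => .out (f c) v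
  | .inp c v => .inp (f c) v
  | .pos h => .pos h
  | .sens s v => .sens s v
  | .act a v => .act a v

theorem Proc.chans_shiftV (P : Proc S) : ∀ c n, (P.shiftV c n).chans = P.chans := by
  induction P with
  | timeout π P Q ih₁ ih₂ =>
    intro c n; cases π <;> simp [Proc.shiftV, Proc.chans, Pi.mapExpr, ih₁, ih₂]
  | _ => intros; simp_all [Proc.shiftV, Proc.chans]

theorem Proc.chans_subst (P : Proc S) : ∀ k v, (P.subst k v).chans = P.chans := by
  induction P with
  | timeout π P Q ih₁ ih₂ =>
    intro c n; cases π <;> simp [Proc.subst, Proc.chans, Pi.mapExpr, ih₁, ih₂]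
  | _ => intros; simp_all [Proc.subst, Proc.chans]

theorem Proc.chans_shiftP (P : Proc S) : ∀ c, (P.shiftP c).chans = P.chans := by
  induction P <;> intros <;> simp_all [Proc.shiftP, Proc.chans]

theorem Proc.chans_psubst (P : Proc S) : ∀ (k : ℕ) (R : Proc S),
    (Proc.psubst k R P).chans ⊆ P.chans ∪ R.chans := by
  induction P with
  | nil => intro k R; exact Set.empty_subset _
  | pvar X =>
    intro k R
    simp only [Proc.psubst]
    split_ifs
    exacts [Set.empty_subset _, Set.subset_union_right, Set.empty_subset _]
  | pre ρ P ih =>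
    intro k R
    have := ih k (R.shiftV 0 ρ.arity)
    rwa [Proc.chans_shiftV] at this
  | par P Q ih₁ ih₂ | cond b P Q ih₁ ih₂ =>
    intro k R
    rintro c (h | h)
    · rcases ih₁ k R h with h | h
      exacts [.inl (.inl h), .inr h]
    · rcases ih₂ k R h with h | h
      exacts [.inl (.inr h), .inr h]
  | timeout π P Q ih₁ ih₂ =>
    intro k R
    have := ih₁ k (R.shiftV 0 π.arity)
    rw [Proc.chans_shiftV] at this
    rintro c (h | h | h)
    · exact .inl (.inl h)
    · rcases this h with h | h
      exacts [.inl (.inr (.inl h)), .inr h]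
    · rcases ih₂ k R h with h | h
      exacts [.inl (.inr (.inr h)), .inr h]
  | fix P ih =>
    intro k R
    have := ih (k + 1) (R.shiftP 0)
    rwa [Proc.chans_shiftP] at this

theorem Proc.chans_unfold (P : Proc S) : P.unfold.chans ⊆ P.chans := by
  have := P.chans_psubst 0 (.fix P)
  rwa [show (Proc.fix P).chans = P.chans from rfl, Set.union_self] at this

theorem Proc.finite_chans (P : Proc S) : P.chans.Finite := by
  induction P with
  | nil | pvar => exact Set.finite_empty
  | pre ρ P ih => exact ih
  | par P Q ih₁ ih₂ | cond b P Q ih₁ ih₂ => exact ih₁.union ih₂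
  | timeout π P Q ih₁ ih₂ =>
    refine Set.Finite.union ?_ (ih₁.union ih₂)
    cases π <;> exact Set.finite_singleton _
  | fix P ih => exact ih

theorem BStep.chans_subset {n : ℕ} {P Q : Proc S} {l : Option (PLabel S)} (h : BStep n P l Q) :
    Q.chans ⊆ P.chans := by
  induction h with
  | sndP | timeout => intro c hc; simp_all [Proc.chans]
  | rcvP => intro c hc; simp_all [Proc.chans, Proc.chans_subst]
  | sensor | posP => rw [Proc.chans_subst]; exact le_rfl
  | actuator | delay | timeNil => exact le_rfl
  | comL _ _ _ ih₁ ih₂ | comR _ _ _ ih₁ ih₂ => exact Set.union_subset_union ih₁ ih₂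
  | timePar _ _ ih₁ ih₂ => exact Set.union_subset_union ih₁ ih₂
  | parL _ _ ih => exact Set.union_subset_union_left _ ih
  | parR _ _ ih => exact Set.union_subset_union_right _ ih
  | fix _ ih => exact ih.trans (Proc.chans_unfold _)
  | condT _ _ _ ih => exact ih.trans Set.subset_union_left
  | condF _ _ _ ih => exact ih.trans Set.subset_union_right

theorem ProcStep.chans_subset {P Q : Proc S} {l : PLabel S} (h : ProcStep P l Q) :
    Q.chans ⊆ P.chans := (pStep_some.2 h).elim fun _ h => h.chans_subset

theorem ProcStep.label_chans {P Q : Proc S} {l : PLabel S} (h : ProcStep P l Q) :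
    l.chans ⊆ P.chans := by
  induction h with
  | sndP | rcvP => exact Set.subset_union_left
  | sensor | posP | actuator | comL | comR => exact Set.empty_subset _
  | parL _ _ ih => exact ih.trans Set.subset_union_left
  | parR _ _ ih => exact ih.trans Set.subset_union_right
  | fix _ ih => exact ih.trans (Proc.chans_unfold _)
  | condT _ _ _ ih => exact ih.trans Set.subset_union_left
  | condF _ _ _ ih => exact ih.trans Set.subset_union_right

theorem Proc.chans_mapChan (f : S.Chan → S.Chan) (P : Proc S) :
    (P.mapChan f).chans = f '' P.chans := by
  induction P with
  | timeout π P Q ih₁ ih₂ =>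
    cases π <;> simp [Proc.mapChan, Proc.chans, Pi.mapChan, ih₁, ih₂, Set.image_union,
      Set.image_insert_eq]
  | _ => simp_all [Proc.mapChan, Proc.chans, Set.image_union]

theorem Proc.mapChan_mapChan (f g : S.Chan → S.Chan) (P : Proc S) :
    (P.mapChan f).mapChan g = P.mapChan (g ∘ f) := by
  induction P with
  | timeout π P Q ih₁ ih₂ => cases π <;> simp [Proc.mapChan, Pi.mapChan, ih₁, ih₂]
  | _ => simp_all [Proc.mapChan]

theorem Proc.mapChan_congr {f g : S.Chan → S.Chan} {P : Proc S} (h : ∀ c ∈ P.chans, f c = g c) :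
    P.mapChan f = P.mapChan g := by
  induction P with
  | nil | pvar => rfl
  | pre ρ P ih => simp only [Proc.mapChan, ih h]
  | par P Q ih₁ ih₂ | cond b P Q ih₁ ih₂ =>
    simp only [Proc.mapChan, ih₁ fun c hc => h c (.inl hc), ih₂ fun c hc => h c (.inr hc)]
  | timeout π P Q ih₁ ih₂ =>
    simp only [Proc.mapChan, ih₁ fun c hc => h c (.inr (.inl hc)),
      ih₂ fun c hc => h c (.inr (.inr hc))]
    congr 1
    cases π <;> simp only [Pi.mapChan] <;> congr 1 <;> exact h _ (.inl rfl)
  | fix P ih => simp only [Proc.mapChan, ih h]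

theorem Proc.mapChan_id (P : Proc S) : P.mapChan id = P := by
  induction P with
  | timeout π P Q ih₁ ih₂ => cases π <;> simp [Proc.mapChan, Pi.mapChan, ih₁, ih₂]
  | _ => simp_all [Proc.mapChan]

theorem BStep.mapChan {n : ℕ} {P Q : Proc S} {l : Option (PLabel S)} (h : BStep n P l Q)
    {f : S.Chan → S.Chan} (hf : ∀ c, S.rng (f c) = S.rng c) :
    BStep n (P.mapChan f) (l.map (PLabel.mapChan f)) (Q.mapChan f) := by
  induction h with
  | sndP => exact .sndP ..
  | rcvP => rw [Proc.mapChan_subst]; exact .rcvP ..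
  | sensor => rw [Proc.mapChan_subst]; exact .sensor ..
  | posP => rw [Proc.mapChan_subst]; exact .posP ..
  | actuator => exact .actuator ..
  | timeNil => exact .timeNil _
  | delay => exact .delay ..
  | timeout => exact .timeout ..
  | comL _ _ hc ih₁ ih₂ => exact .comL ih₁ ih₂ ((hf _).trans hc)
  | comR _ _ hc ih₁ ih₂ => exact .comR ih₁ ih₂ ((hf _).trans hc)
  | timePar _ _ ih₁ ih₂ => exact .timePar ih₁ ih₂
  | parL _ _ ih => exact .parL _ ih
  | parR _ _ ih => exact .parR _ ih
  | fix _ ih => rw [Proc.mapChan_unfold] at ih; exact .fix ih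
  | condT _ hb _ ih => exact .condT _ hb ih
  | condF _ hb _ ih => exact .condF _ hb ih

theorem ProcStep.mapChan {P Q : Proc S} {l : PLabel S} (h : ProcStep P l Q)
    {f : S.Chan → S.Chan} (hf : ∀ c, S.rng (f c) = S.rng c) :
    ProcStep (P.mapChan f) (l.mapChan f) (Q.mapChan f) := by
  obtain ⟨n, h⟩ := pStep_some.2 h
  exact pStep_some.1 ⟨n, h.mapChan hf⟩

theorem PStep.mapChan {P Q : Proc S} {l : Option (PLabel S)} (h : PStep P l Q)
    {f : S.Chan → S.Chan} (hf : ∀ c, S.rng (f c) = S.rng c) :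
    PStep (P.mapChan f) (l.map (PLabel.mapChan f)) (Q.mapChan f) :=
  h.elim fun n h => ⟨n, h.mapChan hf⟩

end SubjectReduction

/-! ### Structural congruence of networks is compatible with transitions and with time -/

section NetworkTransitions

variable {S : Sig.{u}}

/-! ### Channels of networks -/

open Classical in
/-- The transposition of two channels. -/
noncomputable def swapFun (c d : S.Chan) : S.Chan → S.Chan := Equiv.swap c d

@[simp] theorem swapFun_left (c d : S.Chan) : swapFun c d c = d := by simp [swapFun]

@[simp] theorem swapFun_right (c d : S.Chan) : swapFun c d d = c := by simp [swapFun]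

open Classical in
theorem swapFun_of_ne {c d x : S.Chan} (hc : x ≠ c) (hd : x ≠ d) : swapFun c d x = x :=
  Equiv.swap_apply_of_ne_of_ne hc hd

theorem swapFun_injective (c d : S.Chan) : Function.Injective (swapFun c d) :=
  Equiv.injective _

open Classical in
theorem swapFun_comm (c d : S.Chan) : swapFun c d = swapFun d c := by
  simp [swapFun, Equiv.swap_comm c d]

theorem swapFun_comp_self (c d : S.Chan) : swapFun c d ∘ swapFun c d = id := by
  funext x; simp [swapFun]

theorem rng_swapFun {c d : S.Chan} (h : S.rng d = S.rng c) (x : S.Chan) :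
    S.rng (swapFun c d x) = S.rng x := by
  by_cases hc : x = c
  · subst hc; simpa using h
  by_cases hd : x = d
  · subst hd; simpa using h.symm
  rw [swapFun_of_ne hc hd]

open Classical in
theorem comp_swapFun {f : S.Chan → S.Chan} (hf : Function.Injective f) (c d : S.Chan) :
    f ∘ swapFun c d = swapFun (f c) (f d) ∘ f := by
  funext x
  exact (hf.map_swap _ _ _)

theorem Net.swapChan_eq (c d : S.Chan) (M : Net S) : M.swapChan c d = M.mapChan (swapFun c d) := rfl

theorem Net.mapChan_mapChan (f g : S.Chan → S.Chan) (M : Net S) :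
    (M.mapChan f).mapChan g = M.mapChan (g ∘ f) := by
  induction M <;> simp_all [Net.mapChan, Proc.mapChan_mapChan]

theorem Net.mapChan_id (M : Net S) : M.mapChan id = M := by
  induction M <;> simp_all [Net.mapChan, Proc.mapChan_id]

theorem Net.swapChan_swapChan (c d : S.Chan) (M : Net S) : (M.swapChan c d).swapChan c d = M := by
  simp only [Net.swapChan_eq, Net.mapChan_mapChan, swapFun_comp_self, Net.mapChan_id]

theorem Net.swapChan_comm (c d : S.Chan) (M : Net S) : M.swapChan c d = M.swapChan d c := by
  simp only [Net.swapChan_eq, swapFun_comm c d]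

theorem Net.freeChans_mapChan {f : S.Chan → S.Chan} (hf : Function.Injective f) (M : Net S) :
    (M.mapChan f).freeChans = f '' M.freeChans := by
  induction M with
  | zero => exact (Set.image_empty f).symm
  | node n I P μ h => exact P.chans_mapChan f
  | par M N ih₁ ih₂ => simp only [Net.mapChan, Net.freeChans, ih₁, ih₂, Set.image_union]
  | res c M ih => simp only [Net.mapChan, Net.freeChans, ih, Set.image_sdiff hf, Set.image_singleton]

theorem Net.finite_freeChans (M : Net S) : M.freeChans.Finite := by
  induction M with
  | zero => exact Set.finite_empty
  | node n I P μ h => exact P.finite_chans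
  | par M N ih₁ ih₂ => exact ih₁.union ih₂
  | res c M ih => exact ih.subset Set.sdiff_subset

theorem Net.notMem_freeChans_swapChan {c d : S.Chan} {M : Net S} (h : d ∉ M.freeChans) :
    c ∉ (M.swapChan c d).freeChans := by
  rw [Net.swapChan_eq, Net.freeChans_mapChan (swapFun_injective c d)]
  rintro ⟨x, hx, hxc⟩
  exact h (swapFun_injective c d (hxc.trans (swapFun_right c d).symm) ▸ hx)

theorem Sig.exists_fresh (c : S.Chan) {F : Set S.Chan} (hF : F.Finite) :
    ∃ d, S.rng d = S.rng c ∧ d ∉ F :=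
  ((S.infinite_chan c).exists_notMem_finite hF)

/-! ### Transitions and channels -/

/-- The channel of a label, if any. -/
def NLabel.chans : NLabel S → Set S.Chan
  | .snd c _ _ => {c}
  | .rcv c _ _ => {c}
  | _ => ∅

def NLabel.mapChan (f : S.Chan → S.Chan) : NLabel S → NLabel S
  | .tau => .tau
  | .act a => .act a
  | .snd c v h => .snd (f c) v h
  | .rcv c v h => .rcv (f c) v h

theorem NLabel.notMem_chans {l : NLabel S} {c : S.Chan} :
    (∀ v h, l ≠ .snd c v h ∧ l ≠ .rcv c v h) ↔ c ∉ l.chans := by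
  cases l with
  | tau | act a => simp [NLabel.chans]
  | snd d v h =>
    refine ⟨fun H hc => (H v h).1 (congrArg (NLabel.snd · v h) (Eq.symm hc)), fun H w k => ⟨?_, ?_⟩⟩
    · rintro ⟨⟩; exact H rfl
    · rintro ⟨⟩
  | rcv d v h =>
    refine ⟨fun H hc => (H v h).2 (congrArg (NLabel.rcv · v h) (Eq.symm hc)), fun H w k => ⟨?_, ?_⟩⟩
    · rintro ⟨⟩
    · rintro ⟨⟩; exact H rfl

theorem NLabel.mapChan_eq_self {f : S.Chan → S.Chan} {l : NLabel S} (h : ∀ c ∈ l.chans, f c = c) :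
    l.mapChan f = l := by
  cases l with
  | tau | act a => rfl
  | snd c v k | rcv c v k => simp only [NLabel.mapChan, h c rfl]

theorem NLabel.chans_mapChan (f : S.Chan → S.Chan) (l : NLabel S) :
    (l.mapChan f).chans = f '' l.chans := by
  cases l <;> simp [NLabel.mapChan, NLabel.chans]

theorem NetStep.res' {M M' : Net S} {l : NLabel S} {c : S.Chan} (h : NetStep M l M')
    (hc : c ∉ l.chans) : NetStep (.res c M) l (.res c M') := .res c h (NLabel.notMem_chans.2 hc)

theorem NetStep.label_chans {M M' : Net S} {l : NLabel S} (h : NetStep M l M') :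
    l.chans ⊆ M.freeChans := by
  induction h with
  | pos | sensRead | actUnChg | locCom | actChg | glbComL | glbComR => exact Set.empty_subset _
  | snd _ _ _ _ h | rcv _ _ _ _ h => exact h.label_chans
  | parL _ _ ih => exact ih.trans Set.subset_union_left
  | parR _ _ ih => exact ih.trans Set.subset_union_right
  | res c _ hc ih => exact Set.subset_sdiff_singleton ih (NLabel.notMem_chans.1 hc)

theorem NetStep.freeChans_subset {M M' : Net S} {l : NLabel S} (h : NetStep M l M') :
    M'.freeChans ⊆ M.freeChans := by
  induction h with
  | pos _ _ _ h | sensRead _ _ _ _ h | actUnChg _ _ _ _ h | locCom _ _ _ _ h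
  | actChg _ _ _ _ h | snd _ _ _ _ h | rcv _ _ _ _ h => exact h.chans_subset
  | glbComL _ _ _ ih₁ ih₂ | glbComR _ _ _ ih₁ ih₂ => exact Set.union_subset_union ih₁ ih₂
  | parL _ _ ih => exact Set.union_subset_union_left _ ih
  | parR _ _ ih => exact Set.union_subset_union_right _ ih
  | res c _ hc ih => exact Set.sdiff_subset_sdiff_left ih

/-- Injectivity preserves the side condition of restriction, and equality of ranges preserves who
can communicate with whom. The renamings of interest are transpositions of channels of equal range,
as in alpha-conversion. -/
theorem NetStep.mapChan {M M' : Net S} {l : NLabel S} (h : NetStep M l M')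
    {f : S.Chan → S.Chan} (hf : Function.Injective f) (hr : ∀ c, S.rng (f c) = S.rng c) :
    NetStep (M.mapChan f) (l.mapChan f) (M'.mapChan f) := by
  induction h with
  | pos n I μ h => exact .pos n I μ (h.mapChan hr)
  | sensRead n μ k hs h => exact .sensRead n μ k hs (h.mapChan hr)
  | actUnChg n μ k ha h => exact .actUnChg n μ k ha (h.mapChan hr)
  | locCom n I μ k h => exact .locCom n I μ k (h.mapChan hr)
  | actChg n μ k ha h => exact .actChg n μ k ha (h.mapChan hr)
  | snd n I μ k h hc => exact .snd n I μ k (h.mapChan hr) ((hr _).symm ▸ hc)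
  | rcv n I μ k h hc => exact .rcv n I μ k (h.mapChan hr) ((hr _).symm ▸ hc)
  | glbComL _ _ hc ih₁ ih₂ => exact .glbComL ih₁ ih₂ (by unfold Sig.InRange at *; rwa [hr])
  | glbComR _ _ hc ih₁ ih₂ => exact .glbComR ih₁ ih₂ (by unfold Sig.InRange at *; rwa [hr])
  | parL _ _ ih => exact .parL _ ih
  | parR _ _ ih => exact .parR _ ih
  | res c _ hc ih =>
    refine .res' ih ?_
    rw [NLabel.chans_mapChan, hf.mem_set_image]
    exact NLabel.notMem_chans.1 hc

theorem NetEq.mapChan {M N : Net S} (h : NetEq M N) {f : S.Chan → S.Chan}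
    (hf : Function.Injective f) (hr : ∀ c, S.rng (f c) = S.rng c) :
    NetEq (M.mapChan f) (N.mapChan f) := by
  induction h with
  | refl => exact .refl _
  | symm _ ih => exact .symm ih
  | trans _ _ ih₁ ih₂ => exact .trans ih₁ ih₂
  | par _ _ ih₁ ih₂ => exact .par ih₁ ih₂
  | res c _ ih => exact .res _ ih
  | alpha c d M hcd hd =>
    have := NetEq.alpha (f c) (f d) (M.mapChan f) (by rw [hr, hr, hcd])
      (by rwa [Net.freeChans_mapChan hf, hf.mem_set_image])
    rw [Net.swapChan_eq, Net.mapChan_mapChan, ← comp_swapFun hf] at this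
    rwa [Net.mapChan, Net.mapChan, Net.swapChan_eq, Net.mapChan_mapChan]
  | node n I μ h e => exact .node n I μ h (e.mapChan f)
  | par_zero M => exact .par_zero _
  | par_comm M N => exact .par_comm _ _
  | par_assoc M N O => exact .par_assoc _ _ _
  | res_zero c => exact .res_zero _
  | res_comm c d M => exact .res_comm _ _ _
  | res_par c M N hc =>
    exact .res_par _ _ _ (by rwa [Net.freeChans_mapChan hf, hf.mem_set_image])

/-! ### Structural congruence and transitions -/

/-- `N` matches all instantaneous transitions of `M` up to structural congruence. -/
def NetSim (M N : Net S) : Prop :=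
  ∀ l M', NetStep M l M' → ∃ N', NetStep N l N' ∧ NetEq M' N'

theorem NetSim.trans {M N O : Net S} (h₁ : NetSim M N) (h₂ : NetSim N O) : NetSim M O := by
  intro l M' h
  obtain ⟨N', hN, e₁⟩ := h₁ l M' h
  obtain ⟨O', hO, e₂⟩ := h₂ l N' hN
  exact ⟨O', hO, e₁.trans e₂⟩

theorem NetSim.par_comm (M N : Net S) : NetSim (.par M N) (.par N M) := by
  intro l X h
  cases h with
  | glbComL h₁ h₂ hr => exact ⟨_, .glbComR h₂ h₁ hr, .par_comm _ _⟩
  | glbComR h₁ h₂ hr => exact ⟨_, .glbComL h₂ h₁ hr, .par_comm _ _⟩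
  | parL _ h => exact ⟨_, .parR _ h, .par_comm _ _⟩
  | parR _ h => exact ⟨_, .parL _ h, .par_comm _ _⟩

/-- The congruences `e₁` and `e₂` are needed for the component that stays idle. -/
theorem NetSim.par {M M' N N' : Net S} (h₁ : NetSim M M') (h₂ : NetSim N N') (e₁ : NetEq M M')
    (e₂ : NetEq N N') : NetSim (.par M N) (.par M' N') := by
  intro l X h
  cases h with
  | glbComL h h' hr =>
    obtain ⟨_, h, e⟩ := h₁ _ _ h; obtain ⟨_, h', e'⟩ := h₂ _ _ h'
    exact ⟨_, .glbComL h h' hr, .par e e'⟩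
  | glbComR h h' hr =>
    obtain ⟨_, h, e⟩ := h₁ _ _ h; obtain ⟨_, h', e'⟩ := h₂ _ _ h'
    exact ⟨_, .glbComR h h' hr, .par e e'⟩
  | parL _ h => obtain ⟨_, h, e⟩ := h₁ _ _ h; exact ⟨_, .parL _ h, .par e e₂⟩
  | parR _ h => obtain ⟨_, h, e⟩ := h₂ _ _ h; exact ⟨_, .parR _ h, .par e₁ e⟩

theorem NetSim.par_assoc (M N O : Net S) : NetSim (.par (.par M N) O) (.par M (.par N O)) := by
  intro l X h
  cases h with
  | glbComL h h' hr =>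
    cases h with
    | parL _ h => exact ⟨_, .glbComL h (.parR _ h') hr, .par_assoc _ _ _⟩
    | parR _ h => exact ⟨_, .parR _ (.glbComL h h' hr), .par_assoc _ _ _⟩
  | glbComR h h' hr =>
    cases h with
    | parL _ h => exact ⟨_, .glbComR h (.parR _ h') hr, .par_assoc _ _ _⟩
    | parR _ h => exact ⟨_, .parR _ (.glbComR h h' hr), .par_assoc _ _ _⟩
  | parR _ h => exact ⟨_, .parR _ (.parR _ h), .par_assoc _ _ _⟩
  | parL _ h =>
    cases h with
    | glbComL h h' hr => exact ⟨_, .glbComL h (.parL _ h') hr, .par_assoc _ _ _⟩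
    | glbComR h h' hr => exact ⟨_, .glbComR h (.parL _ h') hr, .par_assoc _ _ _⟩
    | parL _ h => exact ⟨_, .parL _ h, .par_assoc _ _ _⟩
    | parR _ h => exact ⟨_, .parR _ (.parL _ h), .par_assoc _ _ _⟩

theorem NetSim.node {P Q : Proc S} (n : S.Node) (I : Interface S) (μ : Mobility) (k : S.Loc)
    (e : ProcEq P Q) : NetSim (.node n I P μ k) (.node n I Q μ k) := by
  intro l X h
  cases h with
  | pos _ _ _ h => obtain ⟨_, h, e⟩ := h.procEq e; exact ⟨_, .pos _ _ _ h, .node _ _ _ _ e⟩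
  | sensRead _ _ _ hs h =>
    obtain ⟨_, h, e⟩ := h.procEq e; exact ⟨_, .sensRead _ _ _ hs h, .node _ _ _ _ e⟩
  | actUnChg _ _ _ hs h =>
    obtain ⟨_, h, e⟩ := h.procEq e; exact ⟨_, .actUnChg _ _ _ hs h, .node _ _ _ _ e⟩
  | locCom _ _ _ _ h =>
    obtain ⟨_, h, e⟩ := h.procEq e; exact ⟨_, .locCom _ _ _ _ h, .node _ _ _ _ e⟩
  | actChg _ _ _ hs h =>
    obtain ⟨_, h, e⟩ := h.procEq e; exact ⟨_, .actChg _ _ _ hs h, .node _ _ _ _ e⟩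
  | snd _ _ _ _ h hc =>
    obtain ⟨_, h, e⟩ := h.procEq e; exact ⟨_, .snd _ _ _ _ h hc, .node _ _ _ _ e⟩
  | rcv _ _ _ _ h hc =>
    obtain ⟨_, h, e⟩ := h.procEq e; exact ⟨_, .rcv _ _ _ _ h hc, .node _ _ _ _ e⟩

theorem NetSim.res {M N : Net S} (c : S.Chan) (h : NetSim M N) :
    NetSim (.res c M) (.res c N) := by
  intro l X hX
  cases hX with
  | res _ hM hc => obtain ⟨_, hN, e⟩ := h _ _ hM; exact ⟨_, .res _ hN hc, .res _ e⟩

theorem NetSim.alpha (c d : S.Chan) (M : Net S) (hcd : S.rng d = S.rng c) (hd : d ∉ M.freeChans) :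
    NetSim (.res c M) (.res d (M.swapChan c d)) := by
  intro l X hX
  cases hX with
  | res _ hM hc =>
    rw [NLabel.notMem_chans] at hc
    have hM' := hM.mapChan (swapFun_injective c d) (rng_swapFun hcd)
    -- The channel of the label is neither `c`, which is restricted, nor `d`, which is not free in
    -- `M`, so the transposition fixes the label.
    rw [NLabel.mapChan_eq_self fun x hx => swapFun_of_ne (ne_of_mem_of_not_mem hx hc)
      (ne_of_mem_of_not_mem (hM.label_chans hx) hd)] at hM'
    exact ⟨_, .res' hM' fun h => hd (hM.label_chans h),
      .alpha c d _ hcd fun h => hd (hM.freeChans_subset h)⟩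

theorem NetSim.par_zero (M : Net S) : NetSim (.par M .zero) M := by
  intro l X h
  cases h with
  | glbComL _ h _ => cases h
  | glbComR _ h _ => cases h
  | parR _ h => cases h
  | parL _ h => exact ⟨_, h, .par_zero _⟩

theorem NetSim.res_comm (c d : S.Chan) (M : Net S) :
    NetSim (.res c (.res d M)) (.res d (.res c M)) := by
  intro l X h
  cases h with
  | res _ h hc => cases h with
    | res _ h hd => exact ⟨_, .res _ (.res _ h hc) hd, .res_comm _ _ _⟩

theorem NetSim.res_par (c : S.Chan) (M N : Net S) (hc : c ∉ M.freeChans) :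
    NetSim (.res c (.par M N)) (.par M (.res c N)) := by
  intro l X h
  cases h with
  | res _ h hl =>
    rw [NLabel.notMem_chans] at hl
    cases h with
    | glbComL h h' hr =>
      exact ⟨_, .glbComL h (.res' h' fun hx => hc (h.label_chans hx)) hr,
        .res_par _ _ _ fun hx => hc (h.freeChans_subset hx)⟩
    | glbComR h h' hr =>
      exact ⟨_, .glbComR h (.res' h' fun hx => hc (h.label_chans hx)) hr,
        .res_par _ _ _ fun hx => hc (h.freeChans_subset hx)⟩
    | parL _ h => exact ⟨_, .parL _ h, .res_par _ _ _ fun hx => hc (h.freeChans_subset hx)⟩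
    | parR _ h => exact ⟨_, .parR _ (.res' h hl), .res_par _ _ _ hc⟩

theorem NetSim.par_res (c : S.Chan) (M N : Net S) (hc : c ∉ M.freeChans) :
    NetSim (.par M (.res c N)) (.res c (.par M N)) := by
  intro l X h
  cases h with
  | glbComL h h' hr => cases h' with
    | res _ h' _ =>
      exact ⟨_, .res' (.glbComL h h' hr) id, .symm (.res_par _ _ _ fun hx => hc (h.freeChans_subset hx))⟩
  | glbComR h h' hr => cases h' with
    | res _ h' _ =>
      exact ⟨_, .res' (.glbComR h h' hr) id, .symm (.res_par _ _ _ fun hx => hc (h.freeChans_subset hx))⟩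
  | parL _ h =>
    exact ⟨_, .res' (.parL _ h) fun hx => hc (h.label_chans hx),
      .symm (.res_par _ _ _ fun hx => hc (h.freeChans_subset hx))⟩
  | parR _ h => cases h with
    | res _ h hl => exact ⟨_, .res _ (.parR _ h) hl, .symm (.res_par _ _ _ hc)⟩

/-- Both directions are proved together so that the symmetry rule is immediate in the induction. -/
theorem NetEq.netSim {M N : Net S} (h : NetEq M N) : NetSim M N ∧ NetSim N M := by
  induction h with
  | refl M => exact ⟨fun l M' h => ⟨M', h, .refl _⟩, fun l M' h => ⟨M', h, .refl _⟩⟩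
  | symm _ ih => exact ih.symm
  | trans _ _ ih₁ ih₂ => exact ⟨ih₁.1.trans ih₂.1, ih₂.2.trans ih₁.2⟩
  | par e₁ e₂ ih₁ ih₂ =>
    exact ⟨.par ih₁.1 ih₂.1 e₁ e₂, .par ih₁.2 ih₂.2 e₁.symm e₂.symm⟩
  | res c _ ih => exact ⟨ih.1.res c, ih.2.res c⟩
  | alpha c d M hcd hd =>
    refine ⟨.alpha c d M hcd hd, ?_⟩
    have := NetSim.alpha d c (M.swapChan c d) hcd.symm (Net.notMem_freeChans_swapChan hd)
    rwa [Net.swapChan_comm d c, Net.swapChan_swapChan] at this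
  | node n I μ h e => exact ⟨.node n I μ h e, .node n I μ h e.symm⟩
  | par_zero M => exact ⟨.par_zero M, fun l M' h => ⟨_, .parL _ h, .symm (.par_zero _)⟩⟩
  | par_comm M N => exact ⟨.par_comm M N, .par_comm N M⟩
  | par_assoc M N O =>
    -- The other direction of associativity is obtained by rotating with commutativity: `M(NO)`,
    -- `(NO)M`, `N(OM)`, `(OM)N`, `O(MN)`, `(MN)O`.
    exact ⟨.par_assoc M N O, (NetSim.par_comm _ _).trans <| (NetSim.par_assoc N O M).trans <|
      (NetSim.par_comm _ _).trans <| (NetSim.par_assoc O M N).trans (.par_comm _ _)⟩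
  | res_zero c =>
    refine ⟨fun l M' h => ?_, fun l M' h => by cases h⟩
    cases h with
    | res _ h _ => cases h
  | res_comm c d M => exact ⟨.res_comm c d M, .res_comm d c M⟩
  | res_par c M N hc => exact ⟨.res_par c M N hc, .par_res c M N hc⟩

theorem NetStep.netEq {M N M' : Net S} {l : NLabel S} (h : NetStep M l M') (e : NetEq M N) :
    ∃ N', NetStep N l N' ∧ NetEq M' N' := e.netSim.1 l M' h

/-! ### Passage of time -/

/-- Passage of time without the condition of maximal progress. -/
inductive TimeStep : Net S → Net S → Prop
  | stat {P P'} (n I h) : PStep P none P' → TimeStep (.node n I P .stat h) (.node n I P' .stat h)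
  | mob {P P' h k} (n I) : PStep P none P' → S.dist h k ≤ S.δ →
      TimeStep (.node n I P .mob h) (.node n I P' .mob k)
  | par {M M' N N'} : TimeStep M M' → TimeStep N N' → TimeStep (.par M N) (.par M' N')
  | zero : TimeStep .zero .zero
  | res {M M'} (c) : TimeStep M M' → TimeStep (.res c M) (.res c M')

/-- Maximal progress of the whole network implies it for every part, so it can be checked once at
the top. This leaves the positive relation `TimeStep`, for which compatibility with `≡` is a plain
induction. -/
theorem netTime_iff {M M' : Net S} :
    NetTime M M' ↔ TimeStep M M' ∧ ¬ ∃ O, NetStep M .tau O := by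
  constructor
  · intro h
    induction h with
    | timeStat n I h hP hn => exact ⟨.stat n I h (procTime_iff.1 hP).1, hn⟩
    | timeMob n I hP hn hd => exact ⟨.mob n I (procTime_iff.1 hP).1 hd, hn⟩
    | timePar _ _ hn ih₁ ih₂ => exact ⟨.par ih₁.1 ih₂.1, hn⟩
    | timeZero => exact ⟨.zero, fun ⟨_, h⟩ => by cases h⟩
    | res c _ ih => exact ⟨.res c ih.1, fun ⟨_, h⟩ => by cases h with | res _ h _ => exact ih.2 ⟨_, h⟩⟩
  · rintro ⟨h, hn⟩
    induction h with
    | stat n I k hP =>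
      exact .timeStat n I k (procTime_iff.2 ⟨hP, fun ⟨_, h⟩ => hn ⟨_, .locCom _ _ _ _ h⟩⟩) hn
    | mob n I hP hd =>
      exact .timeMob n I (procTime_iff.2 ⟨hP, fun ⟨_, h⟩ => hn ⟨_, .locCom _ _ _ _ h⟩⟩) hn hd
    | par _ _ ih₁ ih₂ =>
      exact .timePar (ih₁ fun ⟨_, h⟩ => hn ⟨_, .parL _ h⟩) (ih₂ fun ⟨_, h⟩ => hn ⟨_, .parR _ h⟩) hn
    | zero => exact .timeZero
    | res c _ ih => exact .res c (ih fun ⟨_, h⟩ => hn ⟨_, .res' h id⟩)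

theorem TimeStep.freeChans_subset {M M' : Net S} (h : TimeStep M M') :
    M'.freeChans ⊆ M.freeChans := by
  induction h with
  | stat n I k h | mob n I h _ => exact h.elim fun _ h => h.chans_subset
  | par _ _ ih₁ ih₂ => exact Set.union_subset_union ih₁ ih₂
  | zero => exact le_rfl
  | res c _ ih => exact Set.sdiff_subset_sdiff_left ih

theorem TimeStep.mapChan {M M' : Net S} (h : TimeStep M M') {f : S.Chan → S.Chan}
    (hr : ∀ c, S.rng (f c) = S.rng c) : TimeStep (M.mapChan f) (M'.mapChan f) := by
  induction h with
  | stat n I k h => exact .stat n I k (h.mapChan hr)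
  | mob n I h hd => exact .mob n I (h.mapChan hr) hd
  | par _ _ ih₁ ih₂ => exact .par ih₁ ih₂
  | zero => exact .zero
  | res c _ ih => exact .res _ ih

theorem TimeStep.alpha {c d : S.Chan} {M X : Net S} (hcd : S.rng d = S.rng c)
    (hd : d ∉ M.freeChans) (h : TimeStep (.res c M) X) :
    ∃ Y, TimeStep (.res d (M.swapChan c d)) Y ∧ NetEq X Y := by
  cases h with
  | res _ h =>
    exact ⟨_, .res _ (h.mapChan (rng_swapFun hcd)),
      .alpha c d _ hcd fun hx => hd (h.freeChans_subset hx)⟩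

theorem TimeStep.node {P Q : Proc S} {n : S.Node} {I : Interface S} {μ : Mobility} {k : S.Loc}
    {X : Net S} (e : ProcEq P Q) (h : TimeStep (.node n I P μ k) X) :
    ∃ Y, TimeStep (.node n I Q μ k) Y ∧ NetEq X Y := by
  cases h with
  | stat _ _ _ h => obtain ⟨_, h, e⟩ := h.procEq e; exact ⟨_, .stat _ _ _ h, .node _ _ _ _ e⟩
  | mob _ _ h hd => obtain ⟨_, h, e⟩ := h.procEq e; exact ⟨_, .mob _ _ h hd, .node _ _ _ _ e⟩

theorem NetEq.timeStep {M N : Net S} (e : NetEq M N) :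
    (∀ X, TimeStep M X → ∃ Y, TimeStep N Y ∧ NetEq X Y) ∧
      ∀ X, TimeStep N X → ∃ Y, TimeStep M Y ∧ NetEq X Y := by
  induction e with
  | refl M => exact ⟨fun X h => ⟨X, h, .refl _⟩, fun X h => ⟨X, h, .refl _⟩⟩
  | symm _ ih => exact ih.symm
  | trans _ _ ih₁ ih₂ =>
    constructor
    · intro X h
      obtain ⟨Y, h, e⟩ := ih₁.1 X h
      obtain ⟨Z, h, e'⟩ := ih₂.1 Y h
      exact ⟨Z, h, e.trans e'⟩
    · intro X h
      obtain ⟨Y, h, e⟩ := ih₂.2 X h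
      obtain ⟨Z, h, e'⟩ := ih₁.2 Y h
      exact ⟨Z, h, e.trans e'⟩
  | par _ _ ih₁ ih₂ =>
    constructor
    · intro X h
      cases h with
      | par h h' =>
        obtain ⟨_, h, e⟩ := ih₁.1 _ h; obtain ⟨_, h', e'⟩ := ih₂.1 _ h'
        exact ⟨_, .par h h', .par e e'⟩
    · intro X h
      cases h with
      | par h h' =>
        obtain ⟨_, h, e⟩ := ih₁.2 _ h; obtain ⟨_, h', e'⟩ := ih₂.2 _ h'
        exact ⟨_, .par h h', .par e e'⟩
  | res c _ ih =>
    constructor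
    · intro X h
      cases h with
      | res _ h => obtain ⟨_, h, e⟩ := ih.1 _ h; exact ⟨_, .res _ h, .res _ e⟩
    · intro X h
      cases h with
      | res _ h => obtain ⟨_, h, e⟩ := ih.2 _ h; exact ⟨_, .res _ h, .res _ e⟩
  | alpha c d M hcd hd =>
    refine ⟨fun X h => h.alpha hcd hd, fun X h => ?_⟩
    have := h.alpha hcd.symm (Net.notMem_freeChans_swapChan hd)
    rwa [Net.swapChan_comm d c, Net.swapChan_swapChan] at this
  | node n I μ h e => exact ⟨fun X h => h.node e, fun X h => h.node e.symm⟩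
  | par_zero M =>
    constructor
    · intro X h
      cases h with
      | par h h' => cases h'; exact ⟨_, h, .par_zero _⟩
    · intro X h
      exact ⟨_, .par h .zero, .symm (.par_zero _)⟩
  | par_comm M N =>
    constructor
    · intro X h
      cases h with
      | par h h' => exact ⟨_, .par h' h, .par_comm _ _⟩
    · intro X h
      cases h with
      | par h h' => exact ⟨_, .par h' h, .par_comm _ _⟩
  | par_assoc M N O =>
    constructor
    · intro X h
      cases h with
      | par h h₃ => cases h with
        | par h₁ h₂ => exact ⟨_, .par h₁ (.par h₂ h₃), .par_assoc _ _ _⟩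
    · intro X h
      cases h with
      | par h₁ h => cases h with
        | par h₂ h₃ => exact ⟨_, .par (.par h₁ h₂) h₃, .symm (.par_assoc _ _ _)⟩
  | res_zero c =>
    constructor
    · intro X h
      cases h with
      | res _ h => cases h; exact ⟨_, .zero, .res_zero _⟩
    · intro X h
      cases h
      exact ⟨_, .res _ .zero, .symm (.res_zero _)⟩
  | res_comm c d M =>
    constructor
    · intro X h
      cases h with
      | res _ h => cases h with
        | res _ h => exact ⟨_, .res _ (.res _ h), .res_comm _ _ _⟩
    · intro X h
      cases h with
      | res _ h => cases h with
        | res _ h => exact ⟨_, .res _ (.res _ h), .res_comm _ _ _⟩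
  | res_par c M N hc =>
    constructor
    · intro X h
      cases h with
      | res _ h => cases h with
        | par h h' =>
          exact ⟨_, .par h (.res _ h'), .res_par _ _ _ fun hx => hc (h.freeChans_subset hx)⟩
    · intro X h
      cases h with
      | par h h' => cases h' with
        | res _ h' =>
          exact ⟨_, .res _ (.par h h'), .symm (.res_par _ _ _ fun hx => hc (h.freeChans_subset hx))⟩

theorem NetTime.netEq {M N M' : Net S} (h : NetTime M M') (e : NetEq M N) :
    ∃ N', NetTime N N' ∧ NetEq M' N' := by
  rw [netTime_iff] at h
  obtain ⟨N', hN, e'⟩ := e.timeStep.1 _ h.1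
  refine ⟨N', netTime_iff.2 ⟨hN, fun ⟨O, hO⟩ => h.2 ?_⟩, e'⟩
  -- The negative premise is transported in the opposite direction: a `τ`-step of `N` would give one
  -- of `M`.
  obtain ⟨O', hO', _⟩ := hO.netEq e.symm
  exact ⟨O', hO'⟩

end NetworkTransitions

/-! ### Node lists as invariants of structural congruence -/

section NodeLists

variable {S : Sig.{u}}

/-- The two nodes differ at most by structural congruence of their processes. -/
structure NodeData.Equiv (x y : NodeData S) : Prop where
  name : x.name = y.name
  iface : x.iface = y.iface
  mob : x.mob = y.mob
  loc : x.loc = y.loc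
  proc : ProcEq x.proc y.proc

theorem NodeData.Equiv.refl (x : NodeData S) : x.Equiv x := ⟨rfl, rfl, rfl, rfl, .refl _⟩

theorem NodeData.Equiv.symm {x y : NodeData S} (h : x.Equiv y) : y.Equiv x :=
  ⟨h.1.symm, h.2.symm, h.3.symm, h.4.symm, h.5.symm⟩

/-- Equality of lists of nodes up to permutations and structural congruence of processes. -/
inductive NodesEq : List (NodeData S) → List (NodeData S) → Prop
  | nil : NodesEq [] []
  | cons {x y L L'} : x.Equiv y → NodesEq L L' → NodesEq (x :: L) (y :: L')
  | swap (x y L) : NodesEq (x :: y :: L) (y :: x :: L)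
  | trans {L₁ L₂ L₃} : NodesEq L₁ L₂ → NodesEq L₂ L₃ → NodesEq L₁ L₃

namespace NodesEq

variable {L L' L₁ L₂ : List (NodeData S)}

theorem of_perm (h : L.Perm L') : NodesEq L L' := by
  induction h with
  | nil => exact .nil
  | cons x _ ih => exact .cons (.refl x) ih
  | swap x y L => exact .swap y x L
  | trans _ _ ih₁ ih₂ => exact ih₁.trans ih₂

theorem refl (L : List (NodeData S)) : NodesEq L L := of_perm (.refl L)

theorem symm (h : NodesEq L L') : NodesEq L' L := by
  induction h with
  | nil => exact .nil
  | cons h _ ih => exact .cons h.symm ih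
  | swap x y L => exact .swap y x L
  | trans _ _ ih₁ ih₂ => exact ih₂.trans ih₁

theorem append (h : NodesEq L L') (h' : NodesEq L₁ L₂) : NodesEq (L ++ L₁) (L' ++ L₂) := by
  have left : NodesEq (L ++ L₁) (L' ++ L₁) := by
    induction h with
    | nil => exact .refl _
    | cons h _ ih => exact .cons h ih
    | swap x y L => exact .swap x y _
    | trans _ _ ih₁ ih₂ => exact ih₁.trans ih₂
  refine left.trans ?_
  clear left h
  induction L' with
  | nil => exact h'
  | cons x L' ih => exact .cons (.refl x) ih

theorem map {f : NodeData S → NodeData S} (hf : ∀ x y, x.Equiv y → (f x).Equiv (f y))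
    (h : NodesEq L L') : NodesEq (L.map f) (L'.map f) := by
  induction h with
  | nil => exact .nil
  | cons h _ ih => exact .cons (hf _ _ h) ih
  | swap x y L => exact .swap _ _ _
  | trans _ _ ih₁ ih₂ => exact ih₁.trans ih₂

end NodesEq

/-- The data of a node apart from its process. -/
def NodeData.frame (x : NodeData S) : S.Node × Interface S × Mobility × S.Loc :=
  (x.name, x.iface, x.mob, x.loc)

theorem NodesEq.perm_frame {L L' : List (NodeData S)} (h : NodesEq L L') :
    (L.map NodeData.frame).Perm (L'.map NodeData.frame) := by
  induction h with
  | nil => exact .nil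
  | @cons x y _ _ h _ ih =>
    have : x.frame = y.frame := by simp only [NodeData.frame, h.name, h.iface, h.mob, h.loc]
    simpa only [List.map_cons, this] using ih.cons _
  | swap x y L => exact .swap _ _ _
  | trans _ _ ih₁ ih₂ => exact ih₁.trans ih₂

/-- The network with a single node. -/
def NodeData.net (x : NodeData S) : Net S := .node x.name x.iface x.proc x.mob x.loc

theorem NodeData.Equiv.netEq {x y : NodeData S} (h : x.Equiv y) : NetEq x.net y.net := by
  obtain ⟨n, I, P, μ, k⟩ := x
  obtain ⟨n', I', P', μ', k'⟩ := y
  obtain ⟨h₁, h₂, h₃, h₄, h₅⟩ := h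
  simp only at h₁ h₂ h₃ h₄ h₅
  subst h₁ h₂ h₃ h₄
  exact .node _ _ _ _ h₅

theorem NetEq.zero_par (M : Net S) : NetEq (.par .zero M) M := .trans (.par_comm _ _) (.par_zero _)

theorem NetEq.par_left_comm (M N O : Net S) : NetEq (.par M (.par N O)) (.par N (.par M O)) :=
  .trans (.symm (.par_assoc _ _ _)) (.trans (.par (.par_comm _ _) (.refl _)) (.par_assoc _ _ _))

theorem NodesEq.netEq {L L' : List (NodeData S)} (h : NodesEq L L') :
    NetEq (Net.prod (L.map NodeData.net)) (Net.prod (L'.map NodeData.net)) := by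
  induction h with
  | nil => exact .refl _
  | cons h _ ih => exact .par h.netEq ih
  | swap x y L => exact .par_left_comm _ _ _
  | trans _ _ ih₁ ih₂ => exact ih₁.trans ih₂

theorem Net.prod_append (L L' : List (Net S)) :
    NetEq (Net.prod (L ++ L')) (.par (Net.prod L) (Net.prod L')) := by
  induction L with
  | nil => exact .symm (.zero_par _)
  | cons M L ih => exact .trans (.par (.refl _) ih) (.symm (.par_assoc _ _ _))

/-! ### The nodes of a network without restrictions -/

/-- No restriction occurs in the network. -/
def Net.ResFree : Net S → Prop
  | .zero => True
  | .node .. => True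
  | .par M N => M.ResFree ∧ N.ResFree
  | .res _ _ => False

theorem Net.ResFree.netEq_prod {M : Net S} (h : M.ResFree) :
    NetEq M (Net.prod (M.nodes.map NodeData.net)) := by
  induction M with
  | zero => exact .refl _
  | node n I P μ k => exact .symm (.par_zero _)
  | par M N ih₁ ih₂ =>
    rw [Net.nodes, List.map_append]
    exact .trans (.par (ih₁ h.1) (ih₂ h.2)) (.symm (Net.prod_append _ _))
  | res c M => exact h.elim

theorem NetStep.resFree {M M' : Net S} {l : NLabel S} (h : NetStep M l M') (hM : M.ResFree) :
    M'.ResFree := by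
  induction h with
  | glbComL _ _ _ ih₁ ih₂ | glbComR _ _ _ ih₁ ih₂ => exact ⟨ih₁ hM.1, ih₂ hM.2⟩
  | parL _ _ ih => exact ⟨ih hM.1, hM.2⟩
  | parR _ _ ih => exact ⟨hM.1, ih hM.2⟩
  | res => exact hM.elim
  | _ => trivial

/-- An arbitrary channel. -/
noncomputable def someChan (c : S.Chan) : S.Chan := Classical.choice ⟨c⟩

open Classical in
/-- The nodes of a network, with the channels renamed according to `f` and all restricted channels
replaced by a fixed one. -/
noncomputable def Net.flat : (S.Chan → S.Chan) → Net S → List (NodeData S)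
  | _, .zero => []
  | f, .node n I P μ h => [⟨n, I, P.mapChan f, μ, h⟩]
  | f, .par M N => Net.flat f M ++ Net.flat f N
  | f, .res c M => Net.flat (Function.update f c (someChan c)) M

theorem Net.flat_congr {M : Net S} : ∀ {f g : S.Chan → S.Chan}, (∀ c ∈ M.freeChans, f c = g c) →
    M.flat f = M.flat g := by
  induction M with
  | zero => intros; rfl
  | node n I P μ k => intro f g h; simp only [Net.flat, Proc.mapChan_congr h]
  | par M N ih₁ ih₂ =>
    intro f g h
    simp only [Net.flat, ih₁ fun c hc => h c (.inl hc), ih₂ fun c hc => h c (.inr hc)]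
  | res c M ih =>
    intro f g h
    classical
    refine ih fun d hd => ?_
    by_cases hdc : d = c
    · subst hdc; simp
    · simp only [Function.update_of_ne hdc]; exact h d ⟨hd, hdc⟩

theorem Net.flat_mapChan {g : S.Chan → S.Chan} (hg : Function.Injective g) (M : Net S) :
    ∀ f, (M.mapChan g).flat f = M.flat (f ∘ g) := by
  induction M with
  | zero => intros; rfl
  | node n I P μ k => intro f; simp only [Net.flat, Net.mapChan, Proc.mapChan_mapChan]
  | par M N ih₁ ih₂ => intro f; simp only [Net.flat, Net.mapChan, ih₁, ih₂]
  | res c M ih =>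
    intro f
    classical
    simp only [Net.flat, Net.mapChan, ih]
    rw [Function.update_comp_eq_of_injective _ hg]
    rfl

/-- Forgetting which restricted channel is which makes alpha-conversion and all other laws of
restriction invisible. What remains is permutation of nodes and structural congruence inside them.
Free channels are kept apart by `f`. -/
theorem NetEq.nodesEq_flat {M N : Net S} (h : NetEq M N) : ∀ f, NodesEq (M.flat f) (N.flat f) := by
  classical
  induction h with
  | refl M => intro f; exact .refl _
  | symm _ ih => intro f; exact (ih f).symm
  | trans _ _ ih₁ ih₂ => intro f; exact (ih₁ f).trans (ih₂ f)
  | par _ _ ih₁ ih₂ => intro f; exact (ih₁ f).append (ih₂ f)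
  | res c _ ih => intro f; exact ih _
  | alpha c d M hcd hd =>
    intro f
    simp only [Net.flat, Net.swapChan_eq, Net.flat_mapChan (swapFun_injective c d)]
    rw [Net.flat_congr]
    · exact .refl _
    · intro x hx
      have hxd : x ≠ d := ne_of_mem_of_not_mem hx hd
      by_cases hxc : x = c
      · subst hxc
        simp only [Function.comp, swapFun_left, Function.update_self]
        -- The two chosen channels are equal by proof irrelevance: `someChan` uses its argument only
        -- as a proof that channels exist.
        rfl
      · simp [Function.comp, swapFun_of_ne hxc hxd, hxc, hxd]
  | node n I μ k e => intro f; exact .cons ⟨rfl, rfl, rfl, rfl, e.mapChan f⟩ .nil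
  | par_zero M => intro f; simp only [Net.flat, List.append_nil]; exact .refl _
  | par_comm M N => intro f; exact .of_perm List.perm_append_comm
  | par_assoc M N O => intro f; simp only [Net.flat, List.append_assoc]; exact .refl _
  | res_zero c => intro f; exact .nil
  | res_comm c d M =>
    intro f
    simp only [Net.flat]
    by_cases hcd : c = d
    · subst hcd; exact .refl _
    · rw [Function.update_comm hcd]; exact .refl _
  | res_par c M N hc =>
    intro f
    simp only [Net.flat]
    rw [Net.flat_congr (M := M) (g := f) fun x hx =>
      Function.update_of_ne (ne_of_mem_of_not_mem hx hc) _ _]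
    exact .refl _

theorem Net.map_frame_flat (M : Net S) : ∀ f,
    (M.flat f).map NodeData.frame = M.nodes.map NodeData.frame := by
  induction M with
  | zero => intros; rfl
  | node n I P μ k => intros; rfl
  | par M N ih₁ ih₂ => intro f; simp only [Net.flat, Net.nodes, List.map_append, ih₁, ih₂]
  | res c M ih => intro f; exact ih _

/-- Flattening alters only processes, so names, interfaces, mobility tags and locations are
invariants of structural congruence, up to the order of the nodes. -/
theorem NetEq.perm_frame {M N : Net S} (h : NetEq M N) :
    (M.nodes.map NodeData.frame).Perm (N.nodes.map NodeData.frame) := by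
  have := (h.nodesEq_flat id).perm_frame
  rwa [Net.map_frame_flat, Net.map_frame_flat] at this

theorem Net.ResFree.flat_id {M : Net S} (h : M.ResFree) : M.flat id = M.nodes := by
  induction M with
  | zero => rfl
  | node n I P μ k => simp only [Net.flat, Net.nodes, Proc.mapChan_id]
  | par M N ih₁ ih₂ => simp only [Net.flat, Net.nodes, ih₁ h.1, ih₂ h.2]
  | res c M => exact h.elim

/-- Put the process `q n` in parallel with the process of each node `n`. -/
def Net.addProc (q : S.Node → Proc S) : Net S → Net S
  | .zero => .zero
  | .node n I P μ h => .node n I (.par P (q n)) μ h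
  | .par M N => .par (M.addProc q) (N.addProc q)
  | .res c M => .res c (M.addProc q)

theorem NetStep.addProc {M M' : Net S} {l : NLabel S} (h : NetStep M l M') (q : S.Node → Proc S) :
    NetStep (M.addProc q) l (M'.addProc q) := by
  induction h with
  | pos n I μ h => exact .pos n I μ (h.parL _)
  | sensRead n μ k hs h => exact .sensRead n μ k hs (h.parL _)
  | actUnChg n μ k ha h => exact .actUnChg n μ k ha (h.parL _)
  | locCom n I μ k h => exact .locCom n I μ k (h.parL _)
  | actChg n μ k ha h => exact .actChg n μ k ha (h.parL _)
  | snd n I μ k h hc => exact .snd n I μ k (h.parL _) hc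
  | rcv n I μ k h hc => exact .rcv n I μ k (h.parL _) hc
  | glbComL _ _ hc ih₁ ih₂ => exact .glbComL ih₁ ih₂ hc
  | glbComR _ _ hc ih₁ ih₂ => exact .glbComR ih₁ ih₂ hc
  | parL _ _ ih => exact .parL _ ih
  | parR _ _ ih => exact .parR _ ih
  | res c _ hc ih => exact .res c ih hc

theorem Net.ResFree.addProc {M : Net S} (h : M.ResFree) (q : S.Node → Proc S) :
    (M.addProc q).ResFree := by
  induction M with
  | zero | node => trivial
  | par M N ih₁ ih₂ => exact ⟨ih₁ h.1, ih₂ h.2⟩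
  | res c M => exact h.elim

theorem Net.nodes_addProc (q : S.Node → Proc S) (M : Net S) :
    (M.addProc q).nodes = M.nodes.map fun x => { x with proc := .par x.proc (q x.name) } := by
  induction M with
  | zero | node => rfl
  | par M N ih₁ ih₂ => simp only [Net.addProc, Net.nodes, ih₁, ih₂, List.map_append]
  | res c M ih => exact ih

/-- Needed for the rule `parp`. An induction on `h` would fail, since its intermediate networks may
have restrictions that capture channels of `q`. Both ends being free of restrictions, their node
lists can be compared instead, and these are insensitive to the derivation. -/
theorem NetEq.addProc {M N : Net S} (h : NetEq M N) (hM : M.ResFree) (hN : N.ResFree)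
    (q : S.Node → Proc S) : NetEq (M.addProc q) (N.addProc q) := by
  have h' := h.nodesEq_flat id
  rw [hM.flat_id, hN.flat_id] at h'
  refine .trans (hM.addProc q).netEq_prod (.trans ?_ (hN.addProc q).netEq_prod.symm)
  rw [Net.nodes_addProc, Net.nodes_addProc]
  refine (h'.map ?_).netEq
  intro x y e
  refine ⟨e.name, e.iface, e.mob, e.loc, ?_⟩
  simp only [e.name]
  exact .par e.proc (.refl _)

end NodeLists

/-! ### Instantaneous reductions are transitions up to structural congruence -/

section ReductionToTransition

variable {S : Sig.{u}}

theorem Sig.InRange.symm {c : S.Chan} {h k : S.Loc} (hr : S.InRange c h k) : S.InRange c k h := by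
  unfold Sig.InRange at *
  rwa [S.dist_comm]

theorem Sig.InRange.nonneg {c : S.Chan} {h k : S.Loc} (hr : S.InRange c h k) : 0 ≤ S.rng c :=
  le_trans (WithBot.coe_le_coe.2 zero_le) hr

/-- The label of a transition corresponding to the label of a reduction. -/
def RLabel.toNLabel : RLabel S → NLabel S
  | .tau => .tau
  | .act a => .act a

theorem RLabel.chans_toNLabel (ω : RLabel S) : ω.toNLabel.chans = ∅ := by cases ω <;> rfl

/-- The names of the nodes of a network. -/
def Net.names (M : Net S) : List S.Node := M.nodes.map NodeData.name

theorem Net.names_eq_map_frame (M : Net S) :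
    M.names = (M.nodes.map NodeData.frame).map Prod.fst := by
  rw [List.map_map]; rfl

theorem NetEq.perm_names {M N : Net S} (h : NetEq M N) : M.names.Perm N.names := by
  rw [Net.names_eq_map_frame, Net.names_eq_map_frame]
  exact h.perm_frame.map _

theorem Net.resFree_prod {L : List (Net S)} (h : ∀ M ∈ L, M.ResFree) : (Net.prod L).ResFree := by
  induction L with
  | nil => trivial
  | cons M L ih =>
    exact ⟨h M List.mem_cons_self, ih fun N hN => h N (List.mem_cons_of_mem _ hN)⟩

theorem Net.names_prod_node (L : List ℕ) (n : ℕ → S.Node) (I : ℕ → Interface S) (P : ℕ → Proc S)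
    (μ : ℕ → Mobility) (h : ℕ → S.Loc) :
    (Net.prod (L.map fun i => .node (n i) (I i) (P i) (μ i) (h i))).names = L.map n := by
  induction L with
  | nil => rfl
  | cons i L ih => exact congrArg (n i :: ·) ih

theorem Net.addProc_prod_node (q : S.Node → Proc S) (L : List ℕ) (n : ℕ → S.Node)
    (I : ℕ → Interface S) (P : ℕ → Proc S) (μ : ℕ → Mobility) (h : ℕ → S.Loc) :
    (Net.prod (L.map fun i => .node (n i) (I i) (P i) (μ i) (h i))).addProc q =
      Net.prod (L.map fun i => .node (n i) (I i) (.par (P i) (q (n i))) (μ i) (h i)) := by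
  induction L with
  | nil => rfl
  | cons i L ih => exact congrArg (Net.par _) ih

/-- In a network in which the names of nodes are pairwise distinct, instantaneous reductions are
transitions up to structural congruence. -/
theorem Red.netStep {ω : RLabel S} {M M' : Net S} (h : Red ω M M') (hM : M.names.Nodup) :
    ∃ M'', NetStep M ω.toNLabel M'' ∧ NetEq M'' M' := by
  induction h with
  | pos n I P μ h => exact ⟨_, .pos n I μ (.posP h P), .refl _⟩
  | sensread n P μ h hs => exact ⟨_, .sensRead n μ h hs (.sensor _ _ P), .refl _⟩
  | actunchg n P μ h ha => exact ⟨_, .actUnChg n μ h ha (.actuator _ _ P), .refl _⟩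
  | actchg n P μ h ha => exact ⟨_, .actChg n μ h ha (.actuator _ _ P), .refl _⟩
  | loccom n I μ h v P R Q T hc =>
    exact ⟨_, .locCom n I μ h (.comL (.sndP ..) (.rcvP ..) hc), .refl _⟩
  | glbcom n m I J μ₁ μ₂ v P R Q T hr =>
    exact ⟨_, .glbComL (.snd n I μ₁ _ (.sndP ..) hr.nonneg) (.rcv m J μ₂ _ (.rcvP ..) hr.nonneg)
      hr.symm, .refl _⟩
  | parp r n I I' P P' Q μ μ' h h' _ ih =>
    rw [Net.names_prod_node] at hM ih
    have hinj : Set.InjOn n {i | i ∈ List.range r} := fun i hi j hj hij =>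
      List.inj_on_of_nodup_map hM hi hj hij
    -- The rule `parp` assigns the added process to a position, which structural congruence does not
    -- preserve. Since names are distinct, the assignment can be made through the name of the node
    -- instead.
    let q (m : S.Node) : Proc S := Q (Function.invFunOn n {i | i ∈ List.range r} m)
    have hq : ∀ i ∈ List.range r, q (n i) = Q i := fun i hi =>
      congrArg Q (hinj.leftInvOn_invFunOn hi)
    have hadd (I : ℕ → Interface S) (P : ℕ → Proc S) (μ : ℕ → Mobility) (h : ℕ → S.Loc) :
        Net.prod ((List.range r).map fun i => .node (n i) (I i) (.par (P i) (Q i)) (μ i) (h i)) =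
          (Net.prod ((List.range r).map fun i =>
            .node (n i) (I i) (P i) (μ i) (h i))).addProc q := by
      rw [Net.addProc_prod_node]
      congr 1
      refine List.map_congr_left fun i hi => ?_
      rw [hq i hi]
    have hfree (I : ℕ → Interface S) (P : ℕ → Proc S) (μ : ℕ → Mobility) (h : ℕ → S.Loc) :
        (Net.prod ((List.range r).map fun i => .node (n i) (I i) (P i) (μ i) (h i))).ResFree := by
      refine Net.resFree_prod fun M hM => ?_
      obtain ⟨i, _, rfl⟩ := List.mem_map.1 hM
      trivial
    obtain ⟨M'', hstep, e⟩ := ih hM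
    rw [hadd, hadd]
    -- The transition starts from a product of nodes, hence its target has no restrictions either,
    -- as `NetEq.addProc` requires.
    exact ⟨_, hstep.addProc q, e.addProc (hstep.resFree (hfree _ _ _ _)) (hfree _ _ _ _) q⟩
  | parn N _ ih =>
    simp only [Net.names, Net.nodes, List.map_append] at hM
    obtain ⟨M'', hs, e⟩ := ih hM.of_append_left
    exact ⟨_, .parL N hs, .par e (.refl N)⟩
  | @res ω _ _ c _ ih =>
    obtain ⟨M'', hs, e⟩ := ih hM
    exact ⟨_, .res' hs (by rw [RLabel.chans_toNLabel]; exact id), .res c e⟩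
  | struct e₁ _ e₂ ih =>
    obtain ⟨M'', hs, e⟩ := ih (e₁.perm_names.nodup_iff.1 hM)
    obtain ⟨M₃, hs', e'⟩ := hs.netEq e₁.symm
    exact ⟨M₃, hs', e'.symm.trans (e.trans e₂)⟩

end ReductionToTransition

/-! ### Transitions are reductions; timed reductions and barbs in terms of transitions -/

section TransitionToReduction

variable {S : Sig.{u}}

/-! ### Processes up to structural congruence -/

theorem ProcEq.nil_par (P : Proc S) : ProcEq (.par .nil P) P :=
  .trans (.par_comm _ _) (.par_nil _)

theorem ProcEq.par_right_comm (P Q R : Proc S) :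
    ProcEq (.par (.par P Q) R) (.par (.par P R) Q) :=
  .trans (.par_assoc _ _ _) (.trans (.par (.refl _) (.par_comm _ _)) (.symm (.par_assoc _ _ _)))

theorem ProcEq.par_par_par_comm (P Q R T : Proc S) :
    ProcEq (.par (.par P Q) (.par R T)) (.par (.par P R) (.par Q T)) :=
  .trans (.symm (.par_assoc _ _ _)) (.trans (.par (.par_right_comm _ _ _) (.refl _))
    (.par_assoc _ _ _))

/-- The axioms of the transition system of processes. -/
inductive Redex : Proc S → PLabel S → Proc S → Prop
  | out (c v P Q) : Redex (.timeout (.out c (.val v)) P Q) (.out c v) P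
  | inp (c v P Q) : Redex (.timeout (.inp c) P Q) (.inp c v) (P.subst 0 v)
  | sens (s v P) : Redex (.pre (.sense s) P) (.sens s v) (P.subst 0 v)
  | act (a v P) : Redex (.pre (.write (.val v) a) P) (.act a v) P
  | pos (h P) : Redex (.pre .pos P) (.pos h) (P.subst 0 (S.locVal h))
  | com {c} (v P Q R T) : S.rng c = ⊥ →
      Redex (.par (.timeout (.out c (.val v)) P Q) (.timeout (.inp c) R T)) .tau
        (.par P (R.subst 0 v))

/-- Up to `≡`, recursions and conditionals above the active prefixes can be resolved and the idle
components collected in one remainder `R`, which is the form the reduction axioms expect. -/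
theorem ProcStep.exists_redex {P P' : Proc S} {l : PLabel S} (h : ProcStep P l P') :
    ∃ A A' R, Redex A l A' ∧ ProcEq P (.par A R) ∧ ProcEq P' (.par A' R) := by
  induction h with
  | sndP => exact ⟨_, _, .nil, .out .., .symm (.par_nil _), .symm (.par_nil _)⟩
  | rcvP => exact ⟨_, _, .nil, .inp .., .symm (.par_nil _), .symm (.par_nil _)⟩
  | sensor => exact ⟨_, _, .nil, .sens .., .symm (.par_nil _), .symm (.par_nil _)⟩
  | actuator => exact ⟨_, _, .nil, .act .., .symm (.par_nil _), .symm (.par_nil _)⟩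
  | posP => exact ⟨_, _, .nil, .pos .., .symm (.par_nil _), .symm (.par_nil _)⟩
  | comL _ _ hc ih₁ ih₂ =>
    obtain ⟨_, _, R, ⟨⟩, e₁, e₁'⟩ := ih₁
    obtain ⟨_, _, T, ⟨⟩, e₂, e₂'⟩ := ih₂
    exact ⟨_, _, _, .com _ _ _ _ _ hc, .trans (.par e₁ e₂) (.par_par_par_comm _ _ _ _),
      .trans (.par e₁' e₂') (.par_par_par_comm _ _ _ _)⟩
  | comR _ _ hc ih₁ ih₂ =>
    obtain ⟨_, _, R, ⟨⟩, e₁, e₁'⟩ := ih₁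
    obtain ⟨_, _, T, ⟨⟩, e₂, e₂'⟩ := ih₂
    exact ⟨_, _, _, .com _ _ _ _ _ hc,
      .trans (.par_comm _ _) (.trans (.par e₂ e₁) (.par_par_par_comm _ _ _ _)),
      .trans (.par_comm _ _) (.trans (.par e₂' e₁') (.par_par_par_comm _ _ _ _))⟩
  | parL Q _ ih =>
    obtain ⟨A, A', R, h, e, e'⟩ := ih
    exact ⟨A, A', .par R Q, h, .trans (.par e (.refl _)) (.par_assoc _ _ _),
      .trans (.par e' (.refl _)) (.par_assoc _ _ _)⟩
  | parR Q _ ih =>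
    obtain ⟨A, A', R, h, e, e'⟩ := ih
    exact ⟨A, A', .par R Q, h,
      .trans (.par_comm _ _) (.trans (.par e (.refl _)) (.par_assoc _ _ _)),
      .trans (.par_comm _ _) (.trans (.par e' (.refl _)) (.par_assoc _ _ _))⟩
  | fix _ ih =>
    obtain ⟨A, A', R, h, e, e'⟩ := ih
    exact ⟨A, A', R, h, .trans (.unfold _) e, e'⟩
  | condT _ hb _ ih =>
    obtain ⟨A, A', R, h, e, e'⟩ := ih
    exact ⟨A, A', R, h, .trans (.cond_true _ _ hb) e, e'⟩
  | condF _ hb _ ih =>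
    obtain ⟨A, A', R, h, e, e'⟩ := ih
    exact ⟨A, A', R, h, .trans (.cond_false _ _ hb) e, e'⟩

theorem Proc.prod_append (L L' : List (Proc S)) :
    ProcEq (Proc.prod (L ++ L')) (.par (Proc.prod L) (Proc.prod L')) := by
  induction L with
  | nil => exact .symm (.nil_par _)
  | cons P L ih => exact .trans (.par (.refl _) ih) (.symm (.par_assoc _ _ _))

theorem Proc.waiting_append (ts ts' : List (Pi S × Proc S × Proc S)) (rs rs' : List (Proc S)) :
    ProcEq (.par (Proc.waiting ts rs) (Proc.waiting ts' rs'))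
      (Proc.waiting (ts ++ ts') (rs ++ rs')) := by
  refine .trans (.par_par_par_comm _ _ _ _) (.par ?_ ?_)
  · rw [List.map_append]; exact .symm (Proc.prod_append _ _)
  · rw [List.map_append]; exact .symm (Proc.prod_append _ _)

theorem Proc.resumed_append (ts ts' : List (Pi S × Proc S × Proc S)) (rs rs' : List (Proc S)) :
    ProcEq (.par (Proc.resumed ts rs) (Proc.resumed ts' rs'))
      (Proc.resumed (ts ++ ts') (rs ++ rs')) := by
  refine .trans (.par_par_par_comm _ _ _ _) (.par ?_ ?_)
  · rw [List.map_append]; exact .symm (Proc.prod_append _ _)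
  · exact .symm (Proc.prod_append _ _)

/-- A process that can let time pass is, up to `≡`, a product of timeouts and sleeps, as required by
the timed reduction axioms. -/
theorem PStep.exists_waiting {P P' : Proc S} (h : PStep P none P') :
    ∃ ts rs, ProcEq P (Proc.waiting ts rs) ∧ ProcEq P' (Proc.resumed ts rs) := by
  obtain ⟨n, h⟩ := h
  generalize hl : none = l at h
  induction h with
  | timeNil => exact ⟨[], [], .symm (.par_nil _), .symm (.par_nil _)⟩
  | delay n P =>
    exact ⟨[], [P], .symm (.trans (.nil_par _) (.par_nil _)),
      .symm (.trans (.nil_par _) (.par_nil _))⟩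
  | timeout n π P Q =>
    exact ⟨[(π, P, Q)], [], .symm (.trans (.par_nil _) (.par_nil _)),
      .symm (.trans (.par_nil _) (.par_nil _))⟩
  | timePar _ _ ih₁ ih₂ =>
    obtain ⟨ts, rs, e₁, e₁'⟩ := ih₁ hl
    obtain ⟨ts', rs', e₂, e₂'⟩ := ih₂ hl
    exact ⟨ts ++ ts', rs ++ rs', .trans (.par e₁ e₂) (Proc.waiting_append _ _ _ _),
      .trans (.par e₁' e₂') (Proc.resumed_append _ _ _ _)⟩
  | fix _ ih =>
    obtain ⟨ts, rs, e, e'⟩ := ih hl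
    exact ⟨ts, rs, .trans (.unfold _) e, e'⟩
  | condT _ hb _ ih =>
    obtain ⟨ts, rs, e, e'⟩ := ih hl
    exact ⟨ts, rs, .trans (.cond_true _ _ hb) e, e'⟩
  | condF _ hb _ ih =>
    obtain ⟨ts, rs, e, e'⟩ := ih hl
    exact ⟨ts, rs, .trans (.cond_false _ _ hb) e, e'⟩
  | _ => cases hl

theorem PStep.waiting (ts : List (Pi S × Proc S × Proc S)) (rs : List (Proc S)) :
    PStep (Proc.waiting ts rs) none (Proc.resumed ts rs) := by
  refine .timePar ?_ ?_
  · induction ts with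
    | nil => exact ⟨0, .timeNil 0⟩
    | cons t ts ih => exact .timePar ⟨0, .timeout 0 t.1 t.2.1 t.2.2⟩ ih
  · induction rs with
    | nil => exact ⟨0, .timeNil 0⟩
    | cons R rs ih => exact .timePar ⟨0, .delay 0 R⟩ ih

/-! ### Reductions -/

theorem Red.node_par {ω : RLabel S} {n : S.Node} {I I' : Interface S} {P P' : Proc S}
    {μ μ' : Mobility} {h h' : S.Loc} (hr : Red ω (.node n I P μ h) (.node n I' P' μ' h'))
    (Q : Proc S) : Red ω (.node n I (.par P Q) μ h) (.node n I' (.par P' Q) μ' h') := by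
  have := Red.parp 1 (fun _ => n) (fun _ => I) (fun _ => I') (fun _ => P) (fun _ => P')
    (fun _ => Q) (fun _ => μ) (fun _ => μ') (fun _ => h) (fun _ => h')
    (.struct (.par_zero _) hr (.symm (.par_zero _)))
  exact .struct (.symm (.par_zero _)) this (.par_zero _)

/-- The axiom for communication between nodes allows nothing beside the two prefixes; the rule
`parp` with two nodes restores the remaining processes. -/
theorem Red.node_par_node {ω : RLabel S} {n m : S.Node} {I I' J J' : Interface S}
    {P P' Q Q' : Proc S} {μ μ' μ₁ μ₁' : Mobility} {h h' k k' : S.Loc}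
    (hr : Red ω (.par (.node n I P μ h) (.node m J Q μ₁ k))
      (.par (.node n I' P' μ' h') (.node m J' Q' μ₁' k'))) (R T : Proc S) :
    Red ω (.par (.node n I (.par P R) μ h) (.node m J (.par Q T) μ₁ k))
      (.par (.node n I' (.par P' R) μ' h') (.node m J' (.par Q' T) μ₁' k')) := by
  let F {α : Type u} (x y : α) : ℕ → α := fun i => Nat.casesOn i x fun _ => y
  -- The same function as `F`, repeated because `Mobility` lives in the lowest universe.
  let G (x y : Mobility) : ℕ → Mobility := fun i => Nat.casesOn i x fun _ => y
  have := Red.parp (ω := ω) 2 (F n m) (F I J) (F I' J') (F P Q) (F P' Q') (F R T) (G μ μ₁)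
    (G μ' μ₁') (F h k) (F h' k')
    (.struct (.par (.refl _) (.par_zero _)) hr (.par (.refl _) (.symm (.par_zero _))))
  exact .struct (.par (.refl _) (.symm (.par_zero _))) this (.par (.refl _) (.par_zero _))

theorem Net.mapChan_prod (f : S.Chan → S.Chan) (L : List (Net S)) :
    (Net.prod L).mapChan f = Net.prod (L.map (Net.mapChan f)) := by
  induction L with
  | nil => rfl
  | cons M L ih => exact congrArg (Net.par _) ih

theorem Red.mapChan {ω : RLabel S} {M M' : Net S} (h : Red ω M M') {f : S.Chan → S.Chan}
    (hf : Function.Injective f) (hr : ∀ c, S.rng (f c) = S.rng c) :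
    Red ω (M.mapChan f) (M'.mapChan f) := by
  induction h with
  | pos n I P μ h => simp only [Net.mapChan, Proc.mapChan_subst]; exact .pos ..
  | sensread n P μ h hs => simp only [Net.mapChan, Proc.mapChan_subst]; exact .sensread _ _ _ _ hs
  | actunchg n P μ h ha => exact .actunchg _ _ _ _ ha
  | actchg n P μ h ha => exact .actchg _ _ _ _ ha
  | loccom n I μ h v P R Q T hc =>
    simp only [Net.mapChan, Proc.mapChan, Proc.mapChan_subst]
    exact .loccom _ _ _ _ _ _ _ _ _ ((hr _).trans hc)
  | glbcom n m I J μ₁ μ₂ v P R Q T hd =>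
    simp only [Net.mapChan, Proc.mapChan, Proc.mapChan_subst]
    exact .glbcom _ _ _ _ _ _ _ _ _ _ _ (by unfold Sig.InRange at *; rwa [hr])
  | parp r n I I' P P' Q μ μ' h h' _ ih =>
    rw [Net.mapChan_prod, Net.mapChan_prod, List.map_map, List.map_map] at ih ⊢
    exact .parp r n I I' (fun i => (P i).mapChan f) (fun i => (P' i).mapChan f)
      (fun i => (Q i).mapChan f) μ μ' h h' ih
  | parn N _ ih => exact .parn _ ih
  | res c _ ih => exact .res _ ih
  | struct e₁ _ e₂ ih => exact .struct (e₁.mapChan hf hr) ih (e₂.mapChan hf hr)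

/-- Since `N` may itself use `d`, the bound channel is renamed before its scope is extended. -/
theorem NetEq.extrude {d d' : S.Chan} {M N : Net S} (hr : S.rng d' = S.rng d)
    (hM : d' ∉ M.freeChans) (hN : d' ∉ N.freeChans) :
    NetEq (.par N (.res d M)) (.res d' (.par N (M.swapChan d d'))) :=
  .trans (.par (.refl _) (.alpha _ _ _ hr hM)) (.symm (.res_par _ _ _ hN))

/-- The reduction axiom wants the two communicating nodes side by side. The induction brings the
receiver out of the parallel compositions and restrictions of `N`, for an arbitrary sending node;
`NetStep.red_par` then does the same for the sender. -/
theorem NetStep.red_node_par {c : S.Chan} {v : S.Val} {k : S.Loc} {N N' : Net S}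
    (hN : NetStep N (.rcv c v k) N') : ∀ {n : S.Node} {I : Interface S} {P P' : Proc S}
    {μ : Mobility} {h : S.Loc}, ProcStep P (.out c v) P' → S.InRange c h k →
    Red .tau (.par (.node n I P μ h) N) (.par (.node n I P' μ h) N') := by
  generalize hl : NLabel.rcv c v k = l at hN
  induction hN with
  | rcv m J μ' k hQ hc =>
    cases hl
    intro n I P P' μ h hP hr
    obtain ⟨_, _, R, ⟨⟩, e₁, e₁'⟩ := hP.exists_redex
    obtain ⟨_, _, T, ⟨⟩, e₂, e₂'⟩ := hQ.exists_redex
    exact .struct (.par (.node _ _ _ _ e₁) (.node _ _ _ _ e₂))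
      ((Red.glbcom n m I J μ μ' v _ _ _ _ hr).node_par_node R T)
      (.par (.node _ _ _ _ e₁'.symm) (.node _ _ _ _ e₂'.symm))
  | parL N _ ih =>
    intro n I P P' μ h hP hr
    exact .struct (.symm (.par_assoc _ _ _)) (.parn N (ih hl hP hr)) (.par_assoc _ _ _)
  | parR M _ ih =>
    intro n I P P' μ h hP hr
    exact .struct (.trans (.par (.refl _) (.par_comm _ _)) (.symm (.par_assoc _ _ _)))
      (.parn M (ih hl hP hr)) (.trans (.par_assoc _ _ _) (.par (.refl _) (.par_comm _ _)))
  | @res N N' l d hN hd ih =>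
    subst hl
    intro n I P P' μ h hP hr
    have hcd : c ≠ d := fun e => (hd v k).2 (e ▸ rfl)
    obtain ⟨d', hr', hd'⟩ := Sig.exists_fresh d
      ((N.finite_freeChans.union P.finite_chans).union (Set.finite_singleton c))
    simp only [Set.mem_union, Set.mem_singleton_iff, not_or] at hd'
    -- The induction hypothesis concerns `N` with its original channel `d`, while `d` becomes `d'`
    -- when its scope is extended. So it is applied to the sender with `d` and `d'` exchanged, and
    -- then the whole reduction is transposed, which restores the sender and renames `N`.
    have hP₁ := hP.mapChan (rng_swapFun hr')
    rw [show (PLabel.out c v).mapChan (swapFun d d') = .out c v from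
      congrArg (PLabel.out · v) (swapFun_of_ne hcd (Ne.symm hd'.2))] at hP₁
    have hred := (ih rfl (n := n) (I := I) (μ := μ) hP₁ hr).mapChan (swapFun_injective d d')
      (rng_swapFun hr')
    simp only [Net.mapChan, Proc.mapChan_mapChan, swapFun_comp_self, Proc.mapChan_id] at hred
    exact .struct (.extrude hr' hd'.1.1 hd'.1.2) (.res d' hred)
      (.symm (.extrude hr' (fun hx => hd'.1.1 (hN.freeChans_subset hx))
        fun hx => hd'.1.2 (hP.chans_subset hx)))
  | _ => cases hl

theorem NetStep.red_par {c : S.Chan} {v : S.Val} {h k : S.Loc} {M M' : Net S}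
    (hM : NetStep M (.snd c v h) M') (hr : S.InRange c h k) : ∀ {N N' : Net S},
    NetStep N (.rcv c v k) N' → Red .tau (.par M N) (.par M' N') := by
  generalize hl : NLabel.snd c v h = l at hM
  induction hM with
  | snd n I μ h hP hc => cases hl; intro N N' hN; exact hN.red_node_par hP hr
  | parL O _ ih =>
    intro N N' hN
    exact .struct (.trans (.par_assoc _ _ _) (.trans (.par (.refl _) (.par_comm _ _))
      (.symm (.par_assoc _ _ _)))) (.parn O (ih hl hN)) (.trans (.par_assoc _ _ _)
        (.trans (.par (.refl _) (.par_comm _ _)) (.symm (.par_assoc _ _ _))))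
  | parR O _ ih =>
    intro N N' hN
    exact .struct (.trans (.par_assoc _ _ _) (.par_comm _ _)) (.parn O (ih hl hN))
      (.trans (.par_comm _ _) (.symm (.par_assoc _ _ _)))
  | @res M M' l d hM hd ih =>
    subst hl
    intro N N' hN
    have hcd : c ≠ d := fun e => (hd v h).1 (e ▸ rfl)
    obtain ⟨d', hr', hd'⟩ := Sig.exists_fresh d
      ((M.finite_freeChans.union N.finite_freeChans).union (Set.finite_singleton c))
    simp only [Set.mem_union, Set.mem_singleton_iff, not_or] at hd'
    have hN₁ := hN.mapChan (swapFun_injective d d') (rng_swapFun hr')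
    rw [show (NLabel.rcv c v k).mapChan (swapFun d d') = .rcv c v k from
      congrArg (NLabel.rcv · v k) (swapFun_of_ne hcd (Ne.symm hd'.2))] at hN₁
    -- Again the partner is transposed first, and the resulting reduction afterwards.
    have hred := (ih rfl hN₁).mapChan (swapFun_injective d d') (rng_swapFun hr')
    simp only [Net.mapChan, Net.mapChan_mapChan, swapFun_comp_self, Net.mapChan_id] at hred
    refine .struct (.trans (.par_comm _ _) (.extrude hr' hd'.1.1 hd'.1.2))
      (.res d' (.struct (.par_comm _ _) hred (.par_comm _ _)))
      (.trans (.symm (.extrude hr' (fun hx => hd'.1.1 (hM.freeChans_subset hx))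
        fun hx => hd'.1.2 (hN.freeChans_subset hx))) (.par_comm _ _))
  | _ => cases hl

/-- Internal transitions and changes of actuators are reductions. -/
theorem NetStep.red {l : NLabel S} {M M' : Net S} (h : NetStep M l M') :
    ∀ {ω : RLabel S}, l = ω.toNLabel → Red ω M M' := by
  induction h with
  | pos n I μ h =>
    rintro (_ | a) ⟨⟩
    obtain ⟨_, _, R, ⟨⟩, e, e'⟩ := h.exists_redex
    exact .struct (.node _ _ _ _ e) ((Red.pos ..).node_par R) (.node _ _ _ _ e'.symm)
  | sensRead n μ k hs h =>
    rintro (_ | a) ⟨⟩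
    obtain ⟨_, _, R, ⟨⟩, e, e'⟩ := h.exists_redex
    exact .struct (.node _ _ _ _ e) ((Red.sensread _ _ _ _ hs).node_par R) (.node _ _ _ _ e'.symm)
  | actUnChg n μ k ha h =>
    rintro (_ | a) ⟨⟩
    obtain ⟨_, _, R, ⟨⟩, e, e'⟩ := h.exists_redex
    exact .struct (.node _ _ _ _ e) ((Red.actunchg _ _ _ _ ha).node_par R) (.node _ _ _ _ e'.symm)
  | locCom n I μ k h =>
    rintro (_ | a) ⟨⟩
    obtain ⟨_, _, R, h, e, e'⟩ := h.exists_redex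
    cases h with
    | com v P Q R' T hc =>
      exact .struct (.node _ _ _ _ e) ((Red.loccom _ _ _ _ _ _ _ _ _ hc).node_par R)
        (.node _ _ _ _ e'.symm)
  | actChg n μ k ha h =>
    rintro (_ | a) ⟨⟩
    obtain ⟨_, _, R, ⟨⟩, e, e'⟩ := h.exists_redex
    exact .struct (.node _ _ _ _ e) ((Red.actchg _ _ _ _ ha).node_par R) (.node _ _ _ _ e'.symm)
  | snd | rcv => rintro (_ | a) ⟨⟩
  | glbComL h₁ h₂ hr => rintro (_ | a) ⟨⟩; exact h₁.red_par hr.symm h₂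
  | glbComR h₁ h₂ hr =>
    rintro (_ | a) ⟨⟩; exact .struct (.par_comm _ _) (h₂.red_par hr.symm h₁) (.par_comm _ _)
  | parL N _ ih => intro ω hω; exact .parn N (ih hω)
  | parR M _ ih => intro ω hω; exact .struct (.par_comm _ _) (.parn M (ih hω)) (.par_comm _ _)
  | res c _ _ ih => intro ω hω; exact .res c (ih hω)

/-- Distinct names are required on account of maximal progress: excluding `τ`-reductions when there
are no `τ`-transitions uses `Red.netStep`. The converse, `RedTime.netTime`, only uses `NetStep.red`,
which needs no such hypothesis. -/
theorem NetTime.redTime {M M' : Net S} (h : NetTime M M') (hM : M.names.Nodup) : RedTime M M' := by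
  induction h with
  | timeStat n I k hP hn =>
    obtain ⟨ts, rs, e, e'⟩ := (procTime_iff.1 hP).1.exists_waiting
    refine .struct (.node _ _ _ _ e) (.timestat n I ts rs k ?_) (.node _ _ _ _ e'.symm)
    rintro ⟨M', hred⟩
    obtain ⟨_, hs, _⟩ := hred.netStep (List.nodup_singleton _)
    obtain ⟨_, hs, _⟩ := hs.netEq (.node _ _ _ _ e.symm)
    exact hn ⟨_, hs⟩
  | timeMob n I hP hn hd =>
    obtain ⟨ts, rs, e, e'⟩ := (procTime_iff.1 hP).1.exists_waiting
    refine .struct (.node _ _ _ _ e) (.timemob n I ts rs ?_ hd) (.node _ _ _ _ e'.symm)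
    rintro ⟨M', hred⟩
    obtain ⟨_, hs, _⟩ := hred.netStep (List.nodup_singleton _)
    obtain ⟨_, hs, _⟩ := hs.netEq (.node _ _ _ _ e.symm)
    exact hn ⟨_, hs⟩
  | timePar _ _ hn ih₁ ih₂ =>
    have hM' := hM
    simp only [Net.names, Net.nodes, List.map_append] at hM'
    refine .timepar (ih₁ hM'.of_append_left) (ih₂ hM'.of_append_right) ?_
    rintro ⟨O, hred⟩
    obtain ⟨_, hs, _⟩ := hred.netStep hM
    exact hn ⟨_, hs⟩
  | timeZero => exact .timezero
  | res c _ ih => exact .res c (ih hM)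

theorem RedTime.netTime {M M' : Net S} (h : RedTime M M') :
    ∃ M'', NetTime M M'' ∧ NetEq M'' M' := by
  induction h with
  | timestat n I ts rs k hn =>
    exact ⟨_, netTime_iff.2 ⟨.stat _ _ _ (.waiting ts rs),
      fun ⟨_, h⟩ => hn ⟨_, h.red (ω := .tau) rfl⟩⟩, .refl _⟩
  | timemob n I ts rs hn hd =>
    exact ⟨_, netTime_iff.2 ⟨.mob _ _ (.waiting ts rs) hd,
      fun ⟨_, h⟩ => hn ⟨_, h.red (ω := .tau) rfl⟩⟩, .refl _⟩
  | timepar _ _ hn ih₁ ih₂ =>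
    obtain ⟨_, h₁, e₁⟩ := ih₁
    obtain ⟨_, h₂, e₂⟩ := ih₂
    exact ⟨_, .timePar h₁ h₂ fun ⟨_, h⟩ => hn ⟨_, h.red (ω := .tau) rfl⟩, .par e₁ e₂⟩
  | timezero => exact ⟨_, .timeZero, .refl _⟩
  | res c _ ih =>
    obtain ⟨_, h, e⟩ := ih
    exact ⟨_, .res c h, .res c e⟩
  | struct e₁ _ e₂ ih =>
    obtain ⟨_, h, e⟩ := ih
    obtain ⟨_, h, e'⟩ := h.netEq e₁.symm
    exact ⟨_, h, e'.symm.trans (e.trans e₂)⟩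

/-! ### Barbs -/

theorem Net.Barb.congr {M N : Net S} {a : S.Act} {h : S.Loc} {v : S.Val} (hM : M.Barb a h v)
    (e : NetEq M N) : N.Barb a h v := by
  obtain ⟨gs, n, I, P, μ, M', e', ha⟩ := hM
  exact ⟨gs, n, I, P, μ, M', e.symm.trans e', ha⟩

theorem Net.Barb.res {M : Net S} {a : S.Act} {h : S.Loc} {v : S.Val} (hM : M.Barb a h v)
    (c : S.Chan) : (Net.res c M).Barb a h v := by
  obtain ⟨gs, n, I, P, μ, M', e, ha⟩ := hM
  exact ⟨c :: gs, n, I, P, μ, M', .res c e, ha⟩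

theorem Net.mapChan_resList (f : S.Chan → S.Chan) (gs : List S.Chan) (M : Net S) :
    (Net.resList gs M).mapChan f = Net.resList (gs.map f) (M.mapChan f) := by
  induction gs with
  | nil => rfl
  | cons g gs ih => exact congrArg (Net.res (f g)) ih

theorem Net.Barb.par_right {M : Net S} {a : S.Act} {h : S.Loc} {v : S.Val} (hM : M.Barb a h v)
    (N : Net S) : (Net.par N M).Barb a h v := by
  obtain ⟨gs, n, I, P, μ, M', e, ha⟩ := hM
  refine Net.Barb.congr ?_ (.par (.refl _) e.symm)
  clear e
  -- The induction is on the number of restrictions, because extending the scope of the first one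
  -- renames channels in everything below it.
  generalize hl : gs.length = r
  induction r generalizing gs P M' with
  | zero =>
    obtain rfl := List.length_eq_zero_iff.1 hl
    exact ⟨[], n, I, P, μ, .par N M', .par_left_comm _ _ _, ha⟩
  | succ r ih =>
    obtain ⟨g, gs, rfl⟩ := List.exists_cons_of_length_eq_add_one hl
    obtain ⟨d, hr, hd⟩ := Sig.exists_fresh g
      ((Net.resList gs (.par (.node n I P μ h) M')).finite_freeChans.union N.finite_freeChans)
    rw [Set.mem_union, not_or] at hd
    refine Net.Barb.congr ?_ (NetEq.extrude hr hd.1 hd.2).symm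
    refine Net.Barb.res ?_ d
    rw [Net.swapChan_eq, Net.mapChan_resList]
    exact ih _ _ _ (by simpa using hl)

theorem Net.nodes_resList (gs : List S.Chan) (M : Net S) : (Net.resList gs M).nodes = M.nodes := by
  induction gs with
  | nil => rfl
  | cons g gs ih => exact ih

/-- A barb only concerns the interface and the location of a node, and these survive structural
congruence by `NetEq.perm_frame`. -/
theorem Net.barb_iff {M : Net S} {a : S.Act} {h : S.Loc} {v : S.Val} :
    M.Barb a h v ↔ ∃ x ∈ M.nodes, x.iface.act a = some v ∧ x.loc = h := by
  constructor
  · rintro ⟨gs, n, I, P, μ, M', e, ha⟩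
    have hmem : (n, I, μ, h) ∈ (Net.resList gs (.par (.node n I P μ h) M')).nodes.map
        NodeData.frame := by
      rw [Net.nodes_resList]; exact List.mem_cons_self
    obtain ⟨x, hx, hxf⟩ := List.mem_map.1 (e.perm_frame.mem_iff.2 hmem)
    simp only [NodeData.frame, Prod.mk.injEq] at hxf
    exact ⟨x, hx, hxf.2.1 ▸ ha, hxf.2.2.2⟩
  · rintro ⟨x, hx, ha, rfl⟩
    induction M with
    | zero => cases hx
    | node n I P μ k =>
      obtain rfl := List.mem_singleton.1 hx
      exact ⟨[], n, I, P, μ, .zero, .symm (.par_zero _), ha⟩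
    | par M N ih₁ ih₂ =>
      rcases List.mem_append.1 hx with hx | hx
      · exact ((ih₁ hx).par_right N).congr (.par_comm _ _)
      · exact (ih₂ hx).par_right M
    | res c M ih => exact (ih hx).res c

end TransitionToReduction

/-! ### Well-formedness is preserved, and actuators identify their owners -/

section WellFormedness

variable {S : Sig.{u}}

theorem NodeData.Compatible.symm {x y : NodeData S} (h : x.Compatible y) : y.Compatible x :=
  ⟨h.name_ne.symm, fun a ha => h.act_disj a ha.symm, fun s hs hs' => h.sens_disj s hs hs'.symm⟩

theorem Net.WF.of_perm {M N : Net S} (h : M.WF) (hp : M.nodes.Perm N.nodes) : N.WF :=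
  ⟨fun x hx => h.1 x (hp.mem_iff.2 hx), (hp.pairwise_iff fun h => h.symm).1 h.2⟩

theorem Net.wf_par_iff {M N : Net S} : (Net.par M N).WF ↔
    M.WF ∧ N.WF ∧ ∀ x ∈ M.nodes, ∀ y ∈ N.nodes, x.Compatible y := by
  simp only [Net.WF, Net.nodes, List.pairwise_append, List.forall_mem_append]
  tauto

theorem Net.WF.names_nodup {M : Net S} (h : M.WF) : M.names.Nodup :=
  List.pairwise_map.2 (h.2.imp fun h => h.name_ne)

/-- The network has a node with the actuator `a`. -/
def Net.HasAct (M : Net S) (a : S.Act) : Prop := ∃ x ∈ M.nodes, (x.iface.act a).isSome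

/-- The means of deciding which component of a parallel composition displays or changes an actuator.
-/
theorem Net.WF.not_hasAct_right {M N : Net S} {a : S.Act} (h : (Net.par M N).WF)
    (hM : M.HasAct a) : ¬ N.HasAct a := by
  rintro ⟨y, hy, hya⟩
  obtain ⟨x, hx, hxa⟩ := hM
  exact ((Net.wf_par_iff.1 h).2.2 x hx y hy).act_disj a ⟨hxa, hya⟩

/-- A well-formed node `y` with the same name, sensors and actuators as `x`. -/
structure NodeData.Evolves (x y : NodeData S) : Prop where
  name : y.name = x.name
  sens : ∀ s, (y.iface.sens s).isSome = (x.iface.sens s).isSome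
  act : ∀ a, (y.iface.act a).isSome = (x.iface.act a).isSome
  wf : y.WF

theorem NodeData.Compatible.of_evolves {x x' y y' : NodeData S} (hx : x.Evolves x')
    (hy : y.Evolves y') (h : x.Compatible y) : x'.Compatible y' where
  name_ne := by rw [hx.name, hy.name]; exact h.name_ne
  act_disj a := by rw [hx.act, hy.act]; exact h.act_disj a
  sens_disj s hs := by rw [hx.sens, hy.sens]; exact h.sens_disj s hs

theorem forall₂_exists_left {α β : Type*} {r : α → β → Prop} {L : List α} {L' : List β}
    (h : List.Forall₂ r L L') {y : β} (hy : y ∈ L') : ∃ x ∈ L, r x y := by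
  induction h with
  | nil => cases hy
  | cons h _ ih =>
    rcases List.mem_cons.1 hy with rfl | hy
    · exact ⟨_, List.mem_cons_self, h⟩
    · obtain ⟨x, hx, hxy⟩ := ih hy
      exact ⟨x, List.mem_cons_of_mem _ hx, hxy⟩

theorem Net.WF.of_evolves {M N : Net S} (h : M.WF)
    (hn : List.Forall₂ NodeData.Evolves M.nodes N.nodes) : N.WF := by
  refine ⟨fun y hy => ?_, ?_⟩
  · obtain ⟨x, _, hxy⟩ := forall₂_exists_left hn hy
    exact hxy.wf
  · have h₂ := h.2
    clear h
    generalize M.nodes = L, N.nodes = L' at hn h₂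
    induction hn with
    | nil => exact .nil
    | cons hx hL ih =>
      rw [List.pairwise_cons] at h₂ ⊢
      refine ⟨fun y' hy' => ?_, ih h₂.2⟩
      obtain ⟨y, hy, hyy'⟩ := forall₂_exists_left hL hy'
      exact (h₂.1 y hy).of_evolves hx hyy'

theorem NodeData.WF.with_proc {n : S.Node} {I : Interface S} {P P' : Proc S} {μ : Mobility}
    {h : S.Loc} {l : Option (PLabel S)} (hx : NodeData.WF ⟨n, I, P, μ, h⟩) (hP : PStep P l P')
    (k : S.Loc) : NodeData.WF ⟨n, I, P', μ, k⟩ := by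
  obtain ⟨r, hP⟩ := hP
  exact ⟨hx.finite_sens, hx.finite_act, hP.closed hx.closed, hP.recGuarded hx.guarded,
    hP.usesOnly hx.usesOnly, hx.stationary⟩

theorem NodeData.WF.evolves_proc {n : S.Node} {I : Interface S} {P P' : Proc S} {μ : Mobility}
    {h : S.Loc} {l : Option (PLabel S)} (hx : NodeData.WF ⟨n, I, P, μ, h⟩) (hP : PStep P l P')
    (k : S.Loc) : NodeData.Evolves ⟨n, I, P, μ, h⟩ ⟨n, I, P', μ, k⟩ :=
  ⟨rfl, fun _ => rfl, fun _ => rfl, hx.with_proc hP k⟩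

theorem Interface.isSome_setAct {I : Interface S} {a : S.Act} (v : S.Val)
    (ha : (I.act a).isSome) (b : S.Act) : ((I.setAct a v).act b).isSome = (I.act b).isSome := by
  unfold Interface.setAct
  by_cases h : b = a
  · subst h; simp [ha]
  · simp [h]

theorem NodeData.Evolves.refl {x : NodeData S} (hx : x.WF) : x.Evolves x :=
  ⟨rfl, fun _ => rfl, fun _ => rfl, hx⟩

theorem NetStep.evolves {M M' : Net S} {l : NLabel S} (h : NetStep M l M')
    (hM : ∀ x ∈ M.nodes, x.WF) : List.Forall₂ NodeData.Evolves M.nodes M'.nodes := by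
  have self {N : Net S} (hN : ∀ x ∈ N.nodes, x.WF) :
      List.Forall₂ NodeData.Evolves N.nodes N.nodes :=
    List.forall₂_same.2 fun x hx => .refl (hN x hx)
  have left {M N : Net S} (h : ∀ x ∈ (Net.par M N).nodes, x.WF) : ∀ x ∈ M.nodes, x.WF :=
    fun x hx => h x (List.mem_append_left _ hx)
  have right {M N : Net S} (h : ∀ x ∈ (Net.par M N).nodes, x.WF) : ∀ x ∈ N.nodes, x.WF :=
    fun x hx => h x (List.mem_append_right _ hx)
  induction h with
  | pos _ _ _ h | sensRead _ _ _ _ h | actUnChg _ _ _ _ h | locCom _ _ _ _ h | snd _ _ _ _ h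
  | rcv _ _ _ _ h =>
    exact .cons ((hM _ List.mem_cons_self).evolves_proc (pStep_some.2 h) _) .nil
  | @actChg _ _ a v n I μ k ha h =>
    have hx := hM _ List.mem_cons_self
    have hx' := hx.with_proc (pStep_some.2 h) k
    have hs (v : S.Val) := Interface.isSome_setAct v (h.act_isSome hx.usesOnly)
    refine .cons ⟨rfl, fun _ => rfl, hs v, ⟨hx.finite_sens, ?_, hx'.closed, hx'.guarded,
      Proc.UsesOnly.mono (I := I) (J := I.setAct a v) (fun _ => rfl) (hs v) _ hx'.usesOnly, hx.stationary⟩⟩ .nil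
    simpa only [hs] using hx.finite_act
  | glbComL _ _ _ ih₁ ih₂ | glbComR _ _ _ ih₁ ih₂ =>
    exact List.rel_append (ih₁ (left hM)) (ih₂ (right hM))
  | parL _ _ ih => exact List.rel_append (ih (left hM)) (self (right hM))
  | parR _ _ ih => exact List.rel_append (self (left hM)) (ih (right hM))
  | res c _ _ ih => exact ih hM

theorem TimeStep.evolves {M M' : Net S} (h : TimeStep M M')
    (hM : ∀ x ∈ M.nodes, x.WF) : List.Forall₂ NodeData.Evolves M.nodes M'.nodes := by
  induction h with
  | stat _ _ _ h | mob _ _ h _ =>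
    exact .cons ((hM _ List.mem_cons_self).evolves_proc h _) .nil
  | par _ _ ih₁ ih₂ =>
    exact List.rel_append (ih₁ fun x hx => hM x (List.mem_append_left _ hx))
      (ih₂ fun x hx => hM x (List.mem_append_right _ hx))
  | zero => exact .nil
  | res c _ ih => exact ih hM

theorem NetStep.wf {M M' : Net S} {l : NLabel S} (h : NetStep M l M') (hM : M.WF) : M'.WF :=
  hM.of_evolves (h.evolves hM.1)

theorem NetTime.wf {M M' : Net S} (h : NetTime M M') (hM : M.WF) : M'.WF :=
  hM.of_evolves ((netTime_iff.1 h).1.evolves hM.1)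

theorem NetStep.hasAct {M M' : Net S} {a : S.Act} (h : NetStep M (.act a) M') (hM : M.WF) :
    M.HasAct a := by
  replace hM := hM.1
  generalize hl : NLabel.act a = l at h
  induction h with
  | actChg n μ k ha h =>
    cases hl
    have hx := hM _ List.mem_cons_self
    exact ⟨_, List.mem_cons_self, h.act_isSome hx.usesOnly⟩
  | parL _ _ ih =>
    obtain ⟨x, hx, hxa⟩ := ih (fun x hx => hM x (List.mem_append_left _ hx)) hl
    exact ⟨x, List.mem_append_left _ hx, hxa⟩
  | parR _ _ ih =>
    obtain ⟨x, hx, hxa⟩ := ih (fun x hx => hM x (List.mem_append_right _ hx)) hl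
    exact ⟨x, List.mem_append_right _ hx, hxa⟩
  | res c _ _ ih => exact ih hM hl
  | _ => cases hl

theorem NetStep.map_frame {M M' : Net S} (h : NetStep M .tau M') :
    M'.nodes.map NodeData.frame = M.nodes.map NodeData.frame := by
  -- A `τ`-step may be a communication, so the induction has to cover sending and receiving; only
  -- changes of actuators affect interfaces.
  suffices H : ∀ {l}, NetStep M l M' → (∀ a, l ≠ .act a) →
      M'.nodes.map NodeData.frame = M.nodes.map NodeData.frame from H h (by simp)
  clear h
  intro l h hl
  induction h with
  | glbComL _ _ _ ih₁ ih₂ | glbComR _ _ _ ih₁ ih₂ =>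
    simp only [Net.nodes, List.map_append, ih₁ (by simp), ih₂ (by simp)]
  | parL _ _ ih | parR _ _ ih => simp only [Net.nodes, List.map_append, ih hl]
  | res c _ _ ih => exact ih hl
  | actChg => exact absurd rfl (hl _)
  | _ => rfl

/-- Well-formedness is not invariant under `≡`, for instance because the discarded branch of a
conditional is arbitrary; therefore it is assumed for `N`. Compatibility with `O` depends only on
names and interfaces, which are invariant. -/
theorem NetEq.wf_par {M N O : Net S} (e : NetEq M N) (h : (Net.par M O).WF) (hN : N.WF) :
    (Net.par N O).WF := by
  obtain ⟨_, hO, hc⟩ := Net.wf_par_iff.1 h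
  refine Net.wf_par_iff.2 ⟨hN, hO, fun y hy z hz => ?_⟩
  obtain ⟨x, hx, hxy⟩ := List.mem_map.1 (e.perm_frame.mem_iff.2 (List.mem_map_of_mem hy))
  simp only [NodeData.frame, Prod.mk.injEq] at hxy
  have := hc x hx z hz
  exact ⟨hxy.1 ▸ this.name_ne, hxy.2.1 ▸ this.act_disj, hxy.2.1 ▸ this.sens_disj⟩

end WellFormedness

/-! ### Reduction barbed congruence up to structural congruence, in terms of transitions -/

section Congruence

variable {S : Sig.{u}}

theorem Net.freeChans_update (s : S.Sens) (h : S.Loc) (v : S.Val) (M : Net S) :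
    (M.update s h v).freeChans = M.freeChans := by
  induction M with
  | zero => rfl
  | node n I P μ k => unfold Net.update; split <;> rfl
  | par M N ih₁ ih₂ => simp only [Net.update, Net.freeChans, ih₁, ih₂]
  | res c M ih => simp only [Net.update, Net.freeChans, ih]

theorem Net.update_mapChan (s : S.Sens) (h : S.Loc) (v : S.Val) (f : S.Chan → S.Chan)
    (M : Net S) : (M.mapChan f).update s h v = (M.update s h v).mapChan f := by
  induction M with
  | zero => rfl
  | node n I P μ k => simp only [Net.update, Net.mapChan]; split <;> rfl
  | par M N ih₁ ih₂ => simp only [Net.update, Net.mapChan, ih₁, ih₂]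
  | res c M ih => simp only [Net.update, Net.mapChan, ih]

theorem NetEq.update {M N : Net S} (e : NetEq M N) (s : S.Sens) (h : S.Loc) (v : S.Val) :
    NetEq (M.update s h v) (N.update s h v) := by
  induction e with
  | refl => exact .refl _
  | symm _ ih => exact .symm ih
  | trans _ _ ih₁ ih₂ => exact .trans ih₁ ih₂
  | par _ _ ih₁ ih₂ => exact .par ih₁ ih₂
  | res c _ ih => exact .res c ih
  | alpha c d M hr hd =>
    simp only [Net.update, Net.swapChan_eq, Net.update_mapChan]
    exact .alpha c d _ hr (by rwa [Net.freeChans_update])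
  | node n I μ k e => simp only [Net.update]; split <;> exact .node _ _ _ _ e
  | par_zero M => exact .par_zero _
  | par_comm M N => exact .par_comm _ _
  | par_assoc M N O => exact .par_assoc _ _ _
  | res_zero c => exact .res_zero _
  | res_comm c d M => exact .res_comm _ _ _
  | res_par c M N hc => exact .res_par _ _ _ (by rwa [Net.freeChans_update])

theorem Network.Reduces.of_netEq {M N N' : Network S} (e : NetEq M.1 N.1) (h : N.Reduces N') :
    M.Reduces N' :=
  h.imp (fun h => .struct e h (.refl _)) fun h => .struct e h (.refl _)

/-- A first reduction absorbs `e`; only the empty sequence has to end at a merely congruent network.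
-/
theorem Network.ReducesMany.of_netEq {M N N' : Network S} (e : NetEq M.1 N.1)
    (h : N.ReducesMany N') : ∃ M', M.ReducesMany M' ∧ NetEq N'.1 M'.1 := by
  rcases Relation.ReflTransGen.cases_head h with rfl | ⟨O, hO, h⟩
  · exact ⟨M, .refl, e.symm⟩
  · exact ⟨N', .head (hO.of_netEq e) h, .refl _⟩

theorem RBCongruent.symm {M N : Network S} (h : RBCongruent M N) : RBCongruent N M := by
  obtain ⟨R, hs, h₁, h₂, h₃, h⟩ := h
  exact ⟨R, hs, h₁, h₂, h₃, hs _ _ h⟩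

/-- Composing the witnessing relation with `≡` on both sides preserves all its defining properties.
-/
theorem RBCongruent.congr {M N M' N' : Network S} (h : RBCongruent M N) (eM : NetEq M.1 M'.1)
    (eN : NetEq N.1 N'.1) : RBCongruent M' N' := by
  obtain ⟨R, hs, hred, hbarb, hctx, h⟩ := h
  refine ⟨fun X Y => ∃ A B, NetEq A.1 X.1 ∧ NetEq B.1 Y.1 ∧ R A B, ?_, ?_, ?_, ?_,
    M, N, eM, eN, h⟩
  · rintro X Y ⟨A, B, eA, eB, h⟩
    exact ⟨B, A, eB, eA, hs _ _ h⟩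
  · rintro X Y ⟨A, B, eA, eB, h⟩
    constructor
    · intro X' hX
      obtain ⟨B', hB, h'⟩ := (hred A B h).1 X' (hX.of_netEq eA)
      obtain ⟨Y', hY, e⟩ := hB.of_netEq eB.symm
      exact ⟨Y', hY, X', B', .refl _, e, h'⟩
    · intro a X' hX
      obtain ⟨B₁, B₂, B', h₁, h₂, h₃, h'⟩ := (hred A B h).2 a X' (.struct eA hX (.refl _))
      obtain ⟨Y₁, hY, e⟩ := h₁.of_netEq eB.symm
      exact ⟨Y₁, B₂, B', hY, .struct e.symm h₂ (.refl _), h₃, X', B', .refl _, .refl _, h'⟩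
  · rintro X Y ⟨A, B, eA, eB, h⟩ a k v hX
    obtain ⟨B', hB, hb⟩ := hbarb A B h a k v (Net.Barb.congr hX eA.symm)
    obtain ⟨Y', hY, e⟩ := hB.of_netEq eB.symm
    exact ⟨Y', hY, Net.Barb.congr hb e⟩
  · rintro X Y ⟨A, B, eA, eB, h⟩
    refine ⟨fun O hX hY => ?_, fun c => ?_, fun s k v hv => ?_⟩
    · exact ⟨⟨_, eA.symm.wf_par hX A.2⟩, ⟨_, eB.symm.wf_par hY B.2⟩, .par eA (.refl _),
        .par eB (.refl _), (hctx A B h).1 O _ _⟩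
    · exact ⟨A.res c, B.res c, .res c eA, .res c eB, (hctx A B h).2.1 c⟩
    · exact ⟨A.update s k v, B.update s k v, eA.update s k v, eB.update s k v,
        (hctx A B h).2.2 s k v hv⟩

/-! ### Reduction barbed congruence in terms of transitions -/

/-- Internal steps and passage of time. -/
def LStep (M N : Net S) : Prop := NetStep M .tau N ∨ NetTime M N

/-- Sequences of internal steps and passages of time. -/
def LSteps : Net S → Net S → Prop := Relation.ReflTransGen LStep

/-- Sequences of internal steps. -/
def TauSteps : Net S → Net S → Prop := Relation.ReflTransGen fun M N => NetStep M .tau N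

theorem LStep.wf {M N : Net S} (h : LStep M N) (hM : M.WF) : N.WF :=
  h.elim (fun h => h.wf hM) fun h => h.wf hM

theorem LSteps.wf {M N : Net S} (h : LSteps M N) (hM : M.WF) : N.WF := by
  induction h with
  | refl => exact hM
  | tail _ h ih => exact h.wf ih

theorem TauSteps.lSteps {M N : Net S} (h : TauSteps M N) : LSteps M N := by
  induction h with
  | refl => exact .refl
  | tail _ h ih => exact .tail ih (.inl h)

theorem TauSteps.wf {M N : Net S} (h : TauSteps M N) (hM : M.WF) : N.WF := h.lSteps.wf hM

theorem TauSteps.trans {M N O : Net S} (h : TauSteps M N) (h' : TauSteps N O) : TauSteps M O :=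
  Relation.ReflTransGen.trans h h'

theorem TauSteps.map_frame {M N : Net S} (h : TauSteps M N) :
    N.nodes.map NodeData.frame = M.nodes.map NodeData.frame := by
  induction h with
  | refl => rfl
  | tail _ h ih => exact h.map_frame.trans ih

theorem LStep.netEq {M N M' : Net S} (h : LStep M M') (e : NetEq M N) :
    ∃ N', LStep N N' ∧ NetEq M' N' := by
  rcases h with h | h
  · obtain ⟨N', h, e⟩ := h.netEq e; exact ⟨N', .inl h, e⟩
  · obtain ⟨N', h, e⟩ := h.netEq e; exact ⟨N', .inr h, e⟩

theorem LSteps.netEq {M N M' : Net S} (h : LSteps M M') (e : NetEq M N) :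
    ∃ N', LSteps N N' ∧ NetEq M' N' := by
  induction h with
  | refl => exact ⟨N, .refl, e⟩
  | tail _ h ih =>
    obtain ⟨N₁, h₁, e₁⟩ := ih
    obtain ⟨N₂, h₂, e₂⟩ := h.netEq e₁
    exact ⟨N₂, .tail h₁ h₂, e₂⟩

theorem LStep.reduces {M N : Network S} (h : LStep M.1 N.1) : M.Reduces N :=
  h.imp (fun h => h.red rfl) fun h => h.redTime M.2.names_nodup

theorem Network.Reduces.lStep {M N : Network S} (h : M.Reduces N) :
    ∃ N', LStep M.1 N' ∧ NetEq N' N.1 := by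
  rcases h with h | h
  · obtain ⟨N', h, e⟩ := h.netStep M.2.names_nodup; exact ⟨N', .inl h, e⟩
  · obtain ⟨N', h, e⟩ := h.netTime; exact ⟨N', .inr h, e⟩

/-- Each reduction is a transition only up to `≡`; the discrepancy is carried along the sequence by
compatibility of `≡` with transitions. -/
theorem Network.ReducesMany.lSteps {M N : Network S} (h : M.ReducesMany N) {M₀ : Net S}
    (e : NetEq M₀ M.1) : ∃ N', LSteps M₀ N' ∧ NetEq N' N.1 := by
  induction h with
  | refl => exact ⟨M₀, .refl, e⟩
  | tail _ h ih =>
    obtain ⟨N₁, h₁, e₁⟩ := ih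
    obtain ⟨N₂, h₂, e₂⟩ := h.lStep
    obtain ⟨N₃, h₃, e₃⟩ := h₂.netEq e₁.symm
    exact ⟨N₃, .tail h₁ h₃, e₃.symm.trans e₂⟩

/-- Reduction barbed congruence of two networks which are moreover well-formed. -/
def NetCong (M N : Net S) : Prop := ∃ (hM : M.WF) (hN : N.WF), RBCongruent ⟨M, hM⟩ ⟨N, hN⟩

namespace NetCong

variable {M N : Net S}

theorem symm (h : NetCong M N) : NetCong N M := ⟨h.2.1, h.1, h.2.2.symm⟩

theorem congr {M' N' : Net S} (h : NetCong M N) (eM : NetEq M M') (eN : NetEq N N')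
    (hM : M'.WF) (hN : N'.WF) : NetCong M' N' := ⟨hM, hN, h.2.2.congr eM eN⟩

theorem par_left (h : NetCong M N) {O : Net S} (hM : (Net.par O M).WF) (hN : (Net.par O N).WF) :
    NetCong (.par O M) (.par O N) := by
  obtain ⟨_, _, R, hs, hred, hbarb, hctx, h⟩ := h
  have hM' : (Net.par M O).WF := hM.of_perm List.perm_append_comm
  have hN' : (Net.par N O).WF := hN.of_perm List.perm_append_comm
  exact ⟨hM, hN, RBCongruent.congr ⟨R, hs, hred, hbarb, hctx, (hctx _ _ h).1 O hM' hN'⟩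
    (.par_comm _ _) (.par_comm _ _)⟩

theorem update (h : NetCong M N) (s : S.Sens) (k : S.Loc) {v : S.Val} (hv : v ∈ S.dom s) :
    NetCong (M.update s k v) (N.update s k v) := by
  obtain ⟨_, _, R, hs, hred, hbarb, hctx, h⟩ := h
  exact ⟨_, _, R, hs, hred, hbarb, hctx, (hctx _ _ h).2.2 s k v hv⟩

theorem lStep (h : NetCong M N) {M' : Net S} (hM : LStep M M') :
    ∃ N', LSteps N N' ∧ NetCong M' N' := by
  obtain ⟨hM₀, hN₀, R, hs, hred, hbarb, hctx, h⟩ := h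
  obtain ⟨N', hN, h'⟩ := (hred _ _ h).1 ⟨M', hM.wf hM₀⟩ (LStep.reduces hM)
  obtain ⟨N'', hN', e⟩ := hN.lSteps (.refl _)
  exact ⟨N'', hN', _, hN'.wf hN₀,
    RBCongruent.congr ⟨R, hs, hred, hbarb, hctx, h'⟩ (.refl _) e.symm⟩

theorem act (h : NetCong M N) {M' : Net S} {a : S.Act} (hM : NetStep M (.act a) M') :
    ∃ N₁ N₂ N', LSteps N N₁ ∧ NetStep N₁ (.act a) N₂ ∧ LSteps N₂ N' ∧ NetCong M' N' := by
  obtain ⟨hM₀, hN₀, R, hs, hred, hbarb, hctx, h⟩ := h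
  obtain ⟨N₁, N₂, N', h₁, h₂, h₃, h'⟩ := (hred _ _ h).2 a ⟨M', hM.wf hM₀⟩ (hM.red rfl)
  obtain ⟨L₁, k₁, e₁⟩ := h₁.lSteps (.refl _)
  obtain ⟨L₂, k₂, e₂⟩ := Red.netStep h₂ N₁.2.names_nodup
  obtain ⟨L₃, k₃, e₃⟩ := k₂.netEq e₁.symm
  obtain ⟨L₄, k₄, e₄⟩ := h₃.lSteps (e₃.symm.trans e₂)
  exact ⟨L₁, L₃, L₄, k₁, k₃, k₄, _, k₄.wf (k₃.wf (k₁.wf hN₀)),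
    RBCongruent.congr ⟨R, hs, hred, hbarb, hctx, h'⟩ (.refl _) e₄.symm⟩

theorem barb (h : NetCong M N) {a : S.Act} {k : S.Loc} {v : S.Val} (hM : M.Barb a k v) :
    ∃ N', LSteps N N' ∧ N'.Barb a k v := by
  obtain ⟨hM₀, hN₀, R, hs, hred, hbarb, hctx, h⟩ := h
  obtain ⟨N', hN, hb⟩ := hbarb _ _ h a k v hM
  obtain ⟨N'', hN', e⟩ := hN.lSteps (.refl _)
  exact ⟨N'', hN', Net.Barb.congr hb e.symm⟩

end NetCong

end Congruence

/-! ### Testing nodes with one fresh actuator; observations within a time unit -/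

section Devices

variable {S : Sig.{u}}

/-! ### Contexts which do not interact -/

theorem NetStep.par_silent {K U X : Net S} {l : NLabel S} (hK : ∀ l X, ¬ NetStep K l X)
    (h : NetStep (.par K U) l X) : ∃ U', NetStep U l U' ∧ X = .par K U' := by
  cases h with
  | glbComL h _ _ => exact absurd h (hK _ _)
  | glbComR h _ _ => exact absurd h (hK _ _)
  | parL _ h => exact absurd h (hK _ _)
  | parR _ h => exact ⟨_, h, rfl⟩

/-- The network can do nothing but change actuators. -/
def Quiet (K : Net S) : Prop := ∀ l X, NetStep K l X → ∃ a, l = .act a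

theorem Quiet.tau {K U X : Net S} (hK : Quiet K) (h : NetStep (.par K U) .tau X) :
    ∃ U', NetStep U .tau U' ∧ X = .par K U' := by
  cases h with
  | glbComL h _ _ => obtain ⟨_, ⟨⟩⟩ := hK _ _ h
  | glbComR h _ _ => obtain ⟨_, ⟨⟩⟩ := hK _ _ h
  | parL _ h => obtain ⟨_, ⟨⟩⟩ := hK _ _ h
  | parR _ h => exact ⟨_, h, rfl⟩

theorem Quiet.tauSteps {K U X : Net S} (hK : Quiet K) (h : TauSteps (.par K U) X) :
    ∃ U', TauSteps U U' ∧ X = .par K U' := by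
  induction h with
  | refl => exact ⟨U, .refl, rfl⟩
  | tail _ h ih =>
    obtain ⟨U₁, h₁, rfl⟩ := ih
    obtain ⟨U₂, h₂, rfl⟩ := hK.tau h
    exact ⟨U₂, .tail h₁ h₂, rfl⟩

/-- The blocking principle: changes of actuators do not belong to these sequences, so `K` never
moves, and as long as it stands time cannot pass. Only `τ`-steps of `U` remain. -/
theorem Quiet.lSteps {K U X : Net S} (hK : Quiet K) (hb : ∀ X, ¬ TimeStep K X)
    (h : LSteps (.par K U) X) : ∃ U', TauSteps U U' ∧ X = .par K U' := by
  induction h with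
  | refl => exact ⟨U, .refl, rfl⟩
  | tail _ h ih =>
    obtain ⟨U₁, h₁, rfl⟩ := ih
    rcases h with h | h
    · obtain ⟨U₂, h₂, rfl⟩ := hK.tau h
      exact ⟨U₂, .tail h₁ h₂, rfl⟩
    · cases (netTime_iff.1 h).1 with
      | par hK' _ => exact absurd hK' (hb _)

/-- A network which does nothing but let time pass, and has no sensors. -/
structure Inert (G : Net S) : Prop where
  silent : ∀ l X, ¬ NetStep G l X
  time : ∀ X, TimeStep G X ↔ X = G
  update : ∀ s h v, G.update s h v = G

theorem Inert.quiet {G : Net S} (hG : Inert G) : Quiet G := fun l X h => absurd h (hG.silent l X)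

theorem silent_par {K K' : Net S} (h : ∀ l X, ¬ NetStep K l X) (h' : ∀ l X, ¬ NetStep K' l X) :
    ∀ l X, ¬ NetStep (.par K K') l X := fun _ _ hX =>
  (NetStep.par_silent h hX).elim fun _ hX => h' _ _ hX.1

theorem timeStep_par_iff {M N X : Net S} :
    TimeStep (.par M N) X ↔ ∃ M' N', TimeStep M M' ∧ TimeStep N N' ∧ X = .par M' N' := by
  constructor
  · intro h
    cases h with
    | par h h' => exact ⟨_, _, h, h', rfl⟩
  · rintro ⟨_, _, h, h', rfl⟩
    exact .par h h'

/-! ### Nodes with a single actuator -/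

open Classical in
/-- The interface whose only component is the actuator `a`, set to `v`. -/
noncomputable def Interface.single (a : S.Act) (v : S.Val) : Interface S :=
  ⟨fun _ => none, fun b => if b = a then some v else none⟩

theorem Interface.single_act_self (a : S.Act) (v : S.Val) :
    (Interface.single a v).act a = some v := if_pos rfl

theorem Interface.single_act_isSome {a b : S.Act} {v : S.Val} :
    ((Interface.single a v).act b).isSome ↔ b = a := by
  simp only [Interface.single]
  split_ifs with h <;> simp [h]

theorem Interface.setAct_single (a : S.Act) (v w : S.Val) :
    (Interface.single a v).setAct a w = .single a w := by
  simp only [Interface.setAct, Interface.single, Interface.mk.injEq, true_and]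
  funext b
  by_cases h : b = a
  · subst h; simp
  · simp [h]

/-- A stationary node `n` at `h` with the single actuator `a`, set to `v`. -/
noncomputable def device (n : S.Node) (h : S.Loc) (a : S.Act) (v : S.Val) (P : Proc S) : Net S :=
  .node n (.single a v) P .stat h

/-- The process that sets `a` to `v`. -/
def Proc.set (a : S.Act) (v : S.Val) : Proc S := .pre (.write (.val v) a) .nil

theorem device_silent {n : S.Node} {h : S.Loc} {a : S.Act} {v : S.Val} {P : Proc S}
    (hP : ∀ l P', ¬ ProcStep P l P') : ∀ l X, ¬ NetStep (device n h a v P) l X := by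
  intro l X hX
  cases hX <;> exact hP _ _ ‹_›

theorem device_timeStep {n : S.Node} {h : S.Loc} {a : S.Act} {v : S.Val} {P : Proc S} {X : Net S} :
    TimeStep (device n h a v P) X ↔ ∃ P', PStep P none P' ∧ X = device n h a v P' := by
  constructor
  · intro hX
    cases hX with
    | stat _ _ _ hP => exact ⟨_, hP, rfl⟩
  · rintro ⟨P', hP, rfl⟩
    exact .stat _ _ _ hP

theorem device_hasAct (n : S.Node) (h : S.Loc) (a : S.Act) (v : S.Val) (P : Proc S) :
    (device n h a v P).HasAct a :=
  ⟨_, List.mem_cons_self, Interface.single_act_isSome.2 rfl⟩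

theorem device_update (n : S.Node) (h : S.Loc) (a : S.Act) (v : S.Val) (P : Proc S) (s : S.Sens)
    (k : S.Loc) (w : S.Val) : (device n h a v P).update s k w = device n h a v P := by
  simp [device, Net.update, Interface.single]

/-- Because `v ≠ w` the write is a change of the actuator, not a `τ`-step; otherwise it could be
performed silently and the node would not block time. -/
theorem device_set {n : S.Node} {h : S.Loc} {a : S.Act} {v w : S.Val} (hvw : v ≠ w)
    {l : NLabel S} {X : Net S} : NetStep (device n h a v (.set a w)) l X ↔
      l = .act a ∧ X = device n h a w .nil := by
  constructor
  · intro hX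
    cases hX with
    | pos _ _ _ h | sensRead _ _ _ _ h | locCom _ _ _ _ h | snd _ _ _ _ h | rcv _ _ _ _ h => cases h
    | actUnChg _ _ _ ha h =>
      cases h
      rw [Interface.single_act_self] at ha
      exact absurd (Option.some.inj ha) hvw
    | actChg _ _ _ ha h =>
      cases h
      rw [Interface.setAct_single]
      exact ⟨rfl, rfl⟩
  · rintro ⟨rfl, rfl⟩
    have := NetStep.actChg n .stat h (I := .single a v) (a := a) (v := w)
      (by rw [Interface.single_act_self]; exact fun e => hvw (Option.some.inj e))
      (.actuator a w .nil)
    rwa [Interface.setAct_single] at this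

theorem device_set_timeStep {n : S.Node} {h : S.Loc} {a : S.Act} {v w : S.Val} (X : Net S) :
    ¬ TimeStep (device n h a v (.set a w)) X := by
  rw [device_timeStep]
  rintro ⟨P', ⟨r, hP⟩, _⟩
  cases hP

theorem device_nil_inert (n : S.Node) (h : S.Loc) (a : S.Act) (v : S.Val) :
    Inert (device n h a v .nil) where
  silent := device_silent fun l P' h => by cases h
  time X := by
    rw [device_timeStep]
    constructor
    · rintro ⟨P', ⟨r, hP⟩, rfl⟩
      cases hP
      rfl
    · rintro rfl
      exact ⟨_, ⟨0, .timeNil 0⟩, rfl⟩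
  update := device_update n h a v .nil

theorem device_sleep_timeStep {n : S.Node} {h : S.Loc} {a : S.Act} {v : S.Val} {P : Proc S}
    (X : Net S) : TimeStep (device n h a v (.pre .sleep P)) X ↔ X = device n h a v P := by
  rw [device_timeStep]
  constructor
  · rintro ⟨P', ⟨r, hP⟩, rfl⟩
    cases hP
    rfl
  · rintro rfl
    exact ⟨_, ⟨0, .delay 0 _⟩, rfl⟩

theorem device_sleep_silent {n : S.Node} {h : S.Loc} {a : S.Act} {v : S.Val} {P : Proc S} :
    ∀ l X, ¬ NetStep (device n h a v (.pre .sleep P)) l X :=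
  device_silent fun l P' h => by cases h

/-- Neither the name `n` nor the actuator `a` occurs in the network. -/
def Fresh (n : S.Node) (a : S.Act) (M : Net S) : Prop := n ∉ M.names ∧ ¬ M.HasAct a

/-- A well-formed network has finitely many nodes, each with a finite interface, so the infinite
supplies of names and actuators are not exhausted. -/
theorem exists_fresh {M N : Net S} (hM : M.WF) (hN : N.WF) :
    ∃ n a, Fresh n a M ∧ Fresh n a N := by
  have fin {M : Net S} (hM : M.WF) : {a | M.HasAct a}.Finite := by
    have : {a | M.HasAct a} = ⋃ x ∈ {x | x ∈ M.nodes}, {a | (x.iface.act a).isSome} := by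
      ext a; simp [Net.HasAct]
    rw [this]
    exact (List.finite_toSet _).biUnion fun x hx => (hM.1 x hx).finite_act
  have := S.infinite_node
  have := S.infinite_act
  obtain ⟨n, hn⟩ := ((List.finite_toSet M.names).union (List.finite_toSet N.names)).exists_notMem
  obtain ⟨a, ha⟩ := ((fin hM).union (fin hN)).exists_notMem
  simp only [Set.mem_union, not_or] at hn ha
  exact ⟨n, a, ⟨hn.1, ha.1⟩, ⟨hn.2, ha.2⟩⟩

theorem Fresh.wf_par {n : S.Node} {a : S.Act} {M : Net S} (hf : Fresh n a M) (hM : M.WF)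
    (h : S.Loc) (v : S.Val) {P : Proc S} (hc : P.Closed 0 0) (hg : P.RecGuarded)
    (hu : P.UsesOnly (.single a v)) : (Net.par (device n h a v P) M).WF := by
  refine Net.wf_par_iff.2 ⟨⟨?_, List.pairwise_singleton _ _⟩, hM, ?_⟩
  · intro x hx
    obtain rfl := List.mem_singleton.1 hx
    refine ⟨by simp [Interface.single], ?_, hc, hg, hu, fun _ _ _ => rfl⟩
    simp only [Interface.single_act_isSome]
    exact Set.finite_singleton a
  · intro x hx y hy
    obtain rfl := List.mem_singleton.1 hx
    refine ⟨fun e => hf.1 (List.mem_map.2 ⟨y, hy, e.symm⟩), fun b hb => ?_, fun s _ hs => ?_⟩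
    · obtain rfl := Interface.single_act_isSome.1 hb.1
      exact hf.2 ⟨y, hy, hb.2⟩
    · exact absurd hs.1 (by simp [Interface.single])

theorem Proc.set_usesOnly (a : S.Act) (v w : S.Val) : (Proc.set a w).UsesOnly (.single a v) :=
  ⟨Interface.single_act_isSome.2 rfl, trivial⟩

theorem Fresh.wf_blocker {n : S.Node} {a : S.Act} {M : Net S} (hf : Fresh n a M) (hM : M.WF)
    (h : S.Loc) (v w : S.Val) : (Net.par (device n h a v (.set a w)) M).WF :=
  hf.wf_par hM h v ⟨trivial, trivial⟩ trivial (Proc.set_usesOnly a v w)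

theorem device_set_quiet {n : S.Node} {h : S.Loc} {a : S.Act} {v w : S.Val} (hvw : v ≠ w) :
    Quiet (device n h a v (.set a w)) := fun _ _ hX => ⟨a, ((device_set hvw).1 hX).1⟩

/-! ### Observations in the current time unit -/

/-- A blocker confines the weak barb to `τ`-steps, which change neither interfaces nor locations, so
the barb is already there. Neither the blocker nor `K` can be its owner, because `a` belongs to `M`.
-/
theorem NetCong.strongBarb {K M N : Net S} (h : NetCong (.par K M) (.par K N)) {a : S.Act}
    {k : S.Loc} {v : S.Val} (hM : M.Barb a k v) : N.Barb a k v := by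
  obtain ⟨v₀, v₁, hv⟩ := S.nontrivial_val
  obtain ⟨n, b, hfM, hfN⟩ := exists_fresh h.1 h.2.1
  have hB := hfM.wf_blocker h.1 k v₀ v₁
  have h' := h.par_left hB (hfN.wf_blocker h.2.1 k v₀ v₁)
  obtain ⟨x, hx, hxa, hxk⟩ := Net.barb_iff.1 hM
  have hact : M.HasAct a := ⟨x, hx, by rw [hxa]; rfl⟩
  have hact' : (Net.par K M).HasAct a := ⟨x, List.mem_append_right _ hx, by rw [hxa]; rfl⟩
  obtain ⟨Y, hY, hb⟩ := h'.barb (Net.barb_iff.2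
    ⟨x, List.mem_append_right _ (List.mem_append_right _ hx), hxa, hxk⟩)
  obtain ⟨W, hW, rfl⟩ := (device_set_quiet hv).lSteps device_set_timeStep hY
  obtain ⟨y, hy, hya, hyk⟩ := Net.barb_iff.1 hb
  rcases List.mem_append.1 hy with hy | hy
  · exact absurd hact' (hB.not_hasAct_right ⟨y, hy, by rw [hya]; rfl⟩)
  · have := List.mem_map_of_mem (f := NodeData.frame) hy
    -- The node displaying the barb had the same interface and location before the `τ`-steps.
    rw [hW.map_frame] at this
    obtain ⟨z, hz, hzy⟩ := List.mem_map.1 this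
    simp only [NodeData.frame, Prod.mk.injEq] at hzy
    rw [← hzy.2.1] at hya
    rw [← hzy.2.2.2] at hyk
    rcases List.mem_append.1 hz with hz | hz
    · exact absurd hact (h.1.not_hasAct_right ⟨z, hz, by rw [hya]; rfl⟩)
    · exact Net.barb_iff.2 ⟨z, hz, hya, hyk⟩

variable [Nonempty S.Loc]

/-- With a blocker present, the reductions before the matching change are `τ`-steps. The change
itself is not due to the blocker, whose actuator is fresh for `M` and hence differs from `a`. -/
theorem NetCong.weakAct {M N M' : Net S} (h : NetCong M N) {a : S.Act}
    (hM : NetStep M (.act a) M') : ∃ N₁ N₂, TauSteps N N₁ ∧ NetStep N₁ (.act a) N₂ := by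
  obtain ⟨v, w, hvw⟩ := S.nontrivial_val
  obtain ⟨n, b, hfM, hfN⟩ := exists_fresh h.1 h.2.1
  let k : S.Loc := Classical.arbitrary _
  have h' := h.par_left (hfM.wf_blocker h.1 k v w) (hfN.wf_blocker h.2.1 k v w)
  obtain ⟨N₁, N₂, _, h₁, h₂, _⟩ := h'.act (.parR _ hM)
  obtain ⟨N₁, hN, rfl⟩ := (device_set_quiet hvw).lSteps device_set_timeStep h₁
  cases h₂ with
  | parL _ h₂ =>
    obtain ⟨⟨⟩, _⟩ := (device_set hvw).1 h₂
    exact absurd (hM.hasAct h.1) hfM.2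
  | parR _ h₂ => exact ⟨_, _, hN, h₂⟩

end Devices

/-! ### Timers, which count time units, and probes, which detect communications -/

section Timers

variable {S : Sig.{u}}

/-- A context which does nothing in the current time unit, and which blocks the passage of time in
the next one until it changes the actuator `a`; after that it is inert. -/
structure Timer (a : S.Act) (K₀ K₁ K₂ : Net S) : Prop where
  silent : ∀ l X, ¬ NetStep K₀ l X
  time : ∀ X, TimeStep K₀ X ↔ X = K₁
  step : ∀ l X, NetStep K₁ l X ↔ l = .act a ∧ X = K₂
  block : ∀ X, ¬ TimeStep K₁ X
  inert : Inert K₂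
  hasAct₀ : K₀.HasAct a
  hasAct₁ : K₁.HasAct a
  update : ∀ s h v, K₀.update s h v = K₀

theorem Net.HasAct.par_right {M : Net S} {a : S.Act} (h : M.HasAct a) (N : Net S) :
    (Net.par N M).HasAct a :=
  h.imp fun _ hx => ⟨List.mem_append_right _ hx.1, hx.2⟩

theorem Inert.par {G G' : Net S} (h : Inert G) (h' : Inert G') : Inert (.par G G') where
  silent := silent_par h.silent h'.silent
  time X := by simp only [timeStep_par_iff, h.time, h'.time]; aesop
  update s k v := by simp only [Net.update, h.update, h'.update]

namespace Timer

variable {a : S.Act} {K₀ K₁ K₂ : Net S}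

theorem device {v w : S.Val} (hvw : v ≠ w) (n : S.Node) (h : S.Loc) (a : S.Act) :
    Timer a (device n h a v (.pre .sleep (.set a w))) (CaIT.device n h a v (.set a w))
      (CaIT.device n h a w .nil) where
  silent := device_sleep_silent
  time := device_sleep_timeStep
  step _ _ := device_set hvw
  block := device_set_timeStep
  inert := device_nil_inert n h a w
  hasAct₀ := device_hasAct ..
  hasAct₁ := device_hasAct ..
  update := device_update _ _ _ _ _

/-- Lets a timer absorb the inert remains of earlier timers and probes, so that these never have to
be removed from a congruence. -/
theorem par (t : Timer a K₀ K₁ K₂) {G : Net S} (hG : Inert G) :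
    Timer a (.par G K₀) (.par G K₁) (.par G K₂) where
  silent := silent_par hG.silent t.silent
  time X := by simp only [timeStep_par_iff, hG.time, t.time]; aesop
  step l X := by
    constructor
    · intro h
      obtain ⟨X', hX, rfl⟩ := h.par_silent hG.silent
      obtain ⟨rfl, rfl⟩ := (t.step _ _).1 hX
      exact ⟨rfl, rfl⟩
    · rintro ⟨rfl, rfl⟩
      exact .parR _ ((t.step _ _).2 ⟨rfl, rfl⟩)
  block X := by
    rw [timeStep_par_iff]
    rintro ⟨_, _, _, h, _⟩
    exact t.block _ h
  inert := hG.par t.inert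
  hasAct₀ := t.hasAct₀.par_right G
  hasAct₁ := t.hasAct₁.par_right G
  update s k v := by simp only [Net.update, hG.update, t.update]

variable (t : Timer a K₀ K₁ K₂)

include t

theorem quiet₀ : Quiet K₀ := fun l X h => absurd h (t.silent l X)

theorem quiet₁ : Quiet K₁ := fun l X h => ⟨a, ((t.step l X).1 h).1⟩

theorem netTime {U U' : Net S} (h : NetTime U U') : NetTime (.par K₀ U) (.par K₁ U') := by
  rw [netTime_iff] at *
  refine ⟨.par ((t.time _).2 rfl) h.1, fun ⟨O, hO⟩ => h.2 ?_⟩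
  obtain ⟨U', hU, _⟩ := hO.par_silent t.silent
  exact ⟨U', hU⟩

theorem netTime_inv {U X : Net S} (h : NetTime (.par K₀ U) X) :
    ∃ U', NetTime U U' ∧ X = .par K₁ U' := by
  rw [netTime_iff] at h
  obtain ⟨K', U', hK, hU, rfl⟩ := timeStep_par_iff.1 h.1
  obtain rfl := (t.time _).1 hK
  exact ⟨U', netTime_iff.2 ⟨hU, fun ⟨_, hO⟩ => h.2 ⟨_, .parR _ hO⟩⟩, rfl⟩

/-- At most one time unit can pass, since `K₁` blocks the next, and the state of the timer tells
whether it has passed. -/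
theorem lSteps {V Y : Net S} (h : LSteps (.par K₀ V) Y) :
    (∃ V', TauSteps V V' ∧ Y = .par K₀ V') ∨
      ∃ V₁ V₂ V', TauSteps V V₁ ∧ NetTime V₁ V₂ ∧ TauSteps V₂ V' ∧ Y = .par K₁ V' := by
  induction h with
  | refl => exact .inl ⟨V, .refl, rfl⟩
  | tail _ h ih =>
    rcases ih with ⟨V', hV, rfl⟩ | ⟨V₁, V₂, V', h₁, h₂, h₃, rfl⟩
    · rcases h with h | h
      · obtain ⟨V'', hV'', rfl⟩ := t.quiet₀.tau h
        exact .inl ⟨V'', .tail hV hV'', rfl⟩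
      · obtain ⟨V'', hV'', rfl⟩ := t.netTime_inv h
        exact .inr ⟨V', V'', V'', hV, hV'', .refl, rfl⟩
    · rcases h with h | h
      · obtain ⟨V'', hV'', rfl⟩ := t.quiet₁.tau h
        exact .inr ⟨V₁, V₂, V'', h₁, h₂, .tail h₃ hV'', rfl⟩
      · obtain ⟨_, _, h, _, _⟩ := timeStep_par_iff.1 (netTime_iff.1 h).1
        exact absurd h (t.block _)

/-- `K₁` can change `a` at once. By `NetCong.weakAct` the other side would have to do so after
`τ`-steps only; but these leave `K₀` in place, which is silent, and `V` does not own `a`. -/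
theorem not_netCong [Nonempty S.Loc] {U V : Net S} :
    ¬ NetCong (.par K₁ U) (.par K₀ V) := by
  intro h
  obtain ⟨Y, Z, hY, hZ⟩ := h.weakAct (.parL U ((t.step _ _).2 ⟨rfl, rfl⟩))
  obtain ⟨V', _, rfl⟩ := t.quiet₀.tauSteps hY
  have hwf := hY.wf h.2.1
  obtain ⟨_, hV, _⟩ := hZ.par_silent t.silent
  exact hwf.not_hasAct_right t.hasAct₀ (hV.hasAct (Net.wf_par_iff.1 hwf).2.1)

variable [Nonempty S.Loc] {U V U' : Net S}

theorem lSteps_of_netCong {Y : Net S} (hY : LSteps (.par K₀ V) Y) (h : NetCong (.par K₀ U) Y) :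
    ∃ V', TauSteps V V' ∧ Y = .par K₀ V' := by
  rcases t.lSteps hY with h' | ⟨V₁, V₂, V', _, _, _, rfl⟩
  · exact h'
  · exact absurd h.symm t.not_netCong

theorem tau (h : NetCong (.par K₀ U) (.par K₀ V)) (hU : NetStep U .tau U') :
    ∃ V', TauSteps V V' ∧ NetCong (.par K₀ U') (.par K₀ V') := by
  obtain ⟨Y, hY, h'⟩ := h.lStep (.inl (.parR K₀ hU))
  obtain ⟨V', hV, rfl⟩ := t.lSteps_of_netCong hY h'
  exact ⟨V', hV, h'⟩

/-- The timer owns `a`, so `b ≠ a` and the matching change is made by `V`. If time passed before it,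
the timer would be left in state `K₁`, and if time passed afterwards, `K₁` would be reached as well;
both contradict `not_netCong`. -/
theorem act (h : NetCong (.par K₀ U) (.par K₀ V)) {b : S.Act} (hU : NetStep U (.act b) U') :
    ∃ V₁ V₂ V', TauSteps V V₁ ∧ NetStep V₁ (.act b) V₂ ∧ TauSteps V₂ V' ∧
      NetCong (.par K₀ U') (.par K₀ V') := by
  have hba : b ≠ a := by
    rintro rfl
    exact h.1.not_hasAct_right t.hasAct₀ (hU.hasAct (Net.wf_par_iff.1 h.1).2.1)
  obtain ⟨Y₁, Y₂, Y, h₁, h₂, h₃, h'⟩ := h.act (.parR K₀ hU)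
  rcases t.lSteps h₁ with ⟨V₁, hV₁, rfl⟩ | ⟨_, _, V₁, _, _, _, rfl⟩
  · obtain ⟨V₂, hV₂, rfl⟩ := h₂.par_silent t.silent
    obtain ⟨V', hV', rfl⟩ := t.lSteps_of_netCong h₃ h'
    exact ⟨V₁, V₂, V', hV₁, hV₂, hV', h'⟩
  · cases h₂ with
    | parL _ h₂ => exact absurd (NLabel.act.inj ((t.step _ _).1 h₂).1) hba
    | parR _ h₂ =>
      obtain ⟨V', _, rfl⟩ := t.quiet₁.lSteps t.block h₃
      exact absurd h'.symm t.not_netCong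

/-- A time step leads to `K₁`, so the match contains exactly one time step. But `K₁` is no longer a
timer; a second node that sleeps for two units is therefore added beforehand. After the step it is
itself a timer, and changing `a` turns the old one into an inert part of the new context. -/
theorem netTime_match (h : NetCong (.par K₀ U) (.par K₀ V)) (hU : NetTime U U') :
    ∃ (b : S.Act) (L₀ L₁ L₂ V₁ V₂ V' : Net S), Timer b L₀ L₁ L₂ ∧ TauSteps V V₁ ∧ NetTime V₁ V₂ ∧
      TauSteps V₂ V' ∧ NetCong (.par L₀ U') (.par L₀ V') := by
  obtain ⟨v, w, hvw⟩ := S.nontrivial_val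
  obtain ⟨n, b, hfU, hfV⟩ := exists_fresh h.1 h.2.1
  let k : S.Loc := Classical.arbitrary _
  -- One sleep is used up by the time step to be matched; the other makes `D₁` a timer for the
  -- following unit.
  let D₀ := CaIT.device n k b v (.pre .sleep (.pre .sleep (.set b w)))
  let D₁ := CaIT.device n k b v (.pre .sleep (.set b w))
  have hD₀ : ∀ l X, ¬ NetStep D₀ l X := device_sleep_silent
  have hD₁ : Timer b D₁ _ _ := Timer.device hvw n k b
  have hDU : (Net.par D₀ (.par K₀ U)).WF :=
    hfU.wf_par h.1 k v ⟨trivial, trivial, trivial, trivial⟩ trivial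
      ⟨trivial, trivial, Proc.set_usesOnly b v w⟩
  have hDV : (Net.par D₀ (.par K₀ V)).WF :=
    hfV.wf_par h.2.1 k v ⟨trivial, trivial, trivial, trivial⟩ trivial
      ⟨trivial, trivial, Proc.set_usesOnly b v w⟩
  have perm (A B C : Net S) : (Net.par A (.par B C)).nodes.Perm (Net.par B (.par A C)).nodes := by
    simp only [Net.nodes]
    rw [← List.append_assoc, ← List.append_assoc]
    exact List.perm_append_comm.append_right _
  have h₀ : NetCong (.par K₀ (.par D₀ U)) (.par K₀ (.par D₀ V)) :=
    (h.par_left hDU hDV).congr (.par_left_comm _ _ _) (.par_left_comm _ _ _)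
      (hDU.of_perm (perm _ _ _)) (hDV.of_perm (perm _ _ _))
  have hDt {U U' : Net S} (hU : NetTime U U') : NetTime (.par D₀ U) (.par D₁ U') := by
    rw [netTime_iff] at *
    refine ⟨.par ((device_sleep_timeStep _).2 rfl) hU.1, fun ⟨O, hO⟩ => hU.2 ?_⟩
    obtain ⟨U', hO, _⟩ := hO.par_silent hD₀
    exact ⟨U', hO⟩
  obtain ⟨Y, hY, h₁⟩ := h₀.lStep (.inr (t.netTime (hDt hU)))
  rcases t.lSteps hY with ⟨_, _, rfl⟩ | ⟨W₁, W₂, W₃, hW₁, hW₂, hW₃, rfl⟩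
  · exact absurd h₁ t.not_netCong
  have hD₀q : Quiet D₀ := fun l X h => absurd h (hD₀ l X)
  obtain ⟨V₁, hV₁, rfl⟩ := hD₀q.tauSteps hW₁
  obtain ⟨_, V₂, hD, hV₂, rfl⟩ := timeStep_par_iff.1 (netTime_iff.1 hW₂).1
  obtain rfl := (device_sleep_timeStep _).1 hD
  have hV₂ : NetTime V₁ V₂ :=
    netTime_iff.2 ⟨hV₂, fun ⟨_, hO⟩ => (netTime_iff.1 hW₂).2 ⟨_, .parR _ hO⟩⟩
  obtain ⟨V₃, hV₃, rfl⟩ := hD₁.quiet₀.tauSteps hW₃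
  -- The used timer is discharged. Before the matching change `K₁` still blocks time, and the change
  -- is made by `K₁`, the owner of `a`.
  obtain ⟨Y₁, Y₂, Y₃, k₁, k₂, k₃, h₂⟩ := h₁.act (.parL _ ((t.step _ _).2 ⟨rfl, rfl⟩))
  have hwf := k₁.wf h₁.2.1
  obtain ⟨W₄, hW₄, rfl⟩ := t.quiet₁.lSteps t.block k₁
  obtain ⟨V₄, hV₄, rfl⟩ := hD₁.quiet₀.tauSteps hW₄
  cases k₂ with
  | parR _ k₂ =>
    exact absurd (k₂.hasAct (Net.wf_par_iff.1 hwf).2.1) (hwf.not_hasAct_right t.hasAct₁)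
  | parL _ k₂ =>
    have e₂ := ((t.step _ _).1 k₂).2
    rw [e₂] at k₂ k₃
    -- From here on `K₂ | D₁` takes the part of the timer, and it excludes a passage of time after
    -- the change.
    have t' := hD₁.par t.inert
    obtain ⟨Z, hZ, e⟩ := k₃.netEq (.symm (.par_assoc _ _ _))
    have hwf' : (Net.par (Net.par K₂ D₁) V₄).WF :=
      ((NetStep.parL _ k₂).wf hwf).of_perm (by simp only [Net.nodes, List.append_assoc]; rfl)
    have h₃ : NetCong (.par (.par K₂ D₁) U') Z :=
      h₂.congr (.symm (.par_assoc _ _ _)) e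
        (h₂.1.of_perm (by simp only [Net.nodes, List.append_assoc]; rfl)) (hZ.wf hwf')
    obtain ⟨V', hV', rfl⟩ := t'.lSteps_of_netCong hZ h₃
    exact ⟨b, _, _, _, V₁, V₂, V', t', hV₁, hV₂, hV₃.trans (hV₄.trans hV'), h₃⟩

end Timer

/-! ### Observation of communications -/

/-- A context `T₀` which by a communication described by `Co` with value `w` becomes `T₁ w`, which
can change the actuator `b` provided that `w = v`. -/
structure Probe (b : S.Act) (v : S.Val) (Co : S.Val → Net S → Net S → Prop) (T₀ : Net S)
    (T₁ : S.Val → Net S) (T₂ : Net S) : Prop where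
  tau : ∀ V X, NetStep (.par T₀ V) .tau X →
    (∃ V', NetStep V .tau V' ∧ X = .par T₀ V') ∨ ∃ w V', Co w V V' ∧ X = .par (T₁ w) V'
  com : ∀ V V', Co v V V' → NetStep (.par T₀ V) .tau (.par (T₁ v) V')
  no_act : ∀ a X, ¬ NetStep T₀ (.act a) X
  step : ∀ {w V V' l X}, Co w V V' → NetStep (T₁ w) l X → w = v ∧ l = .act b ∧ X = T₂
  act : NetStep (T₁ v) (.act b) T₂
  inert : Inert T₂
  hasAct₀ : T₀.HasAct b
  hasAct₁ : ∀ w, (T₁ w).HasAct b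

variable {a b : S.Act} {v : S.Val} {Co : S.Val → Net S → Net S → Prop} {T₀ T₂ : Net S}
  {T₁ : S.Val → Net S} {K₀ K₁ K₂ U U' V : Net S}

theorem Probe.tauSteps (p : Probe b v Co T₀ T₁ T₂) {X : Net S} (h : TauSteps (.par T₀ V) X) :
    (∃ V', TauSteps V V' ∧ X = .par T₀ V') ∨
      ∃ w V₁ V₂ V', TauSteps V V₁ ∧ Co w V₁ V₂ ∧ TauSteps V₂ V' ∧ X = .par (T₁ w) V' := by
  induction h with
  | refl => exact .inl ⟨V, .refl, rfl⟩
  | tail _ h ih =>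
    rcases ih with ⟨V', hV, rfl⟩ | ⟨w, V₁, V₂, V', h₁, h₂, h₃, rfl⟩
    · rcases p.tau _ _ h with ⟨V'', hV'', rfl⟩ | ⟨w, V'', hV'', rfl⟩
      · exact .inl ⟨V'', .tail hV hV'', rfl⟩
      · exact .inr ⟨w, V', V'', V'', hV, hV'', .refl, rfl⟩
    · have hq : Quiet (T₁ w) := fun l X h => ⟨b, (p.step h₂ h).2.1⟩
      obtain ⟨V'', hV'', rfl⟩ := hq.tau h
      exact .inr ⟨w, V₁, V₂, V'', h₁, h₂, .tail h₃ hV'', rfl⟩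

/-- The communication of `U` with the probe and the ensuing change of `b` are matched in turn,
without time passing. As only the probe owns `b`, and it can change `b` only after a communication
with value `v`, such a communication occurs in the match. The spent probe joins the timer. -/
theorem Probe.detect [Nonempty S.Loc] (p : Probe b v Co T₀ T₁ T₂) (t : Timer a K₀ K₁ K₂)
    (h : NetCong (.par K₀ U) (.par K₀ V)) (hU : Co v U U') (hTU : (Net.par T₀ (.par K₀ U)).WF)
    (hTV : (Net.par T₀ (.par K₀ V)).WF) :
    ∃ V₁ V₂ V', TauSteps V V₁ ∧ Co v V₁ V₂ ∧ TauSteps V₂ V' ∧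
      NetCong (.par (.par T₂ K₀) U') (.par (.par T₂ K₀) V') := by
  have perm (A B C : Net S) : (Net.par A (.par B C)).nodes.Perm (Net.par B (.par A C)).nodes := by
    simp only [Net.nodes]
    rw [← List.append_assoc, ← List.append_assoc]
    exact List.perm_append_comm.append_right _
  have h₀ : NetCong (.par K₀ (.par T₀ U)) (.par K₀ (.par T₀ V)) :=
    (h.par_left hTU hTV).congr (.par_left_comm _ _ _) (.par_left_comm _ _ _)
      (hTU.of_perm (perm _ _ _)) (hTV.of_perm (perm _ _ _))
  obtain ⟨W₁, hW₁, h₁⟩ := t.tau h₀ (p.com _ _ hU)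
  obtain ⟨W₂, W₃, W₄, hW₂, hW₃, hW₄, h₂⟩ := t.act h₁ (.parL _ p.act)
  -- The matching communication may occur in either of the two matches, so all `τ`-steps before the
  -- change are considered together.
  have hW₂ := hW₁.trans hW₂
  have hwf := hW₂.wf (Net.wf_par_iff.1 h₀.2.1).2.1
  rcases p.tauSteps hW₂ with ⟨V₁, hV₁, rfl⟩ | ⟨w, V₁, V₂, V₃, hV₁, hV₂, hV₃, rfl⟩
  · cases hW₃ with
    | parL _ hW₃ => exact absurd hW₃ (p.no_act _ _)
    | parR _ hW₃ =>
      exact absurd (hW₃.hasAct (Net.wf_par_iff.1 hwf).2.1) (hwf.not_hasAct_right p.hasAct₀)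
  · cases hW₃ with
    | parR _ hW₃ =>
      exact absurd (hW₃.hasAct (Net.wf_par_iff.1 hwf).2.1) (hwf.not_hasAct_right (p.hasAct₁ w))
    | parL _ hW₃ =>
      -- The ability to change `b` identifies the communicated value.
      obtain ⟨rfl, _, e₂⟩ := p.step hV₂ hW₃
      rw [e₂] at hW₄
      obtain ⟨V₄, hV₄, rfl⟩ := p.inert.quiet.tauSteps hW₄
      have e (A : Net S) : NetEq (.par K₀ (.par T₂ A)) (.par (.par T₂ K₀) A) :=
        .trans (.par_left_comm _ _ _) (.symm (.par_assoc _ _ _))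
      have q (A : Net S) : (Net.par K₀ (.par T₂ A)).nodes.Perm (Net.par (.par T₂ K₀) A).nodes := by
        refine (perm _ _ _).trans ?_
        simp only [Net.nodes, List.append_assoc]
        rfl
      exact ⟨V₁, V₂, V₄, hV₁, hV₂, hV₃.trans hV₄,
        h₂.congr (e _) (e _) (h₂.1.of_perm (q _)) (h₂.2.1.of_perm (q _))⟩

/-- The probe which emits `v` along `c` at `k`. -/
theorem Probe.emitter {v₀ v₁ : S.Val} (hv : v₀ ≠ v₁) (n : S.Node) (k : S.Loc) (b : S.Act)
    (c : S.Chan) (v : S.Val) :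
    Probe b v (fun w M N => w = v ∧ ∃ h, NetStep M (.rcv c w h) N ∧ S.InRange c k h)
      (device n k b v₀ (.timeout (.out c (.val v)) (.set b v₁) .nil))
      (fun _ => device n k b v₀ (.set b v₁)) (device n k b v₁ .nil) where
  tau V X hX := by
    cases hX with
    | glbComL h h' hr =>
      cases h with
      | snd _ _ _ _ h => cases h; exact .inr ⟨v, _, ⟨rfl, _, h', hr.symm⟩, rfl⟩
    | glbComR h _ _ =>
      cases h with
      | rcv _ _ _ _ h => cases h
    | parL _ h => cases h <;> cases ‹ProcStep _ _ _›
    | parR _ h => exact .inl ⟨_, h, rfl⟩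
  com V V' := by
    rintro ⟨_, h, hV, hr⟩
    exact .glbComL (.snd _ _ _ _ (.sndP c v _ _) hr.nonneg) hV hr.symm
  no_act a X hX := by
    cases hX with
    | actChg _ _ _ _ h => cases h
  step h hX := ⟨h.1, (device_set hv).1 hX⟩
  act := (device_set hv).2 ⟨rfl, rfl⟩
  inert := device_nil_inert ..
  hasAct₀ := device_hasAct ..
  hasAct₁ _ := device_hasAct ..

open Classical in
/-- The process which sets `b` to `v₁`, provided that `e` evaluates to `v`. -/
noncomputable def Proc.setIf (v : S.Val) (e : Expr S) (b : S.Act) (v₁ : S.Val) : Proc S :=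
  .cond ⟨fun l => decide (l = [v]), [e]⟩ (.set b v₁) .nil

/-- For a wrong value the conditional becomes `nil`, so a receiver that got it never signals. -/
theorem Proc.setIf_step {v w : S.Val} {v₁ : S.Val} {l : PLabel S} {P : Proc S} :
    ProcStep (.setIf v (.val w) b v₁) l P ↔ w = v ∧ ProcStep (.set b v₁) l P := by
  constructor
  · intro h
    cases h with
    | condT _ hb h =>
      obtain ⟨vs, e, hv⟩ := hb
      obtain rfl : vs = [v] := by simpa using hv
      cases e
      exact ⟨rfl, h⟩
    | condF _ _ h => cases h
  · rintro ⟨rfl, h⟩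
    exact .condT _ ⟨[w], rfl, by simp⟩ h

theorem device_setIf {n : S.Node} {k : S.Loc} {v w v₀ v₁ : S.Val} {l : NLabel S} {X : Net S} :
    NetStep (device n k b v₀ (.setIf v (.val w) b v₁)) l X ↔
      w = v ∧ NetStep (device n k b v₀ (.set b v₁)) l X := by
  constructor
  · intro hX
    cases hX with
    | pos _ _ _ h => exact (Proc.setIf_step.1 h).imp_right (.pos _ _ _)
    | sensRead _ _ _ hI h => exact (Proc.setIf_step.1 h).imp_right (.sensRead _ _ _ hI)
    | actUnChg _ _ _ hI h => exact (Proc.setIf_step.1 h).imp_right (.actUnChg _ _ _ hI)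
    | locCom _ _ _ _ h => exact (Proc.setIf_step.1 h).imp_right (.locCom _ _ _ _)
    | actChg _ _ _ hI h => exact (Proc.setIf_step.1 h).imp_right (.actChg _ _ _ hI)
    | snd _ _ _ _ h hc => exact (Proc.setIf_step.1 h).imp_right (.snd _ _ _ _ · hc)
    | rcv _ _ _ _ h hc => exact (Proc.setIf_step.1 h).imp_right (.rcv _ _ _ _ · hc)
  · rintro ⟨rfl, hX⟩
    cases hX with
    | pos _ _ _ h => exact .pos _ _ _ (Proc.setIf_step.2 ⟨rfl, h⟩)
    | sensRead _ _ _ hI h => exact .sensRead _ _ _ hI (Proc.setIf_step.2 ⟨rfl, h⟩)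
    | actUnChg _ _ _ hI h => exact .actUnChg _ _ _ hI (Proc.setIf_step.2 ⟨rfl, h⟩)
    | locCom _ _ _ _ h => exact .locCom _ _ _ _ (Proc.setIf_step.2 ⟨rfl, h⟩)
    | actChg _ _ _ hI h => exact .actChg _ _ _ hI (Proc.setIf_step.2 ⟨rfl, h⟩)
    | snd _ _ _ _ h hc => exact .snd _ _ _ _ (Proc.setIf_step.2 ⟨rfl, h⟩) hc
    | rcv _ _ _ _ h hc => exact .rcv _ _ _ _ (Proc.setIf_step.2 ⟨rfl, h⟩) hc

/-- The probe which at `k` waits for the value `v` along `c`. -/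
theorem Probe.receiver {v₀ v₁ : S.Val} (hv : v₀ ≠ v₁) (n : S.Node) (k : S.Loc) (b : S.Act)
    (c : S.Chan) (v : S.Val) :
    Probe b v (fun w M N => ∃ h, NetStep M (.snd c w h) N ∧ S.InRange c h k)
      (device n k b v₀ (.timeout (.inp c) (.setIf v (.var 0) b v₁) .nil))
      (fun w => device n k b v₀ (.setIf v (.val w) b v₁)) (device n k b v₁ .nil) where
  tau V X hX := by
    cases hX with
    | glbComL h _ _ =>
      cases h with
      | snd _ _ _ _ h => cases h
    | glbComR h h' hr =>
      cases h with
      | rcv _ _ _ _ h => cases h; exact .inr ⟨_, _, ⟨_, h', hr.symm⟩, rfl⟩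
    | parL _ h => cases h <;> cases ‹ProcStep _ _ _›
    | parR _ h => exact .inl ⟨_, h, rfl⟩
  com V V' := by
    rintro ⟨_, hV, hr⟩
    exact .glbComR (.rcv _ _ _ _ (.rcvP c v _ _) hr.nonneg) hV hr.symm
  no_act a X hX := by
    cases hX with
    | actChg _ _ _ _ h => cases h
  step _ hX := ⟨(device_setIf.1 hX).1, (device_set hv).1 (device_setIf.1 hX).2⟩
  act := device_setIf.2 ⟨rfl, (device_set hv).2 ⟨rfl, rfl⟩⟩
  inert := device_nil_inert ..
  hasAct₀ := device_hasAct ..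
  hasAct₁ _ := device_hasAct ..

end Timers

/-! ### The bisimulation, and the case without locations -/

section Completeness

variable {S : Sig.{u}}

/-- The candidate bisimulation: congruence in the presence of a timer. -/
def TimedCong (M N : Network S) : Prop :=
  ∃ (a : S.Act) (K₀ K₁ K₂ : Net S), Timer a K₀ K₁ K₂ ∧ NetCong (.par K₀ M.1) (.par K₀ N.1)

theorem TimedCong.symm {M N : Network S} : TimedCong M N → TimedCong N M
  | ⟨a, K₀, K₁, K₂, t, h⟩ => ⟨a, K₀, K₁, K₂, t, h.symm⟩

theorem TauSteps.tauMany {M N : Net S} (h : TauSteps M N) (hM : M.WF) :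
    Network.TauMany ⟨M, hM⟩ ⟨N, h.wf hM⟩ := by
  induction h with
  | refl => exact .refl
  | tail h₁ h ih => exact .tail ih (.tau h)

theorem Network.weakTrans_of_step {M : Network S} {α : ELabel S} {M₁ M₂ M₃ : Net S}
    (h₁ : TauSteps M.1 M₁) (h₂ : ExtStep M₁ α M₂) (hM₂ : M₂.WF) (h₃ : TauSteps M₂ M₃)
    (hα : α ≠ .tau) : M.WeakTrans α ⟨M₃, h₃.wf hM₂⟩ :=
  .inr ⟨hα, ⟨M₁, h₁.wf M.2⟩, ⟨M₂, hM₂⟩, h₁.tauMany M.2, h₂, h₃.tauMany hM₂⟩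

/-- Contextuality provides the initial timer, with a name and an actuator fresh for both networks.
-/
theorem RBCongruent.timedCong [Nonempty S.Loc] {M N : Network S} (h : RBCongruent M N) :
    TimedCong M N := by
  obtain ⟨v, w, hvw⟩ := S.nontrivial_val
  obtain ⟨n, a, hM, hN⟩ := exists_fresh M.2 N.2
  let k : S.Loc := Classical.arbitrary _
  exact ⟨a, _, _, _, Timer.device hvw n k a, NetCong.par_left ⟨M.2, N.2, h⟩
    (hM.wf_par M.2 k v ⟨trivial, trivial, trivial⟩ trivial ⟨trivial, Proc.set_usesOnly a v w⟩)
    (hN.wf_par N.2 k v ⟨trivial, trivial, trivial⟩ trivial ⟨trivial, Proc.set_usesOnly a v w⟩)⟩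

/-- Each kind of label has its own observer, and each match ends with congruence beside a timer: the
same one, a renewed one after a time step, or one enlarged by a spent probe after a communication.
-/
theorem timedCong_isBisimulation [Nonempty S.Loc] :
    IsBisimulation (TimedCong (S := S)) := by
  refine ⟨fun _ _ => TimedCong.symm, ?_⟩
  rintro M N ⟨a, K₀, K₁, K₂, t, h⟩ α M' hα
  obtain ⟨v₀, v₁, hv⟩ := S.nontrivial_val
  obtain ⟨n, b, hfM, hfN⟩ := exists_fresh h.1 h.2.1
  obtain ⟨M', hM'⟩ := M'
  cases hα with
  | tau hM =>
    obtain ⟨V, hV, h'⟩ := t.tau h hM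
    exact ⟨⟨V, hV.wf N.2⟩, .inl ⟨rfl, hV.tauMany N.2⟩, a, K₀, K₁, K₂, t, h'⟩
  | act hM =>
    obtain ⟨V₁, V₂, V, h₁, h₂, h₃, h'⟩ := t.act h hM
    exact ⟨⟨V, _⟩, Network.weakTrans_of_step h₁ (.act h₂) (h₂.wf (h₁.wf N.2)) h₃ (by nofun),
      a, K₀, K₁, K₂, t, h'⟩
  | sigma hM =>
    obtain ⟨b, L₀, L₁, L₂, V₁, V₂, V, t', h₁, h₂, h₃, h'⟩ := t.netTime_match h hM
    exact ⟨⟨V, _⟩, Network.weakTrans_of_step h₁ (.sigma h₂) (h₂.wf (h₁.wf N.2)) h₃ (by nofun),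
      b, L₀, L₁, L₂, t', h'⟩
  | @sndObs _ c v l k hM hr =>
    -- The probe stands at the location `k` of the label. The matching sender may be at another
    -- location than `l`, as long as `k` is in range, which is exactly what the extensional label
    -- records.
    have p := Probe.receiver hv n k b c v
    have hc : (Proc.timeout (.inp c) (.setIf v (.var 0) b v₁) .nil).Closed 0 0 :=
      ⟨trivial, ⟨by simp [Guard.Closed, Expr.Closed, Pi.arity], ⟨trivial, trivial⟩, trivial⟩,
        trivial⟩
    obtain ⟨V₁, V₂, V, h₁, ⟨_, h₂, hr'⟩, h₃, h'⟩ := p.detect t h ⟨l, hM, hr⟩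
      (hfM.wf_par h.1 k v₀ hc
        ⟨⟨trivial, trivial⟩, trivial⟩
        ⟨⟨Proc.set_usesOnly b v₀ v₁, trivial⟩, trivial⟩)
      (hfN.wf_par h.2.1 k v₀ hc
        ⟨⟨trivial, trivial⟩, trivial⟩
        ⟨⟨Proc.set_usesOnly b v₀ v₁, trivial⟩, trivial⟩)
    exact ⟨⟨V, _⟩, Network.weakTrans_of_step h₁ (.sndObs h₂ hr') (h₂.wf (h₁.wf N.2)) h₃ (by nofun),
      _, _, _, _, t.par p.inert, h'⟩
  | @rcvObs _ c v l k hM hr =>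
    have p := Probe.emitter hv n k b c v
    obtain ⟨V₁, V₂, V, h₁, ⟨_, _, h₂, hr'⟩, h₃, h'⟩ := p.detect t h ⟨rfl, l, hM, hr⟩
      (hfM.wf_par h.1 k v₀ ⟨trivial, ⟨trivial, trivial⟩, trivial⟩ ⟨trivial, trivial⟩
        ⟨Proc.set_usesOnly b v₀ v₁, trivial⟩)
      (hfN.wf_par h.2.1 k v₀ ⟨trivial, ⟨trivial, trivial⟩, trivial⟩ ⟨trivial, trivial⟩
        ⟨Proc.set_usesOnly b v₀ v₁, trivial⟩)
    exact ⟨⟨V, _⟩, Network.weakTrans_of_step h₁ (.rcvObs h₂ hr') (h₂.wf (h₁.wf N.2)) h₃ (by nofun),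
      _, _, _, _, t.par p.inert, h'⟩
  | @sensEnv s v k hs =>
    have h' := h.update s k hs
    -- The timer has no sensors, so the update affects only the two networks.
    simp only [Net.update, t.update] at h'
    exact ⟨N.update s k v, Network.weakTrans_of_step .refl (.sensEnv N.1 k hs) (N.2.update s k v) .refl (by nofun),
      a, K₀, K₁, K₂, t, h'⟩
  | actEnv hM =>
    exact ⟨N, Network.weakTrans_of_step .refl (.actEnv (h.strongBarb hM)) N.2 .refl (by nofun),
      a, K₀, K₁, K₂, t, h⟩

/-! ### Networks without nodes -/

theorem NetStep.nonempty_loc {M N : Net S} {l : NLabel S} (h : NetStep M l N) : Nonempty S.Loc := by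
  induction h with
  | pos _ _ _ _ | sensRead _ _ _ _ _ | actUnChg _ _ _ _ _ | locCom _ _ _ _ _ | actChg _ _ _ _ _
  | snd _ _ _ _ _ _ | rcv _ _ _ _ _ _ => exact ⟨‹_›⟩
  | _ => assumption

theorem Net.netTime_self [IsEmpty S.Loc] (M : Net S) : NetTime M M := by
  induction M with
  | zero => exact .timeZero
  | node _ _ _ _ h => exact isEmptyElim h
  | par M N ih₁ ih₂ =>
    exact .timePar ih₁ ih₂ fun ⟨_, h⟩ => not_isEmpty_iff.2 h.nonempty_loc ‹_›
  | res c M ih => exact .res c ih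

/-- Without locations there are no nodes, and time is the only thing that can pass; the total
relation is a bisimulation. -/
theorem bisimilar_of_isEmpty_loc [IsEmpty S.Loc] (M N : Network S) : Bisimilar M N := by
  have key {A B : Net S} {l : NLabel S} (h : NetStep A l B) : False :=
    not_isEmpty_iff.2 h.nonempty_loc ‹_›
  refine ⟨fun _ _ => True, ⟨fun _ _ _ => trivial, fun M N _ α M' hα => ⟨N, ?_, trivial⟩⟩, trivial⟩
  obtain ⟨M', hM'⟩ := M'
  cases hα with
  | tau h | act h | sndObs h _ | rcvObs h _ => exact (key h).elim
  | sensEnv _ _ | actEnv h => exact isEmptyElim ‹S.Loc›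
  | sigma _ => exact .inr ⟨nofun, N, N, .refl, .sigma N.1.netTime_self, .refl⟩

end Completeness

end CaIT

theorem mainTheorem2 (S : CaIT.Sig.{u}) (M N : CaIT.Network S)
    (h : CaIT.RBCongruent M N) : CaIT.Bisimilar M N := by
  -- Timers and probes are nodes, and placing them takes a location.
  rcases isEmpty_or_nonempty S.Loc with _ | _
  · exact CaIT.bisimilar_of_isEmpty_loc M N
  · exact ⟨_, CaIT.timedCong_isBisimulation, h.timedCong⟩
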